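/- Let $\alpha\ge 1$, $\beta\ge 0$, $-1\le\theta<0$, $0<T\le\infty$, and write $\Lambda^s=(-\Delta)^{s/2}$ (Fourier symbol $|\xi|^s$). Let $u_0\in L^2_\sigma(\mathbb R^3)$ and let $u\in L^\infty(0,T;L^2_\sigma(\mathbb R^3))\cap L^2(0,T;H^\alpha(\mathbb R^3))$ be a Leray–Hopf weak solution of $$u_t+(-\Delta)^\alpha u+(u\cdot\nabla)u+\nabla \pi=0,\qquad \operatorname{div}u=0,\qquad u(\cdot,0)=u_0\qquad\text{on }\mathbb R^3\times(0,T),$$ that is: (i) $\int_0^T\big[(\psi_\tau+(u\cdot\nabla)\psi,u)-(u,\Lambda^{2\alpha}\psi)\big]\,d\tau=-(u_0,\psi(0))$ for all divergence-free vector fields $\psi\in C_0^\infty([0,T)\times\mathbb R^3)$; (ii) $\frac12\|u(t)\|_{L^2}^2+\int_0^t\|\Lambda^\alpha u(\tau)\|_{L^2}^2\,d\tau\le\frac12\|u_0\|_{L^2}^2$ for all $t\in(0,T)$; (iii) $\|u(t)-u_0\|_{L^2}\to0$ as $t\to0^+$. For $0\le s<3/m$ let $\dot W^{s,m}=\{f\in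 L^{m^*}(\mathbb R^3):\Lambda^s f\in L^m(\mathbb R^3)\}$, $\frac1{m^*}=\frac1m-\frac s3$, with norm $\|\Lambda^s f\|_{L^m}$. For a function $\varphi$ put $\|\varphi\|_{\mathcal M(\dot W^{s,m}\to L^r)}=\sup_{0\ne f\in\dot W^{s,m}}\|\varphi f\|_{L^r}/\|f\|_{\dot W^{s,m}}$, and for the matrix field $\nabla u$ let $\|\nabla u\|_{\mathcal M^3}$ be the square root of the sum of the squares of the norms of its entries. Suppose that $$\nabla u\in L^p\big(0,T;\mathcal M^3(\dot W^{\frac{1+\theta}{1+\beta},\frac{6-3\theta}{3-\theta^2}}\to L^{\frac{12-6\theta}{9-5\theta}})\big),\qquad u\in L^q\big(0,T;L^{\frac{12-6\theta}{3-\theta}}(\mathbb R^3)\big),$$ where $\frac1p+\frac1q=\frac12$ and $2\le p\le\infty$ (so that $q$ ranges over $2\le q\le\infty$). Then, after redefinition on a null set of times, $u$ is weakly continuous on $[0,T)$ with values in $L^2$, and the weakly continuous version of $u$ satisfies the energy equality $$\frac12\|u(t)\|_{L^2}^2+\int_0^t\|\Lambda^\alpha u(\tau)\|_{L^2}^2\,d\tau=\frac12\|u_0\|_{L^2}^2\qquad\text{for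 every }0\le t<T.$$ -/

import Mathlib

open MeasureTheory Set Filter Topology FourierTransform
open scoped ENNReal NNReal ContDiff SchwartzMap

noncomputable section

namespace FracNS

/-- Physical space `ℝ³` with its Euclidean norm. -/
abbrev R3 := EuclideanSpace ℝ (Fin 3)

/-- Real vector fields in `L²(ℝ³; ℝ³)`. -/
abbrev L2V := Lp R3 2 (volume : Measure R3)

/-- The `i`-th standard basis vector of `ℝ³`. -/
def e (i : Fin 3) : R3 := EuclideanSpace.single i 1

/-! ### The operator `Λ^s = (-Δ)^(s/2)`, with symbol `|ξ|^s`

Mathlib's Fourier transform is `𝓕 f ξ = ∫ exp (-2πi ⟨x, ξ⟩) f x dx`, for which the frequency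
variable of the symbol is `2πξ`. -/

/-- The symbol of `Λ^s` in Mathlib's normalization: `|2πξ|^s`. -/
def symb (s : ℝ) (ξ : R3) : ℝ := (2 * Real.pi * ‖ξ‖) ^ s

/-- `Λ^s φ`, for a rapidly decaying smooth function `φ` and `s ≥ 0`. -/
def frac (s : ℝ) (φ : R3 → ℂ) : R3 → ℂ :=
  𝓕⁻ (fun ξ => (symb s ξ : ℂ) * 𝓕 φ ξ)

/-- The (`L²`) Fourier transform of the `j`-th component of an `L²` vector field. -/
def fhat (f : L2V) (j : Fin 3) : Lp ℂ 2 (volume : Measure R3) :=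
  𝓕 ((Complex.ofRealCLM.comp (EuclideanSpace.proj (𝕜 := ℝ) j)).compLp f)

/-- `‖Λ^α f‖²_{L²}` for an `L²` vector field, by Plancherel (`∞` if `Λ^α f ∉ L²`). -/
def fracNormSq (α : ℝ) (f : L2V) : ℝ≥0∞ :=
  ∑ j, ∫⁻ ξ, ENNReal.ofReal (symb α ξ ^ 2) * ‖fhat f j ξ‖ₑ ^ 2

/-- The norm of `H^α(ℝ³; ℝ³)` (`∞` if the field is not in `H^α`). -/
def sobolevNorm (α : ℝ) (f : L2V) : ℝ≥0∞ :=
  (∑ j, ∫⁻ ξ, ENNReal.ofReal ((1 + (2 * Real.pi * ‖ξ‖) ^ 2) ^ α) * ‖fhat f j ξ‖ₑ ^ 2)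
    ^ (1 / 2 : ℝ)

/-! ### Homogeneous Sobolev spaces and multiplier spaces -/

/-- `Λ^s f = g` in the sense of distributions. -/
def HasFrac (s : ℝ) (f g : R3 → ℝ) : Prop :=
  ∀ φ : 𝓢(R3, ℂ), ∫ x, (f x : ℂ) * frac s φ x = ∫ x, (g x : ℂ) * φ x

/-- For `0 ≤ s < 3/m` and `1 < m < ∞`: the norm `‖Λ^s f‖_{L^m}` of the homogeneous Sobolev space
`Ẇ^{s,m}(ℝ³)`, in its standard realization as a Banach space of tempered distributions,
`Ẇ^{s,m} = {f ∈ L^{m*} : Λ^s f ∈ L^m}`, where `1/m* = 1/m - s/3`.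
The value is `∞` if `f` is not in the space. (`g = Λ^s f` is unique almost everywhere.) -/
def homSobolevNorm (s m : ℝ) (f : R3 → ℝ) : ℝ≥0∞ :=
  ⨅ (g : R3 → ℝ) (_ : MemLp f (ENNReal.ofReal (3 * m / (3 - s * m))) volume ∧
    MemLp g (ENNReal.ofReal m) volume ∧ HasFrac s f g),
    eLpNorm g (ENNReal.ofReal m) volume

/-- The norm of `φ` in the multiplier space `𝓜(X → Y)`, namely the supremum of
`‖φ f‖_Y / ‖f‖_X` over `f ∈ X`, `f ≠ 0`. Function spaces are given through their extended norms,
which are `∞` outside the space, and `φ ∈ 𝓜(X → Y)` means that this norm is finite. -/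
def multNorm (X Y : (R3 → ℝ) → ℝ≥0∞) (φ : R3 → ℝ) : ℝ≥0∞ :=
  ⨆ (f : R3 → ℝ) (_ : X f < ⊤) (_ : ¬ f =ᵐ[volume] 0), Y (fun x => φ x * f x) / X f

/-- The multiplier norm of a matrix field: the square root of the sum of the squares of the
multiplier norms of its entries. -/
def multNormMat (X Y : (R3 → ℝ) → ℝ≥0∞) (G : Fin 3 → Fin 3 → R3 → ℝ) : ℝ≥0∞ :=
  (∑ i, ∑ j, multNorm X Y (G i j) ^ 2) ^ (1 / 2 : ℝ)

/-- The norm of `𝓜(Ẇ^{s,m} → L^r)` of a matrix field. -/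
def sobMultNorm (s m r : ℝ) (G : Fin 3 → Fin 3 → R3 → ℝ) : ℝ≥0∞ :=
  multNormMat (homSobolevNorm s m) (fun h => eLpNorm h (ENNReal.ofReal r) volume) G

/-! ### Weak derivatives -/

/-- `G = ∇f` in the sense of distributions, `G i j = ∂ᵢ fⱼ`. -/
def IsWeakGrad (f : L2V) (G : Fin 3 → Fin 3 → R3 → ℝ) : Prop :=
  ∀ i j, LocallyIntegrable (G i j) volume ∧
    ∀ φ : R3 → ℝ, ContDiff ℝ ∞ φ → HasCompactSupport φ →
      ∫ x, f x j * fderiv ℝ φ x (e i) = - ∫ x, G i j x * φ x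

/-- `div f = 0` in the sense of distributions; the `L²` fields with this property form `L²_σ`. -/
def IsDivFree (f : L2V) : Prop :=
  ∀ φ : R3 → ℝ, ContDiff ℝ ∞ φ → HasCompactSupport φ → ∫ x, fderiv ℝ φ x (f x) = 0

/-! ### Leray-Hopf weak solutions of the fractional Navier-Stokes equations -/

/-- The open time interval `(0, T)`, with `T = ∞` allowed. -/
def openTime (T : ℝ≥0∞) : Set ℝ := {t | 0 < t ∧ ENNReal.ofReal t < T}

/-- The half-open time interval `[0, T)`, with `T = ∞` allowed. -/
def halfTime (T : ℝ≥0∞) : Set ℝ := {t | 0 ≤ t ∧ ENNReal.ofReal t < T}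

/-- Divergence-free test fields in `C₀^∞([0, T) × ℝ³; ℝ³)`. Smoothness up to `t = 0` is expressed
by taking restrictions of smooth fields that are defined for all real times. -/
structure IsTestField (T : ℝ≥0∞) (ψ : ℝ → R3 → R3) : Prop where
  smooth : ContDiff ℝ ∞ (fun z : ℝ × R3 => ψ z.1 z.2)
  compact : HasCompactSupport (fun z : ℝ × R3 => ψ z.1 z.2)
  supp : tsupport (fun z : ℝ × R3 => ψ z.1 z.2) ⊆ {z | ENNReal.ofReal z.1 < T}
  div_free : ∀ t x, ∑ i, (fderiv ℝ (ψ t) x (e i)) i = 0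

/-- The pairing `(f, Λ^s ψ)` of an `L²` field with `Λ^s` of a real test field. -/
def pairFrac (s : ℝ) (f : L2V) (ψ : R3 → R3) : ℝ :=
  ∑ j, ∫ x, f x j * (frac s (fun y => ((ψ y j : ℝ) : ℂ)) x).re

/-- `(ψ_τ, u) + ((u·∇)ψ, u) - (u, Λ^{2α} ψ)` at the time `τ = t`. -/
def weakIntegrand (α : ℝ) (u : ℝ → L2V) (ψ : ℝ → R3 → R3) (t : ℝ) : ℝ :=
  (∫ x, inner ℝ (deriv (fun τ => ψ τ x) t) (u t x))
    + (∫ x, inner ℝ (fderiv ℝ (ψ t) x (u t x)) (u t x))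
    - pairFrac (2 * α) (u t) (ψ t)

/-- `½‖u(t)‖² + ∫₀ᵗ ‖Λ^α u(τ)‖² dτ`. -/
def totalEnergy (α : ℝ) (u : ℝ → L2V) (t : ℝ) : ℝ≥0∞ :=
  ‖u t‖ₑ ^ 2 / 2 + ∫⁻ τ in Ioc 0 t, fracNormSq α (u τ)

/-- Leray-Hopf weak solutions on `(0, T)` of `u_t + Λ^{2α} u + (u·∇)u + ∇π = 0`, `div u = 0`,
`u(0) = u₀`. -/
structure IsLerayHopf (α : ℝ) (T : ℝ≥0∞) (u₀ : L2V) (u : ℝ → L2V) : Prop where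
  div_free_initial : IsDivFree u₀
  mem_Linfty_L2 : MemLp u ∞ (volume.restrict (openTime T))
  div_free : ∀ᵐ t ∂(volume.restrict (openTime T)), IsDivFree (u t)
  mem_L2_H : MemLp (fun t => sobolevNorm α (u t)) 2 (volume.restrict (openTime T))
  weak_form : ∀ ψ, IsTestField T ψ →
    ∫ t in openTime T, weakIntegrand α u ψ t = - ∫ x, inner ℝ (u₀ x) (ψ 0 x)
  energy_ineq : ∀ t ∈ openTime T, totalEnergy α u t ≤ ‖u₀‖ₑ ^ 2 / 2
  initial : Tendsto u (𝓝[>] 0) (𝓝 u₀)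

/-- `v` is a version of `u` (they agree at almost every time in `(0, T)`) that is weakly
continuous in `L²` on `[0, T)`. -/
def IsWeaklyContVersion (T : ℝ≥0∞) (u v : ℝ → L2V) : Prop :=
  (∀ᵐ t ∂(volume.restrict (openTime T)), v t = u t) ∧
    ∀ w : L2V, ContinuousOn (fun t => inner ℝ (v t) w) (halfTime T)

end FracNS

end

/-! The energy equality is formally the equation tested with u itself. The obstacle is the trilinear
term ∫ (u·∇)u·u, which vanishes formally but need not converge absolutely. The test field is
therefore the twofold mollification W = η ⋆ η ⋆ u. Since div u = 0, one has ∫ (u·∇)W·W = 0, so the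
trilinear term equals ∫ (u·∇)W·(u - W), which is small if it can be bounded in a norm in which W
converges to u.

The multiplier hypothesis gives this bound. The exponents a = (12-6θ)/(3-θ) and r = (12-6θ)/(9-5θ)
are conjugate, so Hölder's inequality pairs u in L^a with the products of ∇W and u - W in L^r.
Because the controlling norms are invariant under translation, the mollified gradient obeys the same
multiplier estimate as ∇u. It remains to bound u - W in Ẇ^{s,m}, which is done by its norm in L^a ∩
H¹, where mollification converges; H¹ is available because α ≥ 1. This is
`IsMollifier.enorm_trilinear_le`. In time, the term is dominated by a multiple of A·B·(B + ‖u‖ +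
9N), where A is the multiplier norm of ∇u, B the L^a norm of u and N its H^α norm. Since 1/p + 1/q =
1/2, the product AB is in L², and the last factor is in L² on bounded intervals because q ≥ 2.
Dominated convergence removes the nonlinear term.

The embedding L^a ∩ H¹ → Ẇ^{s,m} (`exists_homSobolevNorm_le`) is of Gagliardo-Nirenberg type and
rests on 1/m = (1+θ)/2 + (-θ)/a; the order s = (1+θ)/(1+β) may be below 1+θ because f is also in L².
For 0 < s < 1 the operator Λ^s is a singular integral of differences. Splitting it at |z| = R and
optimizing in R bounds it pointwise by (|f| + Mf)^(1-s) (M|∇f|)^s with M the maximal function;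
Hölder's inequality and the maximal theorem finish the estimate.

The weak formulation is used only with test fields χ(t) (η ⋆ K), where K is a compactly supported
curl. These determine an L² field up to the orthogonal complement of the curls. In Fourier variables
such a complement is parallel to ξ, while divergence-free fields are orthogonal to ξ. Hence the
projection `leray` fixes divergence-free fields, and η ⋆ u agrees almost everywhere with the
primitive, in L², of a bounded function. Its squared norm then satisfies an exact identity at every
time (`IsLerayHopf.norm_mollified_sq`). Its dissipation converges by Plancherel, so the squared norm
of the mollified solution converges at every t to ‖u₀‖² - 2∫₀ᵗ‖Λ^α u‖².

These limits also yield the weakly continuous version. At each t the mollified solutions are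
bounded, and since mollifications commute, a weak limit point v(t) satisfies η_n ⋆ v(t) = the n-th
mollified solution at t. For any weakly continuous version the same relation holds at every time, so
‖v(t)‖² is the limit just computed. -/

open scoped LineDeriv

namespace FracNS

/-! ### The Hardy-Littlewood maximal function (dyadic radii) -/

/-- Hardy-Littlewood maximal function over closed balls of dyadic radii, normalized by the cube of
the radius. -/
noncomputable def maxFn (f : R3 → ℝ≥0∞) (x : R3) : ℝ≥0∞ :=
  ⨆ k : ℤ, (∫⁻ y in Metric.closedBall x ((2 : ℝ) ^ k), f y) / ENNReal.ofReal (((2 : ℝ) ^ k) ^ 3)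

theorem measurable_setLIntegral_closedBall {f : R3 → ℝ≥0∞} (hf : Measurable f) (r : ℝ) :
    Measurable fun x => ∫⁻ y in Metric.closedBall x r, f y := by
  have : (fun x => ∫⁻ y in Metric.closedBall x r, f y) =
      fun x => ∫⁻ y, ({p : R3 × R3 | dist p.2 p.1 ≤ r}.indicator (fun p => f p.2)) (x, y) := by
    funext x
    rw [← lintegral_indicator Metric.isClosed_closedBall.measurableSet]
    rfl
  rw [this]
  refine Measurable.lintegral_prod_right' (f := {p : R3 × R3 | dist p.2 p.1 ≤ r}.indicator
    (fun p => f p.2)) ?_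
  refine (hf.comp measurable_snd).indicator ?_
  exact (isClosed_le (by fun_prop) continuous_const).measurableSet

theorem measurable_maxFn {f : R3 → ℝ≥0∞} (hf : Measurable f) : Measurable (maxFn f) :=
  Measurable.iSup fun _ => (measurable_setLIntegral_closedBall hf _).div_const _

/-- Rounding r up to a power of 2 at most doubles it, which costs 2 ^ 3 = 8. Restricting the
supremum to dyadic radii makes it countable, so that `maxFn` is measurable. -/
theorem setLIntegral_closedBall_le_maxFn (f : R3 → ℝ≥0∞) (x : R3) {r : ℝ} (hr : 0 < r) :
    ∫⁻ y in Metric.closedBall x r, f y ≤ 8 * ENNReal.ofReal (r ^ 3) * maxFn f x := by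
  obtain ⟨k, hk1, hk2⟩ := exists_mem_Ico_zpow hr (by norm_num : (1 : ℝ) < 2)
  set R : ℝ := (2 : ℝ) ^ (k + 1) with hR
  have hR0 : 0 < R := by positivity
  have hR2 : R ≤ 2 * r := by
    rw [hR, zpow_add₀ (by norm_num)]; simp; linarith
  have h1 : ∫⁻ y in Metric.closedBall x r, f y ≤ ∫⁻ y in Metric.closedBall x R, f y :=
    lintegral_mono_set (Metric.closedBall_subset_closedBall hk2.le)
  have h2 : (∫⁻ y in Metric.closedBall x R, f y) / ENNReal.ofReal (R ^ 3) ≤ maxFn f x :=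
    le_iSup (fun k : ℤ => (∫⁻ y in Metric.closedBall x ((2 : ℝ) ^ k), f y) /
      ENNReal.ofReal (((2 : ℝ) ^ k) ^ 3)) (k + 1)
  have hne : ENNReal.ofReal (R ^ 3) ≠ 0 := by
    rw [Ne, ENNReal.ofReal_eq_zero, not_le]; positivity
  rw [ENNReal.div_le_iff hne ENNReal.ofReal_ne_top] at h2
  calc _ ≤ maxFn f x * ENNReal.ofReal (R ^ 3) := h1.trans h2
    _ ≤ maxFn f x * ENNReal.ofReal (8 * r ^ 3) := by
        gcongr
        calc R ^ 3 ≤ (2 * r) ^ 3 := by gcongr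
          _ = _ := by ring
    _ = _ := by
        rw [ENNReal.ofReal_mul (by norm_num)]; simp; ring

theorem volume_closedBall_R3 (x : R3) {r : ℝ} (hr : 0 ≤ r) :
    volume (Metric.closedBall x r) = ENNReal.ofReal (r ^ 3) * volume (Metric.ball (0 : R3) 1) := by
  rw [Measure.addHaar_closedBall _ _ hr]; simp

/-- The maximal function is normalized by r ^ 3 rather than by the volume of the ball, so a constant
c contributes c times the volume of the unit ball. -/
theorem maxFn_add_const_le {f g : R3 → ℝ≥0∞} (c : ℝ≥0∞) (hg : Measurable g)
    (h : ∀ x, f x ≤ g x + c) (x : R3) :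
    maxFn f x ≤ maxFn g x + c * volume (Metric.ball (0 : R3) 1) := by
  refine iSup_le fun k => ?_
  have hne : ENNReal.ofReal (((2 : ℝ) ^ k) ^ 3) ≠ 0 := by
    rw [Ne, ENNReal.ofReal_eq_zero, not_le]; positivity
  have h1 : ∫⁻ y in Metric.closedBall x ((2 : ℝ) ^ k), f y ≤
      (∫⁻ y in Metric.closedBall x ((2 : ℝ) ^ k), g y) +
        c * (ENNReal.ofReal (((2 : ℝ) ^ k) ^ 3) * volume (Metric.ball (0 : R3) 1)) := by
    calc _ ≤ ∫⁻ y in Metric.closedBall x ((2 : ℝ) ^ k), (g y + c) := lintegral_mono fun y => h y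
      _ = _ := by
        rw [lintegral_add_left hg, setLIntegral_const, volume_closedBall_R3 _ (by positivity)]
  refine (ENNReal.div_le_div_right h1 _).trans ?_
  rw [ENNReal.add_div]
  gcongr
  · exact le_iSup (fun k : ℤ => (∫⁻ y in Metric.closedBall x ((2 : ℝ) ^ k), g y) /
      ENNReal.ofReal (((2 : ℝ) ^ k) ^ 3)) k
  · rw [ENNReal.div_le_iff hne ENNReal.ofReal_ne_top]
    exact le_of_eq (by ring)

/-- The weak type `(1,1)` inequality. -/
theorem mul_volume_lt_maxFn_le (f : R3 → ℝ≥0∞) {l : ℝ≥0∞} (hl : l ≠ 0) (hl' : l ≠ ⊤) :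
    l * volume {x | l < maxFn f x} ≤ 125 * volume (Metric.ball (0 : R3) 1) * ∫⁻ x, f x := by
  set c := volume (Metric.ball (0 : R3) 1) with hc
  have hc0 : c ≠ 0 := (Metric.measure_ball_pos _ _ one_pos).ne'
  by_cases hI : ∫⁻ x, f x = ⊤
  · rw [hI, ENNReal.mul_top (mul_ne_zero (by norm_num) hc0)]; exact le_top
  have hex : ∀ x : R3, ∃ k : ℤ, l < maxFn f x →
      l * ENNReal.ofReal (((2 : ℝ) ^ k) ^ 3) ≤ ∫⁻ y in Metric.closedBall x ((2 : ℝ) ^ k), f y := by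
    intro x
    by_cases hx : l < maxFn f x
    · obtain ⟨k, hk⟩ := lt_iSup_iff.1 hx
      have hne : ENNReal.ofReal (((2 : ℝ) ^ k) ^ 3) ≠ 0 := by
        rw [Ne, ENNReal.ofReal_eq_zero, not_le]; positivity
      exact ⟨k, fun _ => (ENNReal.le_div_iff_mul_le (Or.inl hne)
        (Or.inl ENNReal.ofReal_ne_top)).1 hk.le⟩
    · exact ⟨0, fun h => absurd h hx⟩
  choose k hk using hex
  set r : R3 → ℝ := fun x => (2 : ℝ) ^ (k x) with hr
  have hr0 : ∀ x, 0 < r x := fun x => by positivity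
  set t : Set R3 := {x | l < maxFn f x} with ht
  -- A radius r > 1 satisfies l * r ≤ l * r ^ 3 ≤ ∫ f. The chosen radii are therefore bounded, as
  -- the Vitali covering lemma requires.
  have hbound : ∀ x ∈ t, r x ≤ max 1 ((∫⁻ x, f x) / l).toReal := by
    intro x hx
    by_cases h1 : r x ≤ 1
    · exact h1.trans (le_max_left _ _)
    refine le_trans ?_ (le_max_right _ _)
    have h2 : l * ENNReal.ofReal (r x) ≤ ∫⁻ x, f x := by
      refine le_trans ?_ ((hk x hx).trans (setLIntegral_le_lintegral _ _))
      gcongr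
      exact le_self_pow₀ (not_le.1 h1).le (by norm_num)
    rw [← ENNReal.ofReal_le_iff_le_toReal (ENNReal.div_ne_top hI hl),
      ENNReal.le_div_iff_mul_le (Or.inl hl) (Or.inl hl'), mul_comm]
    exact h2
  -- Disjoint balls whose fivefold enlargements cover the superlevel set; 5 ^ 3 = 125 is the
  -- constant in the bound.
  obtain ⟨u, hut, hdisj, hcov⟩ := Vitali.exists_disjoint_subfamily_covering_enlargement_closedBall
    t id r _ hbound 5 (by norm_num)
  have hucount : u.Countable := by
    refine hdisj.countable_of_nonempty_interior fun x _ => ?_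
    exact ⟨x, Metric.ball_subset_interior_closedBall (Metric.mem_ball_self (hr0 x))⟩
  have hsub : t ⊆ ⋃ b ∈ u, Metric.closedBall b (5 * r b) := by
    intro x hx
    obtain ⟨b, hb, hxb⟩ := hcov x hx
    exact mem_biUnion hb (hxb (Metric.mem_closedBall_self (hr0 x).le))
  have : Countable u := hucount.to_subtype
  calc l * volume t ≤ l * ∑' b : u, volume (Metric.closedBall (b : R3) (5 * r b)) := by
        gcongr
        exact (measure_mono hsub).trans (measure_biUnion_le _ hucount _)
    _ = ∑' b : u, 125 * c * (l * ENNReal.ofReal (r b ^ 3)) := by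
        rw [← ENNReal.tsum_mul_left]
        congr 1; funext b
        rw [volume_closedBall_R3 _ (by have := hr0 b; positivity), mul_pow,
          ENNReal.ofReal_mul (by positivity), ← hc,
          show ENNReal.ofReal ((5 : ℝ) ^ 3) = 125 by norm_num]
        ring
    _ ≤ ∑' b : u, 125 * c * ∫⁻ y in Metric.closedBall (b : R3) (r b), f y := by
        gcongr with b
        exact hk b (hut b.2)
    _ = 125 * c * ∑' b : u, ∫⁻ y in Metric.closedBall (b : R3) (r b), f y := by
        rw [ENNReal.tsum_mul_left]
    _ = 125 * c * ∫⁻ y in ⋃ b ∈ u, Metric.closedBall (b : R3) (r b), f y := by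
        have := lintegral_biUnion (μ := volume) hucount (fun b _ =>
          (Metric.isClosed_closedBall (x := b) (ε := r b)).measurableSet) hdisj f
        rw [this]
    _ ≤ _ := by gcongr; exact Measure.restrict_le_self

/-! ### Layer cake formulas and the strong type bound for the maximal function -/

/-- One half of the layer cake formula for `[0, ∞]`-valued functions. -/
theorem rpow_le_lintegral_indicator {p : ℝ} (hp : 0 < p) (y : ℝ≥0∞) :
    y ^ p ≤ ∫⁻ l in Ioi (0 : ℝ), ENNReal.ofReal (p * l ^ (p - 1)) *
      (Iio y).indicator 1 (ENNReal.ofReal l) := by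
  -- Only finite levels are computed. For y = ⊤ they make the right side larger than every real
  -- number.
  have key : ∀ N : ℝ≥0, (N : ℝ≥0∞) ≤ y → (N : ℝ≥0∞) ^ p ≤ ∫⁻ l in Ioi (0 : ℝ),
      ENNReal.ofReal (p * l ^ (p - 1)) * (Iio y).indicator 1 (ENNReal.ofReal l) := by
    intro N hN
    have h1 : (N : ℝ≥0∞) ^ p = ∫⁻ l in Ioo (0 : ℝ) N, ENNReal.ofReal (p * l ^ (p - 1)) := by
      rw [restrict_Ioo_eq_restrict_Ioc, ← ofReal_integral_eq_lintegral_ofReal]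
      · rw [← intervalIntegral.integral_of_le N.coe_nonneg, intervalIntegral.integral_const_mul,
          integral_rpow (Or.inl (by linarith))]
        rw [sub_add_cancel, Real.zero_rpow hp.ne', sub_zero, mul_div_cancel₀ _ hp.ne',
          ← ENNReal.ofReal_rpow_of_nonneg N.coe_nonneg hp.le, ENNReal.ofReal_coe_nnreal]
      · exact ((intervalIntegral.intervalIntegrable_rpow' (by linarith)).const_mul p).1
      · filter_upwards [ae_restrict_mem measurableSet_Ioc] with l hl
        have := hl.1
        exact mul_nonneg hp.le (Real.rpow_nonneg this.le _)
    rw [h1]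
    calc _ = ∫⁻ l in Ioo (0 : ℝ) N, ENNReal.ofReal (p * l ^ (p - 1)) *
          (Iio y).indicator 1 (ENNReal.ofReal l) := by
          refine setLIntegral_congr_fun measurableSet_Ioo fun l hl => ?_
          have : ENNReal.ofReal l ∈ Iio y := by
            refine lt_of_lt_of_le ?_ hN
            rw [← ENNReal.ofReal_coe_nnreal]
            exact (ENNReal.ofReal_lt_ofReal_iff (hl.1.trans hl.2)).2 hl.2
          simp [indicator_of_mem this]
      _ ≤ _ := lintegral_mono_set Ioo_subset_Ioi_self
  rcases eq_or_ne y ⊤ with rfl | hy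
  · rw [ENNReal.top_rpow_of_pos hp, top_le_iff]
    refine ENNReal.eq_top_of_forall_nnreal_le fun N => ?_
    refine le_trans ?_ (key (N ^ (1 / p)) le_top)
    rw [← ENNReal.coe_rpow_of_nonneg _ hp.le, ← NNReal.rpow_mul, one_div_mul_cancel hp.ne',
      NNReal.rpow_one]
  · lift y to ℝ≥0 using hy
    exact key y le_rfl

/-- The other half of the layer cake formula. It is applied with q = p - 1, one power of the level
being spent on the weak type bound. -/
theorem lintegral_rpow_Iio_le {q : ℝ} (hq : 0 < q) (y : ℝ≥0∞) :
    ∫⁻ l in Ioi (0 : ℝ), ENNReal.ofReal (l ^ (q - 1)) *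
      (Iio y).indicator 1 (ENNReal.ofReal l) ≤ ENNReal.ofReal (1 / q) * y ^ q := by
  rcases eq_or_ne y ⊤ with rfl | hy
  · rw [ENNReal.top_rpow_of_pos hq, ENNReal.mul_top]
    · exact le_top
    · rw [Ne, ENNReal.ofReal_eq_zero, not_le]; positivity
  lift y to ℝ≥0 using hy
  calc _ = ∫⁻ l in Ioi (0 : ℝ), (Ioo (0 : ℝ) y).indicator
          (fun l => ENNReal.ofReal (l ^ (q - 1))) l := by
        refine setLIntegral_congr_fun measurableSet_Ioi fun l hl => ?_
        have hl : 0 < l := hl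
        by_cases h : l < y
        · have : ENNReal.ofReal l ∈ Iio (y : ℝ≥0∞) := by
            show ENNReal.ofReal l < (y : ℝ≥0∞)
            rw [← ENNReal.ofReal_coe_nnreal]
            exact (ENNReal.ofReal_lt_ofReal_iff (hl.trans h)).2 h
          simp only [indicator_of_mem this]
          rw [indicator_of_mem (show l ∈ Ioo (0 : ℝ) y from ⟨hl, h⟩)]
          simp
        · have : ENNReal.ofReal l ∉ Iio (y : ℝ≥0∞) := by
            show ¬ ENNReal.ofReal l < (y : ℝ≥0∞)
            rw [← ENNReal.ofReal_coe_nnreal, not_lt]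
            exact ENNReal.ofReal_le_ofReal (not_lt.1 h)
          simp only [indicator_of_notMem this]
          rw [indicator_of_notMem (fun h' => h h'.2)]
          simp
    _ ≤ ∫⁻ l in Ioo (0 : ℝ) y, ENNReal.ofReal (l ^ (q - 1)) := by
        rw [← lintegral_indicator measurableSet_Ioo]
        exact setLIntegral_le_lintegral _ _
    _ = _ := by
      rw [restrict_Ioo_eq_restrict_Ioc, ← ofReal_integral_eq_lintegral_ofReal]
      · rw [← intervalIntegral.integral_of_le y.coe_nonneg, integral_rpow (Or.inl (by linarith))]
        rw [sub_add_cancel, Real.zero_rpow hq.ne', sub_zero, div_eq_inv_mul, ← one_div,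
          ENNReal.ofReal_mul (by positivity), ← ENNReal.ofReal_rpow_of_nonneg y.coe_nonneg hq.le,
          ENNReal.ofReal_coe_nnreal]
      · exact (intervalIntegral.intervalIntegrable_rpow' (by linarith)).1
      · filter_upwards [ae_restrict_mem measurableSet_Ioc] with l hl
        exact Real.rpow_nonneg hl.1.le _

/-- The weak type bound, in terms of the part of `f` that exceeds a multiple of the level. -/
theorem mul_volume_lt_maxFn_le_truncated {f : R3 → ℝ≥0∞} (hf : Measurable f) {l : ℝ} (hl : 0 < l) :
    ENNReal.ofReal l * volume {x | ENNReal.ofReal l < maxFn f x} ≤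
      250 * volume (Metric.ball (0 : R3) 1) *
        ∫⁻ x, f x * (Iio (2 * volume (Metric.ball (0 : R3) 1) * f x)).indicator 1
          (ENNReal.ofReal l) := by
  set c := volume (Metric.ball (0 : R3) 1) with hc
  have hc0 : c ≠ 0 := (Metric.measure_ball_pos _ _ one_pos).ne'
  have hct : c ≠ ⊤ := measure_ball_lt_top.ne
  set K : ℝ≥0∞ := 2 * c with hK
  have hKt : K ≠ ⊤ := ENNReal.mul_ne_top (by norm_num) hct
  have hK0 : K ≠ 0 := mul_ne_zero (by norm_num) hc0
  set L := ENNReal.ofReal l with hL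
  have hL0 : L ≠ 0 := by rw [hL, Ne, ENNReal.ofReal_eq_zero, not_le]; exact hl
  have hLt : L ≠ ⊤ := ENNReal.ofReal_ne_top
  -- The part of f above the level L / K, with K = 2c. The rest is at most L / K, and its maximal
  -- function at most c * (L / K) = L / 2, so g must account for the other half of the level.
  set g : R3 → ℝ≥0∞ := fun x => f x * (Iio (K * f x)).indicator 1 L with hg
  have hgm : Measurable g := by
    have : g = {x | L < K * f x}.indicator f := by
      funext x
      by_cases h : L < K * f x
      · simp [hg, h, indicator]
      · simp [hg, h, indicator]
    rw [this]
    exact hf.indicator (measurableSet_lt measurable_const (hf.const_mul K))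
  have hfg : ∀ x, f x ≤ g x + L / K := by
    intro x
    by_cases h : L < K * f x
    · simp [hg, h, indicator]
    · rw [not_lt] at h
      refine le_trans ?_ le_add_self
      rw [ENNReal.le_div_iff_mul_le (Or.inl hK0) (Or.inl hKt), mul_comm]
      exact h
  have hM : ∀ x, maxFn f x ≤ maxFn g x + L / 2 := by
    intro x
    refine (maxFn_add_const_le _ hgm hfg x).trans (le_of_eq ?_)
    congr 1
    rw [← hc, hK, ENNReal.div_eq_inv_mul, ENNReal.mul_inv (Or.inl (by norm_num))
      (Or.inl (by norm_num))]
    calc 2⁻¹ * c⁻¹ * L * c = 2⁻¹ * L * (c⁻¹ * c) := by ring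
      _ = L / 2 := by rw [ENNReal.inv_mul_cancel hc0 hct, mul_one, ENNReal.div_eq_inv_mul]
  have hsub : {x | L < maxFn f x} ⊆ {x | L / 2 < maxFn g x} := by
    intro x hx
    have hx : L < maxFn f x := hx
    show L / 2 < maxFn g x
    by_contra hcon
    rw [not_lt] at hcon
    have := (hM x).trans (add_le_add hcon le_rfl)
    rw [ENNReal.add_halves] at this
    exact absurd hx (not_lt.2 this)
  have h2 := mul_volume_lt_maxFn_le g (l := L / 2) (ENNReal.div_pos hL0 (by norm_num)).ne'
    (ENNReal.div_ne_top hLt (by norm_num))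
  calc L * volume {x | L < maxFn f x} ≤ L * volume {x | L / 2 < maxFn g x} := by gcongr
    _ = 2 * (L / 2 * volume {x | L / 2 < maxFn g x}) := by
        rw [← mul_assoc, ENNReal.mul_div_cancel (by norm_num) (by norm_num)]
    _ ≤ 2 * (125 * c * ∫⁻ x, g x) := by gcongr
    _ = _ := by ring

theorem measurable_indicator_Iio {h : R3 → ℝ≥0∞} (hh : Measurable h) :
    Measurable fun z : R3 × ℝ => (Iio (h z.1)).indicator (1 : ℝ≥0∞ → ℝ≥0∞)
      (ENNReal.ofReal z.2) := by
  have : (fun z : R3 × ℝ => (Iio (h z.1)).indicator (1 : ℝ≥0∞ → ℝ≥0∞) (ENNReal.ofReal z.2))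
      = {z : R3 × ℝ | ENNReal.ofReal z.2 < h z.1}.indicator 1 := by
    funext z; rfl
  rw [this]
  exact measurable_one.indicator (measurableSet_lt
    (ENNReal.measurable_ofReal.comp measurable_snd) (hh.comp measurable_fst))

theorem lintegral_rpow_le_lintegral_meas {p : ℝ} (hp : 0 < p) {h : R3 → ℝ≥0∞}
    (hh : Measurable h) :
    ∫⁻ x, h x ^ p ≤ ∫⁻ l in Ioi (0 : ℝ), ENNReal.ofReal (p * l ^ (p - 1)) *
      volume {x | ENNReal.ofReal l < h x} := by
  calc ∫⁻ x, h x ^ p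
      ≤ ∫⁻ x, ∫⁻ l in Ioi (0 : ℝ), ENNReal.ofReal (p * l ^ (p - 1)) *
          (Iio (h x)).indicator 1 (ENNReal.ofReal l) :=
        lintegral_mono fun x => rpow_le_lintegral_indicator hp _
    _ = ∫⁻ l in Ioi (0 : ℝ), ∫⁻ x, ENNReal.ofReal (p * l ^ (p - 1)) *
          (Iio (h x)).indicator 1 (ENNReal.ofReal l) := by
        refine lintegral_lintegral_swap (Measurable.aemeasurable ?_)
        exact (by fun_prop : Measurable fun z : R3 × ℝ => ENNReal.ofReal (p * z.2 ^ (p - 1))).mul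
          (measurable_indicator_Iio hh)
    _ = _ := by
        refine lintegral_congr fun l => ?_
        have m0 : Measurable fun x => (Iio (h x)).indicator (1 : ℝ≥0∞ → ℝ≥0∞)
            (ENNReal.ofReal l) :=
          (measurable_indicator_Iio hh).comp (measurable_prodMk_right (y := l))
        rw [lintegral_const_mul _ m0, ← lintegral_indicator_one
          (measurableSet_lt measurable_const hh)]
        rfl

/-- By Tonelli's theorem, for fixed x the level runs up to K f(x) and contributes (K f(x)) ^ q / q.
The remaining factor f(x) raises the exponent to q + 1. -/
theorem lintegral_rpow_mul_truncated_le {q : ℝ} (hq : 0 < q) (K : ℝ≥0∞) {f : R3 → ℝ≥0∞}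
    (hf : Measurable f) :
    ∫⁻ l in Ioi (0 : ℝ), ENNReal.ofReal (l ^ (q - 1)) *
        ∫⁻ x, f x * (Iio (K * f x)).indicator 1 (ENNReal.ofReal l) ≤
      ENNReal.ofReal (1 / q) * K ^ q * ∫⁻ x, f x ^ (q + 1) := by
  have m1 := measurable_indicator_Iio (hf.const_mul K)
  have m2 : Measurable fun z : R3 × ℝ => f z.1 := hf.comp measurable_fst
  have m3 : Measurable fun z : R3 × ℝ => ENNReal.ofReal (z.2 ^ (q - 1)) := by fun_prop
  calc _ = ∫⁻ l in Ioi (0 : ℝ), ∫⁻ x, ENNReal.ofReal (l ^ (q - 1)) *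
          (f x * (Iio (K * f x)).indicator 1 (ENNReal.ofReal l)) := by
        refine lintegral_congr fun l => ?_
        rw [lintegral_const_mul]
        exact (m2.mul m1).comp (measurable_prodMk_right (y := l))
    _ = ∫⁻ x, ∫⁻ l in Ioi (0 : ℝ), ENNReal.ofReal (l ^ (q - 1)) *
          (f x * (Iio (K * f x)).indicator 1 (ENNReal.ofReal l)) := by
        symm
        exact lintegral_lintegral_swap (Measurable.aemeasurable (m3.mul (m2.mul m1)))
    _ ≤ ∫⁻ x, ENNReal.ofReal (1 / q) * K ^ q * f x ^ (q + 1) := by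
        refine lintegral_mono fun x => ?_
        calc _ = ∫⁻ l in Ioi (0 : ℝ), f x * (ENNReal.ofReal (l ^ (q - 1)) *
              (Iio (K * f x)).indicator 1 (ENNReal.ofReal l)) :=
              lintegral_congr fun l => by ring
          _ = f x * ∫⁻ l in Ioi (0 : ℝ), ENNReal.ofReal (l ^ (q - 1)) *
              (Iio (K * f x)).indicator 1 (ENNReal.ofReal l) :=
              lintegral_const_mul _ ((m3.mul m1).comp (measurable_prodMk_left (x := x)))
          _ ≤ f x * (ENNReal.ofReal (1 / q) * (K * f x) ^ q) := by
              gcongr; exact lintegral_rpow_Iio_le hq _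
          _ = _ := by
              rw [ENNReal.mul_rpow_of_nonneg _ _ hq.le,
                ENNReal.rpow_add_of_nonneg _ _ hq.le zero_le_one, ENNReal.rpow_one]
              ring
    _ = _ := lintegral_const_mul _ (hf.pow_const _)

/-- The Hardy-Littlewood maximal theorem. -/
theorem exists_lintegral_maxFn_rpow_le {p : ℝ} (hp : 1 < p) :
    ∃ C : ℝ≥0, ∀ f : R3 → ℝ≥0∞, Measurable f →
      ∫⁻ x, maxFn f x ^ p ≤ C * ∫⁻ x, f x ^ p := by
  obtain ⟨c, hc⟩ : ∃ c : ℝ≥0∞, c = volume (Metric.ball (0 : R3) 1) := ⟨_, rfl⟩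
  have hct : c ≠ ⊤ := hc ▸ measure_ball_lt_top.ne
  have hp0 : 0 < p := by linarith
  have hp1 : 0 < p - 1 := by linarith
  obtain ⟨C, hC⟩ : ∃ C : ℝ≥0∞, C = ENNReal.ofReal p * (250 * c) *
    (ENNReal.ofReal (1 / (p - 1)) * (2 * c) ^ (p - 1)) := ⟨_, rfl⟩
  have hCt : C ≠ ⊤ := by
    rw [hC]
    refine ENNReal.mul_ne_top (ENNReal.mul_ne_top ENNReal.ofReal_ne_top
      (ENNReal.mul_ne_top (by norm_num) hct)) (ENNReal.mul_ne_top ENNReal.ofReal_ne_top ?_)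
    exact ENNReal.rpow_ne_top_of_nonneg hp1.le (ENNReal.mul_ne_top (by norm_num) hct)
  refine ⟨C.toNNReal, fun f hf => ?_⟩
  rw [ENNReal.coe_toNNReal hCt]
  have h1 := lintegral_rpow_mul_truncated_le hp1 (2 * c) hf
  rw [sub_add_cancel] at h1
  refine (lintegral_rpow_le_lintegral_meas hp0 (measurable_maxFn hf)).trans ?_
  calc _ ≤ ∫⁻ l in Ioi (0 : ℝ), (ENNReal.ofReal p * (250 * c)) * (ENNReal.ofReal (l ^ (p - 1 - 1)) *
          ∫⁻ x, f x * (Iio (2 * c * f x)).indicator 1 (ENNReal.ofReal l)) := by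
        refine setLIntegral_mono' measurableSet_Ioi fun l hl => ?_
        have hl : 0 < l := hl
        -- One factor l is set aside for the weak type bound. The power l ^ (p - 2) left over is
        -- integrable at 0 because p > 1.
        have e2 : ENNReal.ofReal (p * l ^ (p - 1)) =
            ENNReal.ofReal p * ENNReal.ofReal (l ^ (p - 1 - 1)) * ENNReal.ofReal l := by
          rw [← ENNReal.ofReal_mul hp0.le, ← ENNReal.ofReal_mul (by positivity)]
          congr 1
          rw [mul_assoc, ← Real.rpow_add_one hl.ne', sub_add_cancel]
        have h2 := mul_volume_lt_maxFn_le_truncated hf hl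
        rw [← hc] at h2
        rw [e2, mul_assoc]
        refine (mul_le_mul_right h2 _).trans (le_of_eq ?_)
        ring
    _ = ENNReal.ofReal p * (250 * c) * ∫⁻ l in Ioi (0 : ℝ), (ENNReal.ofReal (l ^ (p - 1 - 1)) *
          ∫⁻ x, f x * (Iio (2 * c * f x)).indicator 1 (ENNReal.ofReal l)) :=
        lintegral_const_mul' _ _ (ENNReal.mul_ne_top ENNReal.ofReal_ne_top
          (ENNReal.mul_ne_top (by norm_num) hct))
    _ ≤ ENNReal.ofReal p * (250 * c) *
          (ENNReal.ofReal (1 / (p - 1)) * (2 * c) ^ (p - 1) * ∫⁻ x, f x ^ p) :=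
        mul_le_mul_right h1 _
    _ = C * ∫⁻ x, f x ^ p := by rw [hC]; ring


/-! ### Potentials and maximal functions -/

theorem lintegral_Ioi_rpow {γ : ℝ} (hγ : 0 < γ) {a : ℝ} (ha : 0 < a) :
    ∫⁻ r in Ioi a, ENNReal.ofReal (γ * r ^ (-γ - 1)) = ENNReal.ofReal (a ^ (-γ)) := by
  rw [← ofReal_integral_eq_lintegral_ofReal]
  · rw [integral_const_mul, integral_Ioi_rpow_of_lt (by linarith) ha, sub_add_cancel]
    congr 1; field_simp
  · exact (integrableOn_Ioi_rpow_of_lt (by linarith) ha).const_mul _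
  · filter_upwards [ae_restrict_mem measurableSet_Ioi] with r hr
    have : 0 < r := ha.trans hr
    exact mul_nonneg hγ.le (Real.rpow_nonneg this.le _)

theorem lintegral_Ioi_rpow_mul_cube {γ : ℝ} (hγ : 3 < γ) {a : ℝ} (ha : 0 < a) :
    ∫⁻ r in Ioi a, ENNReal.ofReal (γ * r ^ (-γ - 1)) * ENNReal.ofReal (r ^ 3) =
      ENNReal.ofReal (γ / (γ - 3) * a ^ (3 - γ)) := by
  have : ∀ r ∈ Ioi a, ENNReal.ofReal (γ * r ^ (-γ - 1)) * ENNReal.ofReal (r ^ 3) =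
      ENNReal.ofReal (γ / (γ - 3)) * ENNReal.ofReal ((γ - 3) * r ^ (-(γ - 3) - 1)) := by
    intro r hr
    have hr : 0 < r := ha.trans hr
    rw [← ENNReal.ofReal_mul (by positivity),
      ← ENNReal.ofReal_mul (div_nonneg (by linarith) (by linarith))]
    congr 1
    rw [mul_assoc, ← Real.rpow_natCast r 3, ← Real.rpow_add hr,
      show (-γ - 1 + (3 : ℕ) : ℝ) = -(γ - 3) - 1 by push_cast; ring]
    have : γ - 3 ≠ 0 := by linarith
    field_simp
  rw [setLIntegral_congr_fun measurableSet_Ioi this, lintegral_const_mul _ (by fun_prop),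
    lintegral_Ioi_rpow (by linarith) ha, ← ENNReal.ofReal_mul (div_nonneg (by linarith) (by linarith)),
    neg_sub]

theorem lintegral_Ioc_rpow_mul_cube {γ : ℝ} (hγ0 : 0 < γ) (hγ : γ < 3) {a : ℝ} (ha : 0 < a) :
    ∫⁻ r in Ioc 0 a, ENNReal.ofReal (γ * r ^ (-γ - 1)) * ENNReal.ofReal (r ^ 3) =
      ENNReal.ofReal (γ / (3 - γ) * a ^ (3 - γ)) := by
  have : ∀ r ∈ Ioc 0 a, ENNReal.ofReal (γ * r ^ (-γ - 1)) * ENNReal.ofReal (r ^ 3) =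
      ENNReal.ofReal (γ * r ^ (2 - γ)) := by
    intro r hr
    have hr : 0 < r := hr.1
    rw [← ENNReal.ofReal_mul (by positivity)]
    congr 1
    rw [mul_assoc, ← Real.rpow_natCast r 3, ← Real.rpow_add hr]
    congr 2; push_cast; ring
  rw [setLIntegral_congr_fun measurableSet_Ioc this, ← ofReal_integral_eq_lintegral_ofReal]
  · rw [← intervalIntegral.integral_of_le ha.le, intervalIntegral.integral_const_mul,
      integral_rpow (Or.inl (by linarith))]
    rw [show 2 - γ + 1 = 3 - γ by ring, Real.zero_rpow (by linarith)]
    congr 1; ring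
  · exact ((intervalIntegral.intervalIntegrable_rpow' (by linarith)).const_mul γ).1
  · filter_upwards [ae_restrict_mem measurableSet_Ioc] with r hr
    exact mul_nonneg hγ0.le (Real.rpow_nonneg hr.1.le _)

/-- Writing |z| ^ (-γ) as the integral of γ r ^ (-γ-1) over r > |z| and applying Tonelli's theorem
reduces a weighted integral to the growth of unweighted integrals over balls. -/
theorem lintegral_mul_norm_rpow_le {γ : ℝ} (hγ : 0 < γ) {k : R3 → ℝ≥0∞} (hk : Measurable k)
    {E : Set R3} {φ : ℝ → ℝ≥0∞}
    (hφ : ∀ r, 0 < r → ∫⁻ z in Metric.ball 0 r ∩ E, k z ≤ φ r) :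
    ∫⁻ z in E, k z * ENNReal.ofReal (‖z‖ ^ (-γ)) ≤
      ∫⁻ r in Ioi (0 : ℝ), ENNReal.ofReal (γ * r ^ (-γ - 1)) * φ r := by
  obtain ⟨I, hIm, hI1, hI0⟩ : ∃ I : R3 → ℝ → ℝ≥0∞, Measurable (Function.uncurry I) ∧
      (∀ z r, ‖z‖ < r → I z r = 1) ∧ ∀ z r, ¬ ‖z‖ < r → I z r = 0 := by
    refine ⟨fun z r => {w : R3 × ℝ | ‖w.1‖ < w.2}.indicator 1 (z, r), ?_, ?_, ?_⟩
    · exact measurable_one.indicator (measurableSet_lt (by fun_prop) (by fun_prop))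
    · intro z r h; simp [indicator, h]
    · intro z r h; simp [indicator, h]
  have hw : Measurable fun r : ℝ => ENNReal.ofReal (γ * r ^ (-γ - 1)) := by fun_prop
  have h1 : ∀ z : R3, ENNReal.ofReal (‖z‖ ^ (-γ)) ≤ ∫⁻ r in Ioi (0 : ℝ),
      ENNReal.ofReal (γ * r ^ (-γ - 1)) * I z r := by
    intro z
    -- At the origin the convention 0 ^ (-γ) = 0 makes the bound trivial.
    rcases eq_or_ne z 0 with rfl | hz
    · rw [norm_zero, Real.zero_rpow (by linarith)]; simp
    · rw [← lintegral_Ioi_rpow hγ (norm_pos_iff.2 hz)]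
      calc _ = ∫⁻ r in Ioi ‖z‖, ENNReal.ofReal (γ * r ^ (-γ - 1)) * I z r := by
            refine setLIntegral_congr_fun measurableSet_Ioi fun r hr => ?_
            simp only [hI1 z r hr, mul_one]
        _ ≤ _ := lintegral_mono_set (Ioi_subset_Ioi (norm_nonneg z))
  calc _ ≤ ∫⁻ z in E, ∫⁻ r in Ioi (0 : ℝ),
          k z * (ENNReal.ofReal (γ * r ^ (-γ - 1)) * I z r) := by
        refine lintegral_mono fun z => ?_
        have hi : Measurable (I z) := hIm.comp measurable_prodMk_left
        exact (mul_le_mul_right (h1 z) (k z)).trans_eq (lintegral_const_mul _ (hw.mul hi)).symm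
    _ = ∫⁻ r in Ioi (0 : ℝ), ∫⁻ z in E,
          k z * (ENNReal.ofReal (γ * r ^ (-γ - 1)) * I z r) := by
        refine lintegral_lintegral_swap (Measurable.aemeasurable ?_)
        exact (hk.comp measurable_fst).mul ((hw.comp measurable_snd).mul hIm)
    _ ≤ _ := by
        refine setLIntegral_mono' measurableSet_Ioi fun r hr => ?_
        calc _ = ∫⁻ z in E, ENNReal.ofReal (γ * r ^ (-γ - 1)) *
              (Metric.ball 0 r).indicator k z := by
              refine lintegral_congr fun z => ?_
              by_cases h : ‖z‖ < r
              · rw [hI1 z r h, indicator_of_mem (mem_ball_zero_iff.2 h), mul_one, mul_comm]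
              · rw [hI0 z r h, indicator_of_notMem (fun h' => h (mem_ball_zero_iff.1 h')),
                  mul_zero, mul_zero]
          _ = ENNReal.ofReal (γ * r ^ (-γ - 1)) * ∫⁻ z in Metric.ball 0 r ∩ E, k z := by
              rw [lintegral_const_mul _ (hk.indicator measurableSet_ball),
                lintegral_indicator measurableSet_ball, Measure.restrict_restrict measurableSet_ball]
          _ ≤ _ := by gcongr; exact hφ r hr

/-- The integral of k over the relevant balls grows like min(r, R) ^ 3. Splitting the radial
integral at R gives the coefficient γ/(3-γ) + 1 = 3/(3-γ). -/
theorem setLIntegral_ball_mul_norm_rpow_le {γ : ℝ} (hγ0 : 0 < γ) (hγ : γ < 3) {k : R3 → ℝ≥0∞}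
    (hk : Measurable k) {A : ℝ≥0∞}
    (hA : ∀ r, 0 < r → ∫⁻ z in Metric.closedBall 0 r, k z ≤ A * ENNReal.ofReal (r ^ 3))
    {R : ℝ} (hR : 0 < R) :
    ∫⁻ z in Metric.ball 0 R, k z * ENNReal.ofReal (‖z‖ ^ (-γ)) ≤
      A * ENNReal.ofReal (3 / (3 - γ) * R ^ (3 - γ)) := by
  refine (lintegral_mul_norm_rpow_le hγ0 hk
    (φ := fun r => A * ENNReal.ofReal ((min r R) ^ 3)) ?_).trans ?_
  · intro r hr
    refine le_trans (lintegral_mono_set ?_) (hA (min r R) (lt_min hr hR))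
    intro z hz
    rw [mem_closedBall_zero_iff]
    exact le_min (mem_ball_zero_iff.1 hz.1).le (mem_ball_zero_iff.1 hz.2).le
  · have hm : Measurable fun r : ℝ => ENNReal.ofReal (γ * r ^ (-γ - 1)) *
        ENNReal.ofReal ((min r R) ^ 3) := by fun_prop
    calc _ = ∫⁻ r in Ioi (0 : ℝ), A * (ENNReal.ofReal (γ * r ^ (-γ - 1)) *
          ENNReal.ofReal ((min r R) ^ 3)) := lintegral_congr fun r => by ring
      _ = A * ∫⁻ r in Ioi (0 : ℝ), ENNReal.ofReal (γ * r ^ (-γ - 1)) *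
          ENNReal.ofReal ((min r R) ^ 3) := lintegral_const_mul _ hm
      _ ≤ _ := by
        gcongr
        rw [← Ioc_union_Ioi_eq_Ioi hR.le]
        refine (lintegral_union_le _ _ _).trans ?_
        have e1 : ∫⁻ r in Ioc 0 R, ENNReal.ofReal (γ * r ^ (-γ - 1)) *
            ENNReal.ofReal ((min r R) ^ 3) = ENNReal.ofReal (γ / (3 - γ) * R ^ (3 - γ)) := by
          rw [← lintegral_Ioc_rpow_mul_cube hγ0 hγ hR]
          exact setLIntegral_congr_fun measurableSet_Ioc fun r hr => by
            simp only [min_eq_left hr.2]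
        have e2 : ∫⁻ r in Ioi R, ENNReal.ofReal (γ * r ^ (-γ - 1)) *
            ENNReal.ofReal ((min r R) ^ 3) = ENNReal.ofReal (R ^ (3 - γ)) := by
          calc _ = ∫⁻ r in Ioi R, ENNReal.ofReal (γ * r ^ (-γ - 1)) * ENNReal.ofReal (R ^ 3) :=
                setLIntegral_congr_fun measurableSet_Ioi fun r hr => by
                  rw [min_eq_right (le_of_lt (mem_Ioi.1 hr))]
            _ = _ := by
                rw [lintegral_mul_const _ (by fun_prop), lintegral_Ioi_rpow hγ0 hR,
                  ← ENNReal.ofReal_mul (by positivity), ← Real.rpow_natCast R 3,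
                  ← Real.rpow_add hR]
                congr 2; push_cast; ring
        have h3 : 0 < 3 - γ := by linarith
        rw [e1, e2, ← ENNReal.ofReal_add (by positivity) (by positivity)]
        refine le_of_eq ?_
        congr 1
        field_simp
        ring

/-- Here the growth function vanishes for r ≤ R, and r ^ 3 is integrable against r ^ (-γ-1) at
infinity because γ > 3. -/
theorem setLIntegral_compl_ball_mul_norm_rpow_le {γ : ℝ} (hγ : 3 < γ) {k : R3 → ℝ≥0∞}
    (hk : Measurable k) {A : ℝ≥0∞}
    (hA : ∀ r, 0 < r → ∫⁻ z in Metric.closedBall 0 r, k z ≤ A * ENNReal.ofReal (r ^ 3))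
    {R : ℝ} (hR : 0 < R) :
    ∫⁻ z in (Metric.ball 0 R)ᶜ, k z * ENNReal.ofReal (‖z‖ ^ (-γ)) ≤
      A * ENNReal.ofReal (γ / (γ - 3) * R ^ (3 - γ)) := by
  refine (lintegral_mul_norm_rpow_le (by linarith) hk
    (φ := fun r => A * (Ioi R).indicator (fun r => ENNReal.ofReal (r ^ 3)) r) ?_).trans ?_
  · intro r hr
    by_cases h : R < r
    · rw [indicator_of_mem (show r ∈ Ioi R from h)]
      refine le_trans (lintegral_mono_set ?_) (hA r hr)
      exact inter_subset_left.trans Metric.ball_subset_closedBall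
    · have : Metric.ball (0 : R3) r ∩ (Metric.ball 0 R)ᶜ = ∅ := by
        rw [← sdiff_eq, sdiff_eq_empty]
        exact Metric.ball_subset_ball (not_lt.1 h)
      simp [this]
  · have hm : Measurable fun r : ℝ => ENNReal.ofReal (γ * r ^ (-γ - 1)) *
        ENNReal.ofReal (r ^ 3) := by fun_prop
    calc _ = ∫⁻ r in Ioi (0 : ℝ), A * (Ioi R).indicator (fun r => ENNReal.ofReal (γ * r ^ (-γ - 1)) *
          ENNReal.ofReal (r ^ 3)) r := lintegral_congr fun r => by
            by_cases h : r ∈ Ioi R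
            · rw [indicator_of_mem h, indicator_of_mem h]; ring
            · rw [indicator_of_notMem h, indicator_of_notMem h]; simp
      _ = A * ∫⁻ r in Ioi (0 : ℝ), (Ioi R).indicator (fun r => ENNReal.ofReal (γ * r ^ (-γ - 1)) *
          ENNReal.ofReal (r ^ 3)) r := lintegral_const_mul _ (hm.indicator measurableSet_Ioi)
      _ ≤ A * ∫⁻ r in Ioi R, ENNReal.ofReal (γ * r ^ (-γ - 1)) * ENNReal.ofReal (r ^ 3) := by
        refine mul_le_mul_right ?_ A
        rw [← lintegral_indicator (measurableSet_Ioi (a := R))]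
        exact setLIntegral_le_lintegral _ _
      _ = _ := by rw [lintegral_Ioi_rpow_mul_cube hγ hR]

/-! ### The absolute singular integral of order `s` -/

/-- `∫ |f(x) - f(x - z)| |z|^(-3-s) dz`. -/
noncomputable def absFrac (s : ℝ) (f : R3 → ℝ) (x : R3) : ℝ≥0∞ :=
  ∫⁻ z, ‖f x - f (x - z)‖ₑ * ENNReal.ofReal (‖z‖ ^ (-(3 + s)))

/-- The substitution y = τ z has Jacobian τ ^ (-3), which cancels the growth (τ r) ^ 3. The bound is
thus uniform in τ, so that derivatives can be averaged along segments. -/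
theorem setLIntegral_closedBall_sub_smul_le {h : R3 → ℝ≥0∞} (hh : Measurable h) (x : R3) {τ r : ℝ}
    (hτ : 0 < τ) (hr : 0 < r) :
    ∫⁻ z in Metric.closedBall 0 r, h (x - τ • z) ≤ 8 * maxFn h x * ENNReal.ofReal (r ^ 3) := by
  have e1 : ∫⁻ z in Metric.closedBall 0 r, h (x - τ • z) =
      ∫⁻ z, (fun y => (Metric.closedBall x (τ * r)).indicator h (x - y)) (τ • z) := by
    rw [← lintegral_indicator Metric.isClosed_closedBall.measurableSet]
    refine lintegral_congr fun z => ?_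
    have : (x - τ • z ∈ Metric.closedBall x (τ * r)) ↔ z ∈ Metric.closedBall (0 : R3) r := by
      rw [Metric.mem_closedBall, mem_closedBall_zero_iff, dist_eq_norm, sub_sub_cancel_left,
        norm_neg, norm_smul, Real.norm_of_nonneg hτ.le]
      exact mul_le_mul_iff_right₀ hτ
    by_cases hz : z ∈ Metric.closedBall (0 : R3) r
    · simp only [indicator_of_mem hz, indicator_of_mem (this.2 hz)]
    · simp only [indicator_of_notMem hz, indicator_of_notMem (fun h' => hz (this.1 h'))]
  have hm : Measurable fun y => (Metric.closedBall x (τ * r)).indicator h (x - y) :=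
    (hh.indicator Metric.isClosed_closedBall.measurableSet).comp (by fun_prop)
  rw [e1, ← lintegral_map (f := fun y => (Metric.closedBall x (τ * r)).indicator h (x - y)) hm
    (by fun_prop), Measure.map_addHaar_smul _ hτ.ne', lintegral_smul_measure,
    lintegral_sub_left_eq_self, lintegral_indicator Metric.isClosed_closedBall.measurableSet]
  have h2 := setLIntegral_closedBall_le_maxFn h x (mul_pos hτ hr)
  calc _ ≤ ENNReal.ofReal |(τ ^ Module.finrank ℝ R3)⁻¹| *
        (8 * ENNReal.ofReal ((τ * r) ^ 3) * maxFn h x) := by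
        rw [smul_eq_mul]; gcongr
    _ = ENNReal.ofReal ((τ ^ 3)⁻¹ * (τ * r) ^ 3) * (8 * maxFn h x) := by
        rw [ENNReal.ofReal_mul (by positivity), abs_of_pos (by positivity)]
        simp only [finrank_euclideanSpace, Fintype.card_fin]
        ring
    _ = _ := by
        rw [mul_comm]
        congr 2
        field_simp

theorem enorm_sub_le_lintegral_fderiv {f : R3 → ℝ} (hf : ContDiff ℝ 1 f) (x z : R3) :
    ‖f x - f (x - z)‖ₑ ≤ (∫⁻ τ in Ioc (0 : ℝ) 1, ‖fderiv ℝ f (x - τ • z)‖ₑ) * ‖z‖ₑ := by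
  have hd : ∀ τ ∈ uIcc (0 : ℝ) 1, HasDerivAt (fun τ : ℝ => f (x - τ • z))
      (-(fderiv ℝ f (x - τ • z) z)) τ := by
    intro τ _
    have h1 : HasDerivAt (fun τ : ℝ => x - τ • z) (-((1 : ℝ) • z)) τ :=
      ((hasDerivAt_id τ).smul_const z).const_sub x
    have h2 := ((hf.differentiable (by norm_num)) (x - τ • z)).hasFDerivAt.comp_hasDerivAt τ h1
    rw [one_smul, map_neg] at h2
    exact h2
  have hc : Continuous fun τ : ℝ => -(fderiv ℝ f (x - τ • z) z) := by
    have := hf.continuous_fderiv (by norm_num)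
    fun_prop
  have h3 := intervalIntegral.integral_eq_sub_of_hasDerivAt hd (hc.intervalIntegrable _ _)
  simp only [one_smul, zero_smul, sub_zero] at h3
  rw [← enorm_neg, neg_sub, ← h3, intervalIntegral.integral_of_le zero_le_one]
  refine (enorm_integral_le_lintegral_enorm _).trans ?_
  rw [← lintegral_mul_const']
  · refine lintegral_mono fun τ => ?_
    rw [enorm_neg]
    exact ContinuousLinearMap.le_opENorm _ _
  · exact enorm_ne_top

/-- The integral is split at |z| = R. Inside, the mean value formula gains a factor |z| and leaves
the kernel |z| ^ (-2-s), integrable at 0 because s < 1. Outside, |z| ^ (-3-s) is integrable at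
infinity because s > 0. In both regions the averages over balls are controlled by maximal functions.
-/
theorem exists_absFrac_le {s : ℝ} (hs0 : 0 < s) (hs1 : s < 1) :
    ∃ C : ℝ≥0, ∀ f : R3 → ℝ, ContDiff ℝ 1 f → ∀ x, ∀ R : ℝ, 0 < R →
      absFrac s f x ≤ C * (ENNReal.ofReal (R ^ (1 - s)) * maxFn (fun y => ‖fderiv ℝ f y‖ₑ) x +
        ENNReal.ofReal (R ^ (-s)) * (‖f x‖ₑ + maxFn (fun y => ‖f y‖ₑ) x)) := by
  obtain ⟨c, hc⟩ : ∃ c : ℝ≥0∞, c = volume (Metric.ball (0 : R3) 1) := ⟨_, rfl⟩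
  have hct : c ≠ ⊤ := hc ▸ measure_ball_lt_top.ne
  obtain ⟨C1, hC1⟩ : ∃ C1 : ℝ≥0∞, C1 = 8 * ENNReal.ofReal (3 / (1 - s)) := ⟨_, rfl⟩
  obtain ⟨C2, hC2⟩ : ∃ C2 : ℝ≥0∞, C2 = (c + 8) * ENNReal.ofReal ((3 + s) / s) := ⟨_, rfl⟩
  have hC : C1 + C2 ≠ ⊤ := by
    rw [hC1, hC2]
    exact ENNReal.add_ne_top.2 ⟨ENNReal.mul_ne_top (by norm_num) ENNReal.ofReal_ne_top,
      ENNReal.mul_ne_top (ENNReal.add_ne_top.2 ⟨hct, by norm_num⟩) ENNReal.ofReal_ne_top⟩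
  refine ⟨(C1 + C2).toNNReal, fun f hf x R hR => ?_⟩
  rw [ENNReal.coe_toNNReal hC]
  have hfm : Measurable fun y => ‖f y‖ₑ := hf.continuous.measurable.enorm
  have hgc : Continuous fun y => fderiv ℝ f y := hf.continuous_fderiv (by norm_num)
  have hgm : Measurable fun y => ‖fderiv ℝ f y‖ₑ := hgc.measurable.enorm
  have hkm : Measurable fun z => ∫⁻ τ in Ioc (0 : ℝ) 1, ‖fderiv ℝ f (x - τ • z)‖ₑ := by
    refine Measurable.lintegral_prod_right' (f := fun w : R3 × ℝ => ‖fderiv ℝ f (x - w.2 • w.1)‖ₑ) ?_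
    exact hgm.comp (by fun_prop)
  have near : ∫⁻ z in Metric.ball 0 R, ‖f x - f (x - z)‖ₑ * ENNReal.ofReal (‖z‖ ^ (-(3 + s))) ≤
      C1 * (ENNReal.ofReal (R ^ (1 - s)) * maxFn (fun y => ‖fderiv ℝ f y‖ₑ) x) := by
    have h1 : ∀ r : ℝ, 0 < r → ∫⁻ z in Metric.closedBall 0 r,
        ∫⁻ τ in Ioc (0 : ℝ) 1, ‖fderiv ℝ f (x - τ • z)‖ₑ ≤
        8 * maxFn (fun y => ‖fderiv ℝ f y‖ₑ) x * ENNReal.ofReal (r ^ 3) := by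
      intro r hr
      have hm : Measurable fun w : R3 × ℝ => ‖fderiv ℝ f (x - w.2 • w.1)‖ₑ :=
        hgm.comp (by fun_prop : Measurable fun w : R3 × ℝ => x - w.2 • w.1)
      rw [lintegral_lintegral_swap (f := fun z τ => ‖fderiv ℝ f (x - τ • z)‖ₑ) hm.aemeasurable]
      calc _ ≤ ∫⁻ τ in Ioc (0 : ℝ) 1,
            8 * maxFn (fun y => ‖fderiv ℝ f y‖ₑ) x * ENNReal.ofReal (r ^ 3) :=
            setLIntegral_mono' measurableSet_Ioc fun τ hτ =>
              setLIntegral_closedBall_sub_smul_le hgm x hτ.1 hr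
        _ = _ := by simp
    have h2 := setLIntegral_ball_mul_norm_rpow_le (γ := 2 + s) (by linarith) (by linarith) hkm h1 hR
    refine le_trans (lintegral_mono fun z => ?_) (h2.trans (le_of_eq ?_))
    · rcases eq_or_ne z 0 with rfl | hz
      · simp
      · have hz' : 0 < ‖z‖ := norm_pos_iff.2 hz
        calc _ ≤ (∫⁻ τ in Ioc (0 : ℝ) 1, ‖fderiv ℝ f (x - τ • z)‖ₑ) * ‖z‖ₑ *
              ENNReal.ofReal (‖z‖ ^ (-(3 + s))) := by
              gcongr; exact enorm_sub_le_lintegral_fderiv hf x z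
          _ = _ := by
              rw [mul_assoc, ← ofReal_norm, ← ENNReal.ofReal_mul hz'.le]
              congr 2
              rw [mul_comm, ← Real.rpow_add_one hz'.ne']
              congr 1; ring
    · rw [hC1, show 3 - (2 + s) = 1 - s by ring,
        ENNReal.ofReal_mul (div_nonneg (by norm_num) (by linarith))]
      ring
  have far : ∫⁻ z in (Metric.ball 0 R)ᶜ, ‖f x - f (x - z)‖ₑ * ENNReal.ofReal (‖z‖ ^ (-(3 + s))) ≤
      C2 * (ENNReal.ofReal (R ^ (-s)) * (‖f x‖ₑ + maxFn (fun y => ‖f y‖ₑ) x)) := by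
    have hm2 : Measurable fun z => ‖f x‖ₑ + ‖f (x - z)‖ₑ :=
      measurable_const.add (hfm.comp (by fun_prop))
    have h1 : ∀ r : ℝ, 0 < r → ∫⁻ z in Metric.closedBall 0 r, (‖f x‖ₑ + ‖f (x - z)‖ₑ) ≤
        ((c + 8) * (‖f x‖ₑ + maxFn (fun y => ‖f y‖ₑ) x)) * ENNReal.ofReal (r ^ 3) := by
      intro r hr
      rw [lintegral_add_left measurable_const, setLIntegral_const, volume_closedBall_R3 _ hr.le, ← hc]
      have := setLIntegral_closedBall_sub_smul_le hfm x one_pos hr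
      simp only [one_smul] at this
      calc _ ≤ ‖f x‖ₑ * (ENNReal.ofReal (r ^ 3) * c) +
            8 * maxFn (fun y => ‖f y‖ₑ) x * ENNReal.ofReal (r ^ 3) := by gcongr
        -- The cross terms are added only to make the sum factor.
        _ ≤ ‖f x‖ₑ * (ENNReal.ofReal (r ^ 3) * c) +
            8 * maxFn (fun y => ‖f y‖ₑ) x * ENNReal.ofReal (r ^ 3) +
            (8 * ‖f x‖ₑ + c * maxFn (fun y => ‖f y‖ₑ) x) * ENNReal.ofReal (r ^ 3) := le_self_add
        _ = _ := by ring
    have h2 := setLIntegral_compl_ball_mul_norm_rpow_le (γ := 3 + s) (by linarith) hm2 h1 hR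
    refine le_trans (lintegral_mono fun z => ?_) (h2.trans (le_of_eq ?_))
    · gcongr
      exact enorm_sub_le
    · rw [hC2, show 3 - (3 + s) = - s by ring, add_sub_cancel_left,
        ENNReal.ofReal_mul (div_nonneg (by linarith) (by linarith))]
      ring
  rw [absFrac, ← lintegral_add_compl _ measurableSet_ball (A := Metric.ball (0 : R3) R)]
  refine (add_le_add near far).trans ?_
  rw [mul_add (C1 + C2)]
  have a1 : C1 ≤ C1 + C2 := le_self_add
  have a2 : C2 ≤ C1 + C2 := le_add_self
  exact add_le_add (mul_le_mul' a1 le_rfl) (mul_le_mul' a2 le_rfl)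

/-- The choice R = N / P makes both terms equal to N ^ (1-s) * P ^ s. Adding δ > 0 to both numbers
keeps R positive and finite even if one of them vanishes; then δ tends to 0. -/
theorem le_rpow_mul_rpow_of_forall {s : ℝ} (hs0 : 0 < s) (hs1 : s < 1) {H P N : ℝ≥0∞} (C : ℝ≥0)
    (hP : P ≠ ⊤) (hN : N ≠ ⊤)
    (h : ∀ R : ℝ, 0 < R → H ≤ C * (ENNReal.ofReal (R ^ (1 - s)) * P + ENNReal.ofReal (R ^ (-s)) * N)) :
    H ≤ 2 * C * (N ^ (1 - s) * P ^ s) := by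
  lift P to ℝ≥0 using hP
  lift N to ℝ≥0 using hN
  have key : ∀ δ : ℝ, 0 < δ →
      H ≤ 2 * C * ENNReal.ofReal ((N + δ) ^ (1 - s) * (P + δ) ^ s) := by
    intro δ hδ
    have hN' : 0 < (N : ℝ) + δ := by positivity
    have hP' : 0 < (P : ℝ) + δ := by positivity
    refine (h ((N + δ) / (P + δ)) (by positivity)).trans ?_
    rw [two_mul, add_mul, mul_add]
    have e1 : (((N : ℝ) + δ) / (P + δ)) ^ (1 - s) * (P + δ) = (N + δ) ^ (1 - s) * (P + δ) ^ s := by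
      rw [Real.div_rpow hN'.le hP'.le, Real.rpow_sub hP', Real.rpow_one]
      field_simp
    have e2 : (((N : ℝ) + δ) / (P + δ)) ^ (-s) * (N + δ) = (N + δ) ^ (1 - s) * (P + δ) ^ s := by
      rw [Real.div_rpow hN'.le hP'.le, Real.rpow_sub hN', Real.rpow_one, Real.rpow_neg hN'.le,
        Real.rpow_neg hP'.le]
      field_simp
    gcongr
    · rw [← e1, ENNReal.ofReal_mul (by positivity)]
      gcongr
      rw [← ENNReal.ofReal_coe_nnreal]
      exact ENNReal.ofReal_le_ofReal (by linarith)
    · rw [← e2, ENNReal.ofReal_mul (by positivity)]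
      gcongr
      rw [← ENNReal.ofReal_coe_nnreal]
      exact ENNReal.ofReal_le_ofReal (by linarith)
  have hlim : Tendsto (fun δ : ℝ => 2 * (C : ℝ≥0∞) * ENNReal.ofReal ((N + δ) ^ (1 - s) * (P + δ) ^ s))
      (𝓝[>] 0) (𝓝 (2 * C * ENNReal.ofReal ((N + (0 : ℝ)) ^ (1 - s) * (P + (0 : ℝ)) ^ s))) := by
    refine tendsto_nhdsWithin_of_tendsto_nhds ?_
    refine ENNReal.Tendsto.const_mul ?_ (Or.inr (by finiteness))
    refine (ENNReal.continuous_ofReal.tendsto _).comp ?_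
    have c1 : Continuous fun δ : ℝ => ((N : ℝ) + δ) ^ (1 - s) :=
      (continuous_const.add continuous_id).rpow_const fun _ => Or.inr (by linarith)
    have c2 : Continuous fun δ : ℝ => ((P : ℝ) + δ) ^ s :=
      (continuous_const.add continuous_id).rpow_const fun _ => Or.inr hs0.le
    exact (c1.mul c2).tendsto 0
  have := ge_of_tendsto hlim (by filter_upwards [self_mem_nhdsWithin] with δ hδ using key δ hδ)
  refine this.trans (le_of_eq ?_)
  rw [add_zero, add_zero, ENNReal.ofReal_mul (by positivity),
    ← ENNReal.ofReal_rpow_of_nonneg N.coe_nonneg (by linarith),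
    ← ENNReal.ofReal_rpow_of_nonneg P.coe_nonneg hs0.le, ENNReal.ofReal_coe_nnreal,
    ENNReal.ofReal_coe_nnreal]


/-! ### Mollification -/

/-- Even mollifiers. -/
structure IsMollifier (η : R3 → ℝ) : Prop where
  smooth : ContDiff ℝ ∞ η
  compact : HasCompactSupport η
  nonneg : ∀ x, 0 ≤ η x
  integral_eq : ∫ x, η x = 1
  even : ∀ x, η (-x) = η x

/-- A sequence of mollifiers whose supports shrink to the origin. -/
noncomputable def bump (n : ℕ) : ContDiffBump (0 : R3) where
  -- The ratio of the outer to the inner radius stays equal to 2, which the almost everywhere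
  -- convergence of the mollifications requires.
  rIn := 1 / (2 * ((n : ℝ) + 1))
  rOut := 1 / ((n : ℝ) + 1)
  rIn_pos := by positivity
  rIn_lt_rOut := by
    apply one_div_lt_one_div_of_lt <;> nlinarith [(Nat.cast_nonneg n : (0 : ℝ) ≤ n)]

noncomputable def ker (n : ℕ) : R3 → ℝ := (bump n).normed volume

theorem isMollifier_ker (n : ℕ) : IsMollifier (ker n) where
  smooth := (bump n).contDiff_normed
  compact := (bump n).hasCompactSupport_normed
  nonneg := (bump n).nonneg_normed
  integral_eq := (bump n).integral_normed
  even := (bump n).normed_neg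

theorem tendsto_bump_rOut : Tendsto (fun n => (bump n).rOut) atTop (𝓝 0) :=
  tendsto_one_div_add_atTop_nhds_zero_nat

theorem norm_le_of_ker_ne_zero {n : ℕ} {x : R3} (h : ker n x ≠ 0) : ‖x‖ ≤ (bump n).rOut := by
  have h1 : x ∈ tsupport (ker n) := subset_tsupport _ h
  rw [ker, ContDiffBump.tsupport_normed_eq] at h1
  exact mem_closedBall_zero_iff.1 h1

/-- The convolution `η * f`. -/
noncomputable def mol {E : Type*} [NormedAddCommGroup E] [NormedSpace ℝ E] (η : R3 → ℝ)
    (f : R3 → E) : R3 → E :=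
  convolution η f (ContinuousLinearMap.lsmul ℝ ℝ) volume

section
variable {E : Type*} [NormedAddCommGroup E] [NormedSpace ℝ E]

theorem mol_apply (η : R3 → ℝ) (f : R3 → E) (x : R3) : mol η f x = ∫ t, η t • f (x - t) := rfl

theorem mol_apply' (η : R3 → ℝ) (f : R3 → E) (x : R3) : mol η f x = ∫ y, η (x - y) • f y := by
  rw [mol_apply, ← integral_sub_left_eq_self _ _ x]
  simp

theorem mol_congr_ae (η : R3 → ℝ) {f g : R3 → E} (h : f =ᵐ[volume] g) : mol η f = mol η g := by
  funext x
  rw [mol_apply', mol_apply']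
  refine integral_congr_ae ?_
  filter_upwards [h] with y hy
  rw [hy]

theorem IsMollifier.continuous {η : R3 → ℝ} (hη : IsMollifier η) : Continuous η := hη.smooth.continuous

theorem IsMollifier.integrable {η : R3 → ℝ} (hη : IsMollifier η) : Integrable η :=
  hη.continuous.integrable_of_hasCompactSupport hη.compact

theorem IsMollifier.lintegral_eq {η : R3 → ℝ} (hη : IsMollifier η) : ∫⁻ t, ENNReal.ofReal (η t) = 1 := by
  rw [← ofReal_integral_eq_lintegral_ofReal hη.integrable (ae_of_all _ hη.nonneg),
    hη.integral_eq, ENNReal.ofReal_one]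

/-- Jensen's inequality followed by Tonelli's theorem. -/
theorem IsMollifier.lintegral_rpow_le {η : R3 → ℝ} (hη : IsMollifier η) {p : ℝ} (hp : 1 ≤ p) {F : R3 → R3 → ℝ≥0∞}
    (hF : Measurable (Function.uncurry F)) :
    ∫⁻ x, (∫⁻ t, ENNReal.ofReal (η t) * F x t) ^ p ≤
      ∫⁻ t, ENNReal.ofReal (η t) * ∫⁻ x, F x t ^ p := by
  have hp0 : 0 < p := by linarith
  have hηm : Measurable fun t => ENNReal.ofReal (η t) := hη.continuous.measurable.ennreal_ofReal
  set ν : Measure R3 := volume.withDensity fun t => ENNReal.ofReal (η t) with hν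
  have : IsProbabilityMeasure ν := ⟨by rw [hν, withDensity_apply _ MeasurableSet.univ,
    setLIntegral_univ, hη.lintegral_eq]⟩
  have hFx : ∀ x, Measurable (F x) := fun x => hF.comp measurable_prodMk_left
  have h1 : ∀ {g : R3 → ℝ≥0∞}, Measurable g → ∫⁻ t, ENNReal.ofReal (η t) * g t = ∫⁻ t, g t ∂ν :=
    fun hg => (lintegral_withDensity_eq_lintegral_mul _ hηm hg).symm
  have h2 : ∀ x, (∫⁻ t, ENNReal.ofReal (η t) * F x t) ^ p ≤
      ∫⁻ t, ENNReal.ofReal (η t) * F x t ^ p := by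
    intro x
    have := eLpNorm'_le_eLpNorm'_of_exponent_le (f := F x) one_pos hp ν
      (hFx x).aestronglyMeasurable
    simp only [eLpNorm'_eq_lintegral_enorm, enorm_eq_self, ENNReal.rpow_one, one_div, inv_one] at this
    rw [h1 (hFx x), h1 ((hFx x).pow_const p)]
    calc _ ≤ ((∫⁻ t, F x t ^ p ∂ν) ^ p⁻¹) ^ p := by gcongr
      _ = _ := by rw [← ENNReal.rpow_mul, inv_mul_cancel₀ hp0.ne', ENNReal.rpow_one]
  refine (lintegral_mono h2).trans ?_
  rw [lintegral_lintegral_swap]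
  · refine lintegral_mono fun t => ?_
    have hFt : Measurable fun x => F x t := hF.comp measurable_prodMk_right
    rw [lintegral_const_mul _ (hFt.pow_const p)]
  · exact ((hηm.comp measurable_snd).mul (hF.pow_const p)).aemeasurable

/-- Jensen's inequality for the probability density η. The bound on the slices is required only
where η does not vanish, so that small supports allow only small translations. -/
theorem IsMollifier.eLpNorm_integral_le {η : R3 → ℝ} (hη : IsMollifier η) [CompleteSpace E] {p : ℝ} (hp : 1 ≤ p) {F : R3 → R3 → E}
    (hF : StronglyMeasurable (Function.uncurry F)) {B : ℝ≥0∞}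
    (hB : ∀ t, η t ≠ 0 → eLpNorm (fun x => F x t) (ENNReal.ofReal p) volume ≤ B) :
    eLpNorm (fun x => ∫ t, η t • F x t) (ENNReal.ofReal p) volume ≤ B := by
  have hp0 : 0 < p := by linarith
  have hp1 : ENNReal.ofReal p ≠ 0 := by rwa [Ne, ENNReal.ofReal_eq_zero, not_le]
  have e : ∀ f : R3 → E, eLpNorm f (ENNReal.ofReal p) volume = (∫⁻ x, ‖f x‖ₑ ^ p) ^ (1 / p) := by
    intro f
    rw [eLpNorm_eq_lintegral_rpow_enorm_toReal hp1 ENNReal.ofReal_ne_top,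
      ENNReal.toReal_ofReal hp0.le]
  rw [e, one_div, ENNReal.rpow_inv_le_iff hp0]
  calc _ ≤ ∫⁻ x, (∫⁻ t, ENNReal.ofReal (η t) * ‖F x t‖ₑ) ^ p := by
        refine lintegral_mono fun x => ?_
        refine ENNReal.rpow_le_rpow ?_ hp0.le
        refine (enorm_integral_le_lintegral_enorm _).trans (le_of_eq (lintegral_congr fun t => ?_))
        rw [enorm_smul, Real.enorm_of_nonneg (hη.nonneg t)]
    _ ≤ ∫⁻ t, ENNReal.ofReal (η t) * ∫⁻ x, ‖F x t‖ₑ ^ p := hη.lintegral_rpow_le hp hF.enorm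
    _ ≤ ∫⁻ t, ENNReal.ofReal (η t) * B ^ p := by
        refine lintegral_mono fun t => ?_
        by_cases h : η t = 0
        · simp [h]
        · have := hB t h
          rw [e, one_div, ENNReal.rpow_inv_le_iff hp0] at this
          gcongr
    _ = B ^ p := by
        rw [lintegral_mul_const _ hη.continuous.measurable.ennreal_ofReal, hη.lintegral_eq, one_mul]

theorem IsMollifier.eLpNorm_mol_le {η : R3 → ℝ} (hη : IsMollifier η) [CompleteSpace E] {p : ℝ} (hp : 1 ≤ p) {f : R3 → E}
    (hf : AEStronglyMeasurable f volume) :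
    eLpNorm (mol η f) (ENNReal.ofReal p) volume ≤ eLpNorm f (ENNReal.ofReal p) volume := by
  rw [mol_congr_ae η hf.ae_eq_mk, eLpNorm_congr_ae hf.ae_eq_mk]
  have hg := hf.stronglyMeasurable_mk
  refine hη.eLpNorm_integral_le hp (F := fun x t => hf.mk f (x - t))
    (hg.comp_measurable (by fun_prop)) fun t _ => ?_
  exact (eLpNorm_comp_measurePreserving (p := ENNReal.ofReal p) hg.aestronglyMeasurable
    (measurePreserving_sub_right volume t)).le

/-- Since η has integral one, η ⋆ f - f is the η-average of the differences f(· - t) - f. -/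
theorem IsMollifier.eLpNorm_mol_sub_le {η : R3 → ℝ} (hη : IsMollifier η) [CompleteSpace E] {p : ℝ} (hp : 1 ≤ p) {f : R3 → E}
    (hf : LocallyIntegrable f volume) {B : ℝ≥0∞}
    (hB : ∀ t, η t ≠ 0 → eLpNorm (fun x => f (x - t) - f x) (ENNReal.ofReal p) volume ≤ B) :
    eLpNorm (fun x => mol η f x - f x) (ENNReal.ofReal p) volume ≤ B := by
  have hfm := hf.aestronglyMeasurable
  have hg := hfm.stronglyMeasurable_mk
  have e1 : (fun x => mol η f x - f x) =ᵐ[volume]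
      fun x => ∫ t, η t • (hfm.mk f (x - t) - hfm.mk f x) := by
    filter_upwards [hfm.ae_eq_mk] with x hx
    have hex : ConvolutionExistsAt η (hfm.mk f) x (ContinuousLinearMap.lsmul ℝ ℝ) volume :=
      hη.compact.convolutionExists_left _ hη.continuous
        ((locallyIntegrable_congr hfm.ae_eq_mk).1 hf) x
    simp_rw [smul_sub]
    have hex : Integrable (fun t => η t • hfm.mk f (x - t)) volume := hex
    rw [integral_sub hex (hη.integrable.smul_const _), integral_smul_const, hη.integral_eq, one_smul,
      ← hx, mol_congr_ae η hfm.ae_eq_mk]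
    rfl
  rw [eLpNorm_congr_ae e1]
  refine hη.eLpNorm_integral_le hp (F := fun x t => hfm.mk f (x - t) - hfm.mk f x)
    ((hg.comp_measurable (by fun_prop)).sub (hg.comp_measurable measurable_fst)) fun t ht => ?_
  refine le_trans (le_of_eq (eLpNorm_congr_ae ?_)) (hB t ht)
  have h2 := (measurePreserving_sub_right (volume : Measure R3) t).quasiMeasurePreserving.ae
    hfm.ae_eq_mk
  filter_upwards [h2, hfm.ae_eq_mk] with x h3 h4
  rw [h3, h4]

theorem tendsto_eLpNorm_translate_sub {F : Type*} [NormedAddCommGroup F] {p : ℝ≥0∞} (hp1 : 1 ≤ p) (hp : p ≠ ⊤) {f : R3 → F}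
    (hf : MemLp f p volume) :
    Tendsto (fun t : R3 => eLpNorm (fun x => f (x - t) - f x) p volume) (𝓝 0) (𝓝 0) := by
  have : Fact (1 ≤ p) := ⟨hp1⟩
  let g : R3 → C(R3, R3) := fun t => ⟨fun x => x - t, by fun_prop⟩
  have hg : Continuous g := ContinuousMap.continuous_of_continuous_uncurry _ (by
    show Continuous fun z : R3 × R3 => z.2 - z.1
    fun_prop)
  have hgm : ∀ t, MeasurePreserving (g t) (volume : Measure R3) volume := fun t =>
    measurePreserving_sub_right volume t
  have h := (continuous_const (y := hf.toLp f)).compMeasurePreservingLp hg hgm hp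
  have h0 := (h.tendsto 0).sub (tendsto_const_nhds (x := hf.toLp f))
  have e0 : Lp.compMeasurePreserving (g 0) (hgm 0) (hf.toLp f) = hf.toLp f := by
    rw [Lp.toLp_compMeasurePreserving hf (hgm 0)]
    congr 1
    funext x; simp [g]
  rw [e0, sub_self] at h0
  have h1 := h0.enorm
  rw [enorm_zero] at h1
  refine h1.congr fun t => ?_
  rw [Lp.toLp_compMeasurePreserving hf (hgm t), ← MemLp.toLp_sub, Lp.enorm_toLp]
  rfl

theorem tendsto_eLpNorm_mol_sub [CompleteSpace E] {p : ℝ} (hp : 1 ≤ p) {f : R3 → E}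
    (hf : MemLp f (ENNReal.ofReal p) volume) :
    Tendsto (fun n => eLpNorm (fun x => mol (ker n) f x - f x) (ENNReal.ofReal p) volume) atTop
      (𝓝 0) := by
  have hp1 : 1 ≤ ENNReal.ofReal p := by rwa [← ENNReal.ofReal_one, ENNReal.ofReal_le_ofReal_iff (by linarith)]
  have h := tendsto_eLpNorm_translate_sub hp1 ENNReal.ofReal_ne_top hf
  rw [ENNReal.tendsto_nhds_zero] at h ⊢
  intro ε hε
  obtain ⟨δ, hδ, hball⟩ := Metric.eventually_nhds_iff.1 (h ε hε)
  filter_upwards [(tendsto_order.1 tendsto_bump_rOut).2 δ hδ] with n hn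
  refine (isMollifier_ker n).eLpNorm_mol_sub_le hp (hf.locallyIntegrable hp1) fun t ht => ?_
  exact hball (by rw [dist_zero_right]; exact (norm_le_of_ker_ne_zero ht).trans_lt hn)

theorem ae_tendsto_mol [CompleteSpace E] {f : R3 → E} (hf : LocallyIntegrable f volume) :
    ∀ᵐ x, Tendsto (fun n => mol (ker n) f x) atTop (𝓝 (f x)) := by
  refine ContDiffBump.ae_convolution_tendsto_right_of_locallyIntegrable (K := 2)
    tendsto_bump_rOut (Eventually.of_forall fun n => ?_) hf
  show 1 / ((n : ℝ) + 1) ≤ 2 * (1 / (2 * ((n : ℝ) + 1)))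
  apply le_of_eq; field_simp

theorem IsMollifier.contDiff_mol {η : R3 → ℝ} (hη : IsMollifier η) [CompleteSpace E] {f : R3 → E} (hf : LocallyIntegrable f volume) :
    ContDiff ℝ ∞ (mol η f) :=
  hη.compact.contDiff_convolution_left (n := ⊤) _ hη.smooth hf

theorem IsMollifier.fderiv_mol {η : R3 → ℝ} (hη : IsMollifier η) [CompleteSpace E] {f : R3 → E} (hf : LocallyIntegrable f volume)
    (x v : R3) : fderiv ℝ (mol η f) x v = ∫ y, fderiv ℝ η (x - y) v • f y := by
  have h := hη.compact.hasFDerivAt_convolution_left (ContinuousLinearMap.lsmul ℝ ℝ)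
    (hη.smooth.of_le (by norm_cast)) hf x
  have hex : ConvolutionExistsAt (fderiv ℝ η) f x
      (ContinuousLinearMap.precompL R3 (ContinuousLinearMap.lsmul ℝ ℝ)) volume :=
    (hη.compact.fderiv ℝ).convolutionExists_left _ (hη.smooth.continuous_fderiv (by norm_num)) hf x
  rw [show fderiv ℝ (mol η f) x = _ from h.fderiv, convolution_def,
    ContinuousLinearMap.integral_apply hex]
  rw [← integral_sub_left_eq_self _ _ x]
  simp [ContinuousLinearMap.precompL_apply]

end

/-! ### Weak derivatives and their mollification -/

/-- `g` is the weak derivative `∂ᵢ f`. -/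
def HasWeakDeriv (i : Fin 3) (f g : R3 → ℝ) : Prop :=
  ∀ φ : R3 → ℝ, ContDiff ℝ ∞ φ → HasCompactSupport φ →
    ∫ x, f x * fderiv ℝ φ x (e i) = - ∫ x, g x * φ x

theorem fderiv_const_sub_apply {φ : R3 → ℝ} (hφ : Differentiable ℝ φ) (x y v : R3) :
    fderiv ℝ (fun y => φ (x - y)) y v = - fderiv ℝ φ (x - y) v := by
  have h1 : HasFDerivAt (fun y : R3 => x - y) (-(ContinuousLinearMap.id ℝ R3)) y :=
    (hasFDerivAt_id y).const_sub x
  have h2 : HasFDerivAt (fun y => φ (x - y)) _ y := (hφ (x - y)).hasFDerivAt.comp y h1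
  rw [h2.fderiv]
  simp

/-- The function y ↦ η (x - y) is an admissible test function, and the sign from differentiating in
y cancels the sign in the definition of the weak derivative. -/
theorem HasWeakDeriv.fderiv_mol {η : R3 → ℝ} (hη : IsMollifier η) {i : Fin 3} {f g : R3 → ℝ}
    (h : HasWeakDeriv i f g) (hf : LocallyIntegrable f volume) (x : R3) :
    fderiv ℝ (mol η f) x (e i) = mol η g x := by
  have hc : HasCompactSupport fun y => η (x - y) :=
    hη.compact.comp_homeomorph (Homeomorph.subLeft x)
  have h1 := h (fun y => η (x - y)) (hη.smooth.comp (contDiff_const.sub contDiff_id)) hc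
  rw [hη.fderiv_mol hf, mol_apply']
  simp_rw [fderiv_const_sub_apply (hη.smooth.differentiable (by norm_num)), mul_neg] at h1
  rw [integral_neg, neg_inj] at h1
  simp_rw [smul_eq_mul]
  simpa only [mul_comm] using h1

theorem HasWeakDeriv.translate {i : Fin 3} {f g : R3 → ℝ} (h : HasWeakDeriv i f g) (z : R3) :
    HasWeakDeriv i (fun x => f (x + z)) (fun x => g (x + z)) := by
  intro φ hφ hc
  have h1 := h (fun y => φ (y - z)) (hφ.comp (contDiff_id.sub contDiff_const))
    (hc.comp_homeomorph (Homeomorph.subRight z))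
  rw [← integral_add_right_eq_self _ z, ← integral_add_right_eq_self (fun x => g x * φ (x - z)) z] at h1
  have h2 : ∀ x, fderiv ℝ (fun y => φ (y - z)) (x + z) (e i) = fderiv ℝ φ x (e i) := by
    intro x
    rw [fderiv_comp_sub, add_sub_cancel_right]
  simpa only [h2, add_sub_cancel_right] using h1


/-! ### The bound for the absolute singular integral in Lebesgue spaces -/

theorem lintegral_enorm_rpow_eq {E : Type*} [NormedAddCommGroup E] {p : ℝ} (hp : 0 < p)
    (f : R3 → E) : ∫⁻ x, ‖f x‖ₑ ^ p = eLpNorm f (ENNReal.ofReal p) volume ^ p := by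
  have hp1 : ENNReal.ofReal p ≠ 0 := by rwa [Ne, ENNReal.ofReal_eq_zero, not_le]
  rw [eLpNorm_eq_lintegral_rpow_enorm_toReal hp1 ENNReal.ofReal_ne_top, ENNReal.toReal_ofReal hp.le,
    ← ENNReal.rpow_mul, one_div_mul_cancel hp.ne', ENNReal.rpow_one]

theorem lintegral_add_rpow_le {p : ℝ} (hp : 1 ≤ p) {f g : R3 → ℝ≥0∞} (hf : Measurable f)
    (hg : Measurable g) {A B : ℝ≥0∞} (hA : ∫⁻ x, f x ^ p ≤ A ^ p) (hB : ∫⁻ x, g x ^ p ≤ B ^ p) :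
    ∫⁻ x, (f x + g x) ^ p ≤ (A + B) ^ p := by
  have hp0 : 0 < p := by linarith
  have h := ENNReal.lintegral_Lp_add_le (μ := (volume : Measure R3)) hf.aemeasurable
    hg.aemeasurable hp
  rw [one_div, ENNReal.rpow_inv_le_iff hp0] at h
  refine h.trans (ENNReal.rpow_le_rpow (add_le_add ?_ ?_) hp0.le)
  · rwa [ENNReal.rpow_inv_le_iff hp0]
  · rwa [ENNReal.rpow_inv_le_iff hp0]

theorem exists_lintegral_maxFn_rpow_le_eLpNorm {p : ℝ} (hp : 1 < p) :
    ∃ C : ℝ≥0, ∀ {E : Type} [NormedAddCommGroup E] (f : R3 → E), Continuous f →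
      ∫⁻ x, maxFn (fun y => ‖f y‖ₑ) x ^ p ≤ (C * eLpNorm f (ENNReal.ofReal p) volume) ^ p := by
  obtain ⟨C, hC⟩ := exists_lintegral_maxFn_rpow_le hp
  have hp0 : 0 < p := by linarith
  refine ⟨C ^ (1 / p), fun f hf => ?_⟩
  refine (hC _ ?_).trans (le_of_eq ?_)
  · exact (continuous_enorm.comp hf).measurable
  · rw [lintegral_enorm_rpow_eq hp0, ENNReal.mul_rpow_of_nonneg _ _ hp0.le,
      ENNReal.coe_rpow_of_nonneg _ (by positivity), ← ENNReal.rpow_mul, one_div_mul_cancel hp0.ne',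
      ENNReal.rpow_one]

/-- Put N = |f| + Mf and P = M|∇f|. Pointwise, the singular integral is at most a multiple of N ^
(1-s) * P ^ s, hence of N ^ (1-ϑ) * (N + P) ^ ϑ because s ≤ ϑ. By the maximal theorem N is in L^a
and N + P is in L². Hölder's inequality applies with weights (1-ϑ)m/a and ϑm/2, whose sum is 1 by
the relation `hma`. -/
theorem exists_lintegral_absFrac_le_of_contDiff {s ϑ a m : ℝ} (hs0 : 0 < s) (hsϑ : s ≤ ϑ)
    (hϑ : ϑ < 1) (ha : 1 < a) (hm : 0 < m) (hma : 1 / m = ϑ / 2 + (1 - ϑ) / a) :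
    ∃ C : ℝ≥0, ∀ f : R3 → ℝ, ContDiff ℝ 1 f → MemLp f (ENNReal.ofReal 2) volume →
      MemLp (fderiv ℝ f) (ENNReal.ofReal 2) volume → MemLp f (ENNReal.ofReal a) volume →
      ∀ K : ℝ≥0∞, eLpNorm f (ENNReal.ofReal a) volume ≤ K → eLpNorm f (ENNReal.ofReal 2) volume ≤ K →
      eLpNorm (fderiv ℝ f) (ENNReal.ofReal 2) volume ≤ K →
      ∫⁻ x, absFrac s f x ^ m ≤ (C * K) ^ m := by
  obtain ⟨C0, hC0⟩ := exists_absFrac_le hs0 (hsϑ.trans_lt hϑ)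
  obtain ⟨Ca, hCa⟩ := exists_lintegral_maxFn_rpow_le_eLpNorm ha
  obtain ⟨C2, hC2⟩ := exists_lintegral_maxFn_rpow_le_eLpNorm (one_lt_two : (1 : ℝ) < 2)
  have ha0 : 0 < a := by linarith
  set D : ℝ≥0 := 1 + Ca + (1 + C2 + C2) with hD
  refine ⟨2 * C0 * D, fun f hf hf2 hg2 hfa K hKa hK2 hKg => ?_⟩
  set M := maxFn (fun y => ‖f y‖ₑ) with hM
  set P := maxFn (fun y => ‖fderiv ℝ f y‖ₑ) with hP
  have hfm : Measurable fun y => ‖f y‖ₑ := (continuous_enorm.comp hf.continuous).measurable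
  have hgc : Continuous (fderiv ℝ f) := hf.continuous_fderiv (by norm_num)
  have hgm : Measurable fun y => ‖fderiv ℝ f y‖ₑ := (continuous_enorm.comp hgc).measurable
  have hMm : Measurable M := measurable_maxFn hfm
  have hPm : Measurable P := measurable_maxFn hgm
  have hNm : Measurable fun x => ‖f x‖ₑ + M x := hfm.add hMm
  have hM2 := hC2 f hf.continuous
  have hMa := hCa f hf.continuous
  have hP2 := hC2 _ hgc
  have fin : ∀ {h : R3 → ℝ≥0∞} {B : ℝ≥0∞}, Measurable h → B ≠ ⊤ → ∫⁻ x, h x ^ (2 : ℝ) ≤ B ^ (2 : ℝ) →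
      ∀ᵐ x, h x ≠ ⊤ := by
    intro h B hh hB hle
    have := ae_lt_top (hh.pow_const (2 : ℝ))
      (hle.trans_lt (ENNReal.rpow_lt_top_of_nonneg (by norm_num) hB)).ne
    filter_upwards [this] with x hx hcon
    rw [hcon] at hx
    simp at hx
  have hpt : ∀ᵐ x, absFrac s f x ≤ 2 * C0 *
      ((‖f x‖ₑ + M x) ^ (1 - ϑ) * (‖f x‖ₑ + M x + P x) ^ ϑ) := by
    filter_upwards [fin hMm (ENNReal.mul_ne_top ENNReal.coe_ne_top hf2.2.ne) hM2,
      fin hPm (ENNReal.mul_ne_top ENNReal.coe_ne_top hg2.2.ne) hP2] with x h1 h2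
    refine (le_rpow_mul_rpow_of_forall hs0 (hsϑ.trans_lt hϑ) C0 h2
      (ENNReal.add_ne_top.2 ⟨enorm_ne_top, h1⟩) (hC0 f hf x)).trans ?_
    refine mul_le_mul_right ?_ _
    calc (‖f x‖ₑ + M x) ^ (1 - s) * P x ^ s
        = (‖f x‖ₑ + M x) ^ (1 - ϑ) * ((‖f x‖ₑ + M x) ^ (ϑ - s) * P x ^ s) := by
          rw [← mul_assoc, ← ENNReal.rpow_add_of_nonneg _ _ (by linarith) (by linarith)]
          congr 2; ring
      _ ≤ (‖f x‖ₑ + M x) ^ (1 - ϑ) * ((‖f x‖ₑ + M x + P x) ^ (ϑ - s) *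
            (‖f x‖ₑ + M x + P x) ^ s) := by
          refine mul_le_mul_right (mul_le_mul' (ENNReal.rpow_le_rpow le_self_add (by linarith))
            (ENNReal.rpow_le_rpow le_add_self hs0.le)) _
      _ = _ := by
          rw [← ENNReal.rpow_add_of_nonneg _ _ (by linarith) (by linarith), sub_add_cancel]
  have hϑ0 : 0 < ϑ := hs0.trans_le hsϑ
  have hp1 : 0 ≤ (1 - ϑ) * m / a := by
    have : 0 ≤ 1 - ϑ := by linarith
    positivity
  have hq1 : 0 ≤ ϑ * m / 2 := by positivity
  have hpq : (1 - ϑ) * m / a + ϑ * m / 2 = 1 := by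
    have : 1 = m * (ϑ / 2 + (1 - ϑ) / a) := by rw [← hma, mul_one_div_cancel hm.ne']
    linear_combination (-1 : ℝ) * this
  have hI1 : ∫⁻ x, (‖f x‖ₑ + M x) ^ a ≤ (D * K) ^ a := by
    refine (lintegral_add_rpow_le ha.le hfm hMm (lintegral_enorm_rpow_eq ha0 f).le hMa).trans ?_
    refine ENNReal.rpow_le_rpow ?_ ha0.le
    calc _ ≤ K + Ca * K := by gcongr
      _ = ((1 + Ca : ℝ≥0) : ℝ≥0∞) * K := by push_cast; ring
      _ ≤ _ := by gcongr; exact le_self_add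
  have hI2 : ∫⁻ x, (‖f x‖ₑ + M x + P x) ^ (2 : ℝ) ≤ (D * K) ^ (2 : ℝ) := by
    refine (lintegral_add_rpow_le one_le_two hNm hPm (lintegral_add_rpow_le one_le_two hfm hMm
      (lintegral_enorm_rpow_eq two_pos f).le hM2) hP2).trans ?_
    refine ENNReal.rpow_le_rpow ?_ (by norm_num)
    calc _ ≤ K + C2 * K + C2 * K := by gcongr
      _ = ((1 + C2 + C2 : ℝ≥0) : ℝ≥0∞) * K := by push_cast; ring
      _ ≤ _ := by gcongr; exact le_add_self
  calc ∫⁻ x, absFrac s f x ^ m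
      ≤ ∫⁻ x, (2 * C0 : ℝ≥0∞) ^ m * (((‖f x‖ₑ + M x) ^ a) ^ ((1 - ϑ) * m / a) *
          ((‖f x‖ₑ + M x + P x) ^ (2 : ℝ)) ^ (ϑ * m / 2)) := by
        refine lintegral_mono_ae ?_
        filter_upwards [hpt] with x hx
        refine (ENNReal.rpow_le_rpow hx hm.le).trans (le_of_eq ?_)
        rw [ENNReal.mul_rpow_of_nonneg (2 * (C0 : ℝ≥0∞)) _ hm.le,
          ENNReal.mul_rpow_of_nonneg (_ ^ (1 - ϑ)) _ hm.le,
          ← ENNReal.rpow_mul, ← ENNReal.rpow_mul, ← ENNReal.rpow_mul, ← ENNReal.rpow_mul]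
        congr 3
        · field_simp
        · ring
    _ = (2 * C0 : ℝ≥0∞) ^ m * ∫⁻ x, ((‖f x‖ₑ + M x) ^ a) ^ ((1 - ϑ) * m / a) *
          ((‖f x‖ₑ + M x + P x) ^ (2 : ℝ)) ^ (ϑ * m / 2) :=
        lintegral_const_mul _ (((hNm.pow_const _).pow_const _).mul
          (((hNm.add hPm).pow_const _).pow_const _))
    _ ≤ (2 * C0 : ℝ≥0∞) ^ m * ((∫⁻ x, (‖f x‖ₑ + M x) ^ a) ^ ((1 - ϑ) * m / a) *
          (∫⁻ x, (‖f x‖ₑ + M x + P x) ^ (2 : ℝ)) ^ (ϑ * m / 2)) := by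
        gcongr
        exact ENNReal.lintegral_mul_norm_pow_le (hNm.pow_const _).aemeasurable
          ((hNm.add hPm).pow_const _).aemeasurable hp1 hq1 hpq
    _ ≤ (2 * C0 : ℝ≥0∞) ^ m * (((D * K) ^ a) ^ ((1 - ϑ) * m / a) *
          ((D * K) ^ (2 : ℝ)) ^ (ϑ * m / 2)) := by gcongr
    _ = _ := by
        rw [← ENNReal.rpow_mul, ← ENNReal.rpow_mul, ← ENNReal.rpow_add_of_nonneg _ _ (by positivity)
          (by positivity), show a * ((1 - ϑ) * m / a) + 2 * (ϑ * m / 2) = m by field_simp; ring,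
          ← ENNReal.mul_rpow_of_nonneg _ _ hm.le]
        push_cast
        ring_nf

theorem enorm_fderiv_le_sum (f : R3 → ℝ) (x : R3) :
    ‖fderiv ℝ f x‖ₑ ≤ ∑ i, ‖fderiv ℝ f x (e i)‖ₑ := by
  have h : ‖fderiv ℝ f x‖ ≤ ∑ i, ‖fderiv ℝ f x (e i)‖ := by
    refine ContinuousLinearMap.opNorm_le_bound _ (by positivity) fun v => ?_
    have hv : v = ∑ i, v i • e i := by
      ext j; simp [e, Finset.sum_apply, Pi.single_apply]
    conv_lhs => rw [hv]
    rw [map_sum, Finset.sum_mul]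
    refine (norm_sum_le _ _).trans (Finset.sum_le_sum fun i _ => ?_)
    rw [map_smul, norm_smul, mul_comm]
    gcongr
    exact PiLp.norm_apply_le v i
  rw [← ofReal_norm]
  refine (ENNReal.ofReal_le_ofReal h).trans ?_
  rw [ENNReal.ofReal_sum_of_nonneg fun i _ => norm_nonneg _]
  simp only [ofReal_norm, le_refl]

theorem eLpNorm_fderiv_mol_le {η : R3 → ℝ} (hη : IsMollifier η) {p : ℝ} (hp : 1 ≤ p)
    {f : R3 → ℝ} {g : Fin 3 → R3 → ℝ} (hf : LocallyIntegrable f volume)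
    (hg : ∀ i, AEStronglyMeasurable (g i) volume) (h : ∀ i, HasWeakDeriv i f (g i)) :
    eLpNorm (fderiv ℝ (mol η f)) (ENNReal.ofReal p) volume ≤
      ∑ i, eLpNorm (g i) (ENNReal.ofReal p) volume := by
  have hp1 : 1 ≤ ENNReal.ofReal p := by
    rwa [← ENNReal.ofReal_one, ENNReal.ofReal_le_ofReal_iff (by linarith)]
  have hd : ∀ i : Fin 3, (fun x => ‖fderiv ℝ (mol η f) x (e i)‖) = fun x => ‖mol η (g i) x‖ := by
    intro i; funext x; rw [(h i).fderiv_mol hη hf]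
  have hc : ∀ i : Fin 3, Continuous fun x => ‖fderiv ℝ (mol η f) x (e i)‖ := fun i =>
    (((hη.contDiff_mol hf).continuous_fderiv (by norm_num)).clm_apply continuous_const).norm
  calc _ ≤ eLpNorm (∑ i, fun x => ‖fderiv ℝ (mol η f) x (e i)‖) (ENNReal.ofReal p) volume := by
        refine eLpNorm_mono_enorm fun x => (enorm_fderiv_le_sum _ x).trans (le_of_eq ?_)
        rw [Finset.sum_apply, Real.enorm_of_nonneg (by positivity),
          ENNReal.ofReal_sum_of_nonneg fun i _ => norm_nonneg _]
        simp only [ofReal_norm]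
    _ ≤ ∑ i, eLpNorm (fun x => ‖fderiv ℝ (mol η f) x (e i)‖) (ENNReal.ofReal p) volume :=
        eLpNorm_sum_le (fun i _ => (hc i).aestronglyMeasurable) hp1
    _ ≤ _ := by
        refine Finset.sum_le_sum fun i _ => ?_
        rw [hd i, eLpNorm_norm]
        exact hη.eLpNorm_mol_le hp (hg i)

theorem measurable_absFrac (s : ℝ) {f : R3 → ℝ} (hf : Measurable f) : Measurable (absFrac s f) := by
  refine Measurable.lintegral_prod_right' (f := fun w : R3 × R3 =>
    ‖f w.1 - f (w.1 - w.2)‖ₑ * ENNReal.ofReal (‖w.2‖ ^ (-(3 + s)))) ?_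
  have h1 : Measurable fun w : R3 × R3 => f w.1 := hf.comp measurable_fst
  have h2 : Measurable fun w : R3 × R3 => f (w.1 - w.2) := hf.comp (by fun_prop)
  fun_prop

/-- Mollification does not increase the norms on the right. Fatou's lemma, first in z and then in x,
carries the bound for the mollified functions to f. -/
theorem exists_lintegral_absFrac_le {s ϑ a m : ℝ} (hs0 : 0 < s) (hsϑ : s ≤ ϑ)
    (hϑ : ϑ < 1) (ha : 1 < a) (hm : 0 < m) (hma : 1 / m = ϑ / 2 + (1 - ϑ) / a) :
    ∃ C : ℝ≥0, ∀ (f : R3 → ℝ) (g : Fin 3 → R3 → ℝ), MemLp f (ENNReal.ofReal 2) volume →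
      (∀ i, MemLp (g i) (ENNReal.ofReal 2) volume) → (∀ i, HasWeakDeriv i f (g i)) →
      MemLp f (ENNReal.ofReal a) volume →
      ∫⁻ x, absFrac s f x ^ m ≤ (C * (eLpNorm f (ENNReal.ofReal a) volume +
        eLpNorm f (ENNReal.ofReal 2) volume + ∑ i, eLpNorm (g i) (ENNReal.ofReal 2) volume)) ^ m := by
  obtain ⟨C, hC⟩ := exists_lintegral_absFrac_le_of_contDiff hs0 hsϑ hϑ ha hm hma
  refine ⟨C, fun f g hf hg hd hfa => ?_⟩
  set K := eLpNorm f (ENNReal.ofReal a) volume + eLpNorm f (ENNReal.ofReal 2) volume +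
    ∑ i, eLpNorm (g i) (ENNReal.ofReal 2) volume with hK
  have hf1 : LocallyIntegrable f volume := hf.locallyIntegrable (by simp)
  have hsm : ∀ n, ContDiff ℝ 1 (mol (ker n) f) := fun n =>
    ((isMollifier_ker n).contDiff_mol hf1).of_le (by norm_cast)
  have hn : ∀ n, ∫⁻ x, absFrac s (mol (ker n) f) x ^ m ≤ (C * K) ^ m := by
    intro n
    have h1 := (isMollifier_ker n).eLpNorm_mol_le one_le_two hf.1
    have h2 := (isMollifier_ker n).eLpNorm_mol_le ha.le hf.1
    have h3 := eLpNorm_fderiv_mol_le (isMollifier_ker n) one_le_two hf1 (fun i => (hg i).1) hd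
    refine hC _ (hsm n) ⟨(hsm n).continuous.aestronglyMeasurable, h1.trans_lt hf.2⟩
      ⟨((hsm n).continuous_fderiv (by norm_num)).aestronglyMeasurable, h3.trans_lt ?_⟩
      ⟨(hsm n).continuous.aestronglyMeasurable, h2.trans_lt hfa.2⟩ K (h2.trans ?_) (h1.trans ?_)
      (h3.trans ?_)
    · exact ENNReal.sum_lt_top.2 fun i _ => (hg i).2
    · rw [hK, add_assoc]; exact le_self_add
    · rw [hK, add_assoc]; exact le_self_add.trans le_add_self
    · exact le_add_self
  have hpt : ∀ᵐ x, absFrac s f x ^ m ≤ liminf (fun n => absFrac s (mol (ker n) f) x ^ m) atTop := by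
    have hae := ae_tendsto_mol hf1
    filter_upwards [hae] with x hx
    -- For fixed x, almost every z is such that the mollifications converge at x - z.
    have hz := (Measure.measurePreserving_sub_left (volume : Measure R3) x).quasiMeasurePreserving.ae hae
    have h1 : absFrac s f x ≤ liminf (fun n => absFrac s (mol (ker n) f) x) atTop := by
      refine le_trans (lintegral_mono_ae ?_) (lintegral_liminf_le fun n => ?_)
      · filter_upwards [hz] with z hz
        refine (Tendsto.liminf_eq ?_).ge
        exact ENNReal.Tendsto.mul_const ((hx.sub hz).enorm) (Or.inr ENNReal.ofReal_ne_top)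
      · have := (hsm n).continuous.measurable
        have h2 : Measurable fun z => mol (ker n) f (x - z) := this.comp (by fun_prop)
        fun_prop
    have h2 : Monotone fun t : ℝ≥0∞ => t ^ m := ENNReal.monotone_rpow_of_nonneg hm.le
    calc _ ≤ (liminf (fun n => absFrac s (mol (ker n) f) x) atTop) ^ m := h2 h1
      _ = _ := h2.map_liminf_of_continuousAt _ (ENNReal.continuous_rpow_const.continuousAt)
  calc _ ≤ ∫⁻ x, liminf (fun n => absFrac s (mol (ker n) f) x ^ m) atTop := lintegral_mono_ae hpt
    _ ≤ liminf (fun n => ∫⁻ x, absFrac s (mol (ker n) f) x ^ m) atTop :=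
        lintegral_liminf_le fun n => (measurable_absFrac s (hsm n).continuous.measurable).pow_const m
    _ ≤ _ := liminf_le_of_le (by isBoundedDefault) fun b hb => by
        obtain ⟨n, hn'⟩ := hb.exists
        exact hn'.trans (hn n)


/-! ### `Λ^s` as a singular integral -/

/-- Near 0 the bound 1 - cos t ≤ t²/2 reduces the kernel to |z| ^ (-1-s); far away 1 - cos is at
most 2. -/
theorem integrable_one_sub_cos {s : ℝ} (hs0 : 0 < s) (hs1 : s < 1) (ξ : R3) :
    Integrable fun z : R3 => (1 - Real.cos (2 * Real.pi * inner ℝ z ξ)) * ‖z‖ ^ (-(3 + s)) := by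
  have hm : Measurable fun z : R3 => (1 - Real.cos (2 * Real.pi * inner ℝ z ξ)) *
      ‖z‖ ^ (-(3 + s)) := by
    have : Measurable fun z : R3 => inner ℝ z ξ := (by fun_prop : Continuous _).measurable
    fun_prop
  refine ⟨hm.aestronglyMeasurable, ?_⟩
  have hc : volume (Metric.ball (0 : R3) 1) ≠ ⊤ := measure_ball_lt_top.ne
  set B : ℝ := 2 * Real.pi ^ 2 * ‖ξ‖ ^ 2 with hB
  have hball : ∀ A : ℝ, ∀ r : ℝ, 0 < r → ∫⁻ _ in Metric.closedBall (0 : R3) r, ENNReal.ofReal A ≤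
      (ENNReal.ofReal A * volume (Metric.ball (0 : R3) 1)) * ENNReal.ofReal (r ^ 3) := by
    intro A r hr
    rw [setLIntegral_const, volume_closedBall_R3 _ hr.le]
    exact le_of_eq (by ring)
  have h1 := setLIntegral_ball_mul_norm_rpow_le (γ := 1 + s) (by linarith) (by linarith)
    measurable_const (hball B) one_pos
  have h2 := setLIntegral_compl_ball_mul_norm_rpow_le (γ := 3 + s) (by linarith)
    measurable_const (hball 2) one_pos
  rw [HasFiniteIntegral, ← lintegral_add_compl _ measurableSet_ball (A := Metric.ball (0 : R3) 1)]
  refine ENNReal.add_lt_top.2 ⟨lt_of_le_of_lt (le_trans (lintegral_mono fun z => ?_) h1) ?_,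
    lt_of_le_of_lt (le_trans (lintegral_mono fun z => ?_) h2) ?_⟩
  · rw [← ENNReal.ofReal_mul (by positivity), Real.enorm_of_nonneg
      (mul_nonneg (by linarith [Real.cos_le_one (2 * Real.pi * inner ℝ z ξ)]) (by positivity))]
    refine ENNReal.ofReal_le_ofReal ?_
    rcases eq_or_ne z 0 with rfl | hz
    · simp only [inner_zero_left, mul_zero, Real.cos_zero, sub_self, zero_mul]
      positivity
    · have hz' : 0 < ‖z‖ := norm_pos_iff.2 hz
      have e1 : ‖z‖ ^ (-(1 + s)) = ‖z‖ ^ 2 * ‖z‖ ^ (-(3 + s)) := by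
        rw [← Real.rpow_natCast ‖z‖ 2, ← Real.rpow_add hz']
        congr 1; push_cast; ring
      rw [e1, ← mul_assoc]
      gcongr
      have h3 := Real.one_sub_sq_div_two_le_cos (x := 2 * Real.pi * inner ℝ z ξ)
      have h4 : (inner ℝ z ξ) ^ 2 ≤ (‖z‖ * ‖ξ‖) ^ 2 :=
        sq_le_sq' (neg_le_of_abs_le (abs_real_inner_le_norm z ξ)) (real_inner_le_norm z ξ)
      calc _ ≤ (2 * Real.pi * inner ℝ z ξ) ^ 2 / 2 := by linarith
        _ = 2 * Real.pi ^ 2 * (inner ℝ z ξ) ^ 2 := by ring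
        _ ≤ 2 * Real.pi ^ 2 * (‖z‖ * ‖ξ‖) ^ 2 := by gcongr
        _ = _ := by rw [hB]; ring
  · exact ENNReal.mul_lt_top (ENNReal.mul_lt_top ENNReal.ofReal_lt_top hc.lt_top)
      ENNReal.ofReal_lt_top
  · rw [← ENNReal.ofReal_mul (by positivity), Real.enorm_of_nonneg
      (mul_nonneg (by linarith [Real.cos_le_one (2 * Real.pi * inner ℝ z ξ)]) (by positivity))]
    refine ENNReal.ofReal_le_ofReal ?_
    gcongr
    linarith [Real.neg_one_le_cos (2 * Real.pi * inner ℝ z ξ)]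
  · exact ENNReal.mul_lt_top (ENNReal.mul_lt_top ENNReal.ofReal_lt_top hc.lt_top)
      ENNReal.ofReal_lt_top

/-- `∫ (1 - cos (2π z₀)) |z|^(-3-s) dz`. -/
noncomputable def fracConst (s : ℝ) : ℝ :=
  ∫ z : R3, (1 - Real.cos (2 * Real.pi * inner ℝ z (e 0))) * ‖z‖ ^ (-(3 + s))

theorem norm_e (i : Fin 3) : ‖e i‖ = 1 := by simp [e]

/-- The nonnegative integrand is positive on a nonempty open set: at e₀/2 the cosine equals -1. -/
theorem fracConst_pos {s : ℝ} (hs0 : 0 < s) (hs1 : s < 1) : 0 < fracConst s := by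
  rw [fracConst, integral_pos_iff_support_of_nonneg]
  · have hc : Continuous fun z : R3 => Real.cos (2 * Real.pi * inner ℝ z (e 0)) := by fun_prop
    have ho : IsOpen {z : R3 | Real.cos (2 * Real.pi * inner ℝ z (e 0)) < 1} :=
      isOpen_lt hc continuous_const
    refine lt_of_lt_of_le (ho.measure_pos volume ⟨(1 / 2 : ℝ) • e 0, ?_⟩) (measure_mono ?_)
    · show Real.cos _ < 1
      rw [real_inner_smul_left, real_inner_self_eq_norm_sq, norm_e]
      rw [show 2 * Real.pi * (1 / 2 * 1 ^ 2) = Real.pi by ring, Real.cos_pi]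
      norm_num
    · intro z hz
      have hz : Real.cos (2 * Real.pi * inner ℝ z (e 0)) < 1 := hz
      have hz0 : z ≠ 0 := by
        rintro rfl; simp at hz
      have : 0 < ‖z‖ := norm_pos_iff.2 hz0
      rw [Function.mem_support]
      exact mul_ne_zero (by linarith) (Real.rpow_pos_of_pos this _).ne'
  · intro z
    exact mul_nonneg (by linarith [Real.cos_le_one (2 * Real.pi * inner ℝ z (e 0))]) (by positivity)
  · exact integrable_one_sub_cos hs0 hs1 _

/-- The integral depends on ξ only through its length and is homogeneous of degree s. A reflection
taking ξ/|ξ| to `e 0`, followed by dilation by |ξ|, turns it into `fracConst s`. -/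
theorem integral_one_sub_cos {s : ℝ} (hs0 : 0 < s) (ξ : R3) :
    ∫ z : R3, (1 - Real.cos (2 * Real.pi * inner ℝ z ξ)) * ‖z‖ ^ (-(3 + s)) =
      fracConst s * ‖ξ‖ ^ s := by
  rcases eq_or_ne ξ 0 with rfl | hξ
  · simp [Real.zero_rpow hs0.ne']
  have hξ' : 0 < ‖ξ‖ := norm_pos_iff.2 hξ
  set w : R3 := ‖ξ‖⁻¹ • ξ with hw
  have hwn : ‖w‖ = ‖e 0‖ := by
    rw [hw, norm_smul, norm_inv, norm_norm, inv_mul_cancel₀ hξ'.ne', norm_e]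
  set Q := (ℝ ∙ (w - e 0))ᗮ.reflection with hQ
  have hQw : Q w = e 0 := Submodule.reflection_sub hwn
  have hξw : ξ = ‖ξ‖ • w := by rw [hw, smul_smul, mul_inv_cancel₀ hξ'.ne', one_smul]
  set F : R3 → ℝ := fun y => (1 - Real.cos (2 * Real.pi * inner ℝ y (e 0))) * ‖y‖ ^ (-(3 + s)) with hF
  have h1 : ∀ z : R3, (1 - Real.cos (2 * Real.pi * inner ℝ z ξ)) * ‖z‖ ^ (-(3 + s)) =
      ‖ξ‖ ^ (3 + s) * F (‖ξ‖ • Q z) := by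
    intro z
    have e1 : inner ℝ (‖ξ‖ • Q z) (e 0) = inner ℝ z ξ := by
      rw [real_inner_smul_left, ← hQw, LinearIsometryEquiv.inner_map_map, ← real_inner_smul_right,
        ← hξw]
    simp only [hF]
    rw [e1, norm_smul, norm_norm, LinearIsometryEquiv.norm_map,
      Real.mul_rpow (norm_nonneg _) (norm_nonneg _), Real.rpow_neg hξ'.le]
    have : ‖ξ‖ ^ (3 + s) ≠ 0 := (Real.rpow_pos_of_pos hξ' _).ne'
    field_simp
  simp_rw [h1]
  have hQi : ∫ z, F (‖ξ‖ • Q z) = ∫ y, F (‖ξ‖ • y) :=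
    Q.measurePreserving.integral_comp Q.toHomeomorph.measurableEmbedding (fun y => F (‖ξ‖ • y))
  rw [integral_const_mul, hQi, Measure.integral_comp_smul]
  simp only [finrank_euclideanSpace, Fintype.card_fin, smul_eq_mul]
  rw [abs_of_pos (by positivity), Real.rpow_add hξ']
  have : ∫ x, F x = fracConst s := rfl
  rw [this]
  have h3 : ‖ξ‖ ^ (3 : ℝ) = ‖ξ‖ ^ 3 := by exact_mod_cast Real.rpow_natCast ‖ξ‖ 3
  rw [h3]
  field_simp

-- In Fourier variables the symmetric second difference multiplies φ̂ by 1 - cos(2π z·ξ).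
-- Integrating this factor against |z| ^ (-3-s) recovers the symbol, and Fubini's theorem exchanges
-- the two integrals.
open Real in
theorem frac_eq_integral {s : ℝ} (hs0 : 0 < s) (hs1 : s < 1) (φ : 𝓢(R3, ℂ)) (x : R3) :
    frac s φ x = ((2 * Real.pi) ^ s / fracConst s : ℝ) *
      ∫ z : R3, (φ x - (φ (x + z) + φ (x - z)) / 2) * (‖z‖ ^ (-(3 + s)) : ℝ) := by
  have hJ := fracConst_pos hs0 hs1
  set c : ℝ := (2 * Real.pi) ^ s / fracConst s with hc
  set ψ : 𝓢(R3, ℂ) := 𝓕 φ with hψ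
  have hψ' : (ψ : R3 → ℂ) = 𝓕 (φ : R3 → ℂ) := SchwartzMap.fourier_coe φ
  have hinv : ∀ y, φ y = ∫ ξ, 𝐞 (inner ℝ ξ y) • ψ ξ := by
    intro y
    have h1 : 𝓕⁻ ψ = φ := by rw [hψ]; exact FourierTransform.fourierInv_fourier_eq φ
    rw [← Real.fourierInv_eq, ← SchwartzMap.fourierInv_coe, h1]
  have hsym : ∀ ξ : R3, symb s ξ = c * ∫ z : R3, (1 - Real.cos (2 * Real.pi * inner ℝ z ξ)) *
      ‖z‖ ^ (-(3 + s)) := by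
    intro ξ
    rw [integral_one_sub_cos hs0, symb, Real.mul_rpow (by positivity) (norm_nonneg _), hc]
    field_simp
  have hint : Integrable (fun w : R3 × R3 => (𝐞 (inner ℝ w.1 x) • ψ w.1) *
      (((1 - Real.cos (2 * Real.pi * inner ℝ w.2 w.1)) * ‖w.2‖ ^ (-(3 + s)) : ℝ) : ℂ))
      (volume.prod volume) := by
    have hcont : Continuous fun ξ : R3 => 𝐞 (inner ℝ ξ x) • ψ ξ := by
      have := ψ.continuous
      exact (Real.continuous_fourierChar.comp (by fun_prop)).smul this
    have hmeas : AEStronglyMeasurable (fun w : R3 × R3 => (𝐞 (inner ℝ w.1 x) • ψ w.1) *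
      (((1 - Real.cos (2 * Real.pi * inner ℝ w.2 w.1)) * ‖w.2‖ ^ (-(3 + s)) : ℝ) : ℂ))
        ((volume : Measure R3).prod volume) := by
      refine Measurable.aestronglyMeasurable ?_
      have m1 : Measurable fun w : R3 × R3 => 𝐞 (inner ℝ w.1 x) • ψ w.1 :=
        hcont.measurable.comp measurable_fst
      have m2 : Measurable fun w : R3 × R3 => inner ℝ w.2 w.1 :=
        (by fun_prop : Continuous _).measurable
      have m3 : Measurable fun w : R3 × R3 =>
        (1 - Real.cos (2 * Real.pi * inner ℝ w.2 w.1)) * ‖w.2‖ ^ (-(3 + s)) := by fun_prop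
      exact m1.mul (Complex.measurable_ofReal.comp m3)
    rw [integrable_prod_iff hmeas]
    refine ⟨ae_of_all _ fun ξ => ?_, ?_⟩
    · have := ((integrable_one_sub_cos hs0 hs1 ξ).ofReal (𝕜 := ℂ)).const_mul (𝐞 (inner ℝ ξ x) • ψ ξ)
      exact this
    have e1 : ∀ ξ : R3, ∫ z, ‖(𝐞 (inner ℝ ξ x) • ψ ξ) *
        (((1 - Real.cos (2 * Real.pi * inner ℝ z ξ)) * ‖z‖ ^ (-(3 + s)) : ℝ) : ℂ)‖ =
        fracConst s * (‖ξ‖ ^ s * ‖ψ ξ‖) := by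
      intro ξ
      rw [← mul_assoc, ← integral_one_sub_cos hs0, ← integral_mul_const]
      refine integral_congr_ae (ae_of_all _ fun z => ?_)
      simp only
      rw [mul_comm _ ‖ψ ξ‖, norm_mul, Circle.norm_smul, Complex.norm_real, Real.norm_of_nonneg
        (mul_nonneg (by linarith [Real.cos_le_one (2 * Real.pi * inner ℝ z ξ)]) (by positivity))]
    simp_rw [e1]
    refine Integrable.const_mul ?_ _
    have i0 := ψ.integrable_pow_mul volume 0
    have i1 := ψ.integrable_pow_mul volume 1
    refine (i0.add i1).mono' ?_ (ae_of_all _ fun ξ => ?_)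
    · have h1 : Continuous fun ξ : R3 => ‖ξ‖ ^ s := continuous_norm.rpow_const fun _ => Or.inr hs0.le
      exact (h1.mul ψ.continuous.norm).aestronglyMeasurable
    · rw [Real.norm_of_nonneg (by positivity)]
      simp only [Pi.add_apply, pow_zero, pow_one, ← add_mul]
      gcongr
      rcases le_total ‖ξ‖ 1 with h | h
      · exact (Real.rpow_le_one (norm_nonneg _) h hs0.le).trans (by simp)
      · calc ‖ξ‖ ^ s ≤ ‖ξ‖ ^ (1 : ℝ) := Real.rpow_le_rpow_of_exponent_le h hs1.le
          _ ≤ _ := by rw [Real.rpow_one]; linarith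
  have hchar : ∀ y : R3, Integrable fun ξ : R3 => 𝐞 (inner ℝ ξ y) • ψ ξ := by
    intro y
    refine (ψ.integrable (μ := volume)).mono ?_ (ae_of_all _ fun ξ => ?_)
    · exact ((Real.continuous_fourierChar.comp (by fun_prop)).smul ψ.continuous).aestronglyMeasurable
    · rw [Circle.norm_smul]
  calc frac s φ x = ∫ ξ, 𝐞 (inner ℝ ξ x) • ((symb s ξ : ℂ) * ψ ξ) := by
        rw [frac, Real.fourierInv_eq, hψ']
    _ = ∫ ξ, (c : ℂ) * ∫ z, (𝐞 (inner ℝ ξ x) • ψ ξ) *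
          (((1 - Real.cos (2 * Real.pi * inner ℝ z ξ)) * ‖z‖ ^ (-(3 + s)) : ℝ) : ℂ) := by
        refine integral_congr_ae (ae_of_all _ fun ξ => ?_)
        simp only
        rw [integral_const_mul, integral_complex_ofReal, hsym, Circle.smul_def, Circle.smul_def]
        push_cast
        simp only [smul_eq_mul]
        ring
    _ = c * ∫ z, ∫ ξ, (𝐞 (inner ℝ ξ x) • ψ ξ) *
          (((1 - Real.cos (2 * Real.pi * inner ℝ z ξ)) * ‖z‖ ^ (-(3 + s)) : ℝ) : ℂ) := by
        rw [integral_const_mul]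
        congr 1
        exact integral_integral_swap (f := fun ξ z => (𝐞 (inner ℝ ξ x) • ψ ξ) *
          (((1 - Real.cos (2 * Real.pi * inner ℝ z ξ)) * ‖z‖ ^ (-(3 + s)) : ℝ) : ℂ)) hint
    _ = _ := by
        congr 1
        refine integral_congr_ae (ae_of_all _ fun z => ?_)
        simp only
        have hadd : Integrable fun ξ : R3 =>
            (𝐞 (inner ℝ ξ (x + z)) • ψ ξ + 𝐞 (inner ℝ ξ (x - z)) • ψ ξ) / 2 :=
          ((hchar _).add (hchar _)).div_const 2
        rw [hinv x, hinv (x + z), hinv (x - z), ← integral_add (hchar _) (hchar _),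
          ← integral_div, ← integral_sub (hchar _) hadd,
          ← integral_mul_const]
        refine integral_congr_ae (ae_of_all _ fun ξ => ?_)
        simp only [Circle.smul_def, Real.fourierChar_apply, smul_eq_mul, inner_add_right,
          inner_sub_right]
        push_cast
        rw [real_inner_comm ξ z, Complex.cos]
        have a1 : Complex.exp (2 * π * (inner ℝ ξ x + inner ℝ ξ z) * Complex.I) =
            Complex.exp (2 * π * inner ℝ ξ x * Complex.I) *
              Complex.exp (2 * π * inner ℝ ξ z * Complex.I) := by
          rw [← Complex.exp_add]; ring_nf
        have a2 : Complex.exp (2 * π * (inner ℝ ξ x - inner ℝ ξ z) * Complex.I) =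
            Complex.exp (2 * π * inner ℝ ξ x * Complex.I) *
              Complex.exp (-(2 * π * inner ℝ ξ z) * Complex.I) := by
          rw [← Complex.exp_add]; ring_nf
        rw [a1, a2]
        ring


/-! ### Fractional derivatives of `L²` functions -/

/-- The singular integral that represents `Λ^s f`. -/
noncomputable def fracInt (s : ℝ) (f : R3 → ℝ) (x : R3) : ℝ :=
  (2 * Real.pi) ^ s / fracConst s *
    ∫ z : R3, (f x - (f (x + z) + f (x - z)) / 2) * ‖z‖ ^ (-(3 + s))

/-- The second difference is the mean of the first differences at z and at -z, which contribute
equally because the kernel is even. -/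
theorem lintegral_enorm_secondDiff_le (s : ℝ) {h : R3 → ℂ} (hm : Measurable h) (x : R3) :
    ∫⁻ z, ‖(h x - (h (x + z) + h (x - z)) / 2) * (‖z‖ ^ (-(3 + s)) : ℝ)‖ₑ ≤
      ∫⁻ z, ‖h x - h (x - z)‖ₑ * ENNReal.ofReal (‖z‖ ^ (-(3 + s))) := by
  obtain ⟨I, hI⟩ : ∃ I, I = ∫⁻ z, ‖h x - h (x - z)‖ₑ * ENNReal.ofReal (‖z‖ ^ (-(3 + s))) := ⟨_, rfl⟩
  have hI' : ∫⁻ z, ‖h x - h (x + z)‖ₑ * ENNReal.ofReal (‖z‖ ^ (-(3 + s))) = I := by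
    rw [hI, ← lintegral_neg_eq_self]
    simp [sub_eq_add_neg]
  rw [← hI]
  have hk : ∀ z : R3, ‖((‖z‖ ^ (-(3 + s)) : ℝ) : ℂ)‖ₑ = ENNReal.ofReal (‖z‖ ^ (-(3 + s))) := by
    intro z
    rw [← ofReal_norm, Complex.norm_real, Real.norm_of_nonneg (by positivity)]
  have h2 : ‖(2 : ℂ)⁻¹‖ₑ = 2⁻¹ := by
    rw [enorm_inv (by norm_num)]; congr 1
    rw [← ofReal_norm]; simp
  calc _ ≤ ∫⁻ z, (2⁻¹ * (‖h x - h (x + z)‖ₑ * ENNReal.ofReal (‖z‖ ^ (-(3 + s)))) +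
        2⁻¹ * (‖h x - h (x - z)‖ₑ * ENNReal.ofReal (‖z‖ ^ (-(3 + s))))) := by
        refine lintegral_mono fun z => ?_
        rw [enorm_mul, hk, ← mul_assoc, ← mul_assoc, ← add_mul]
        gcongr
        have : h x - (h (x + z) + h (x - z)) / 2 =
          2⁻¹ * (h x - h (x + z)) + 2⁻¹ * (h x - h (x - z)) := by ring
        rw [this]
        refine (enorm_add_le _ _).trans ?_
        rw [enorm_mul, enorm_mul, h2]
    _ = 2⁻¹ * I + 2⁻¹ * I := by
        rw [lintegral_add_left (by fun_prop), lintegral_const_mul _ (by fun_prop),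
          lintegral_const_mul _ (by fun_prop), hI', ← hI]
    _ = I := by rw [← add_mul, ENNReal.inv_two_add_inv_two, one_mul]

theorem enorm_sub_eq_ofReal (f : R3 → ℝ) (x y : R3) : ‖(f x : ℂ) - (f y : ℂ)‖ₑ = ‖f x - f y‖ₑ := by
  rw [← Complex.ofReal_sub, ← ofReal_norm, Complex.norm_real, ofReal_norm]

theorem ofReal_fracInt (s : ℝ) (f : R3 → ℝ) (x : R3) :
    (fracInt s f x : ℂ) = ((2 * Real.pi) ^ s / fracConst s : ℝ) *
      ∫ z : R3, ((f x : ℂ) - (f (x + z) + f (x - z)) / 2) * (‖z‖ ^ (-(3 + s)) : ℝ) := by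
  rw [fracInt, Complex.ofReal_mul, ← integral_complex_ofReal]
  push_cast
  rfl

theorem enorm_fracInt_le (s : ℝ) {f : R3 → ℝ} (hf : Measurable f) (x : R3) :
    ‖fracInt s f x‖ₑ ≤ ‖(2 * Real.pi) ^ s / fracConst s‖ₑ * absFrac s f x := by
  have h1 : ‖fracInt s f x‖ₑ = ‖(fracInt s f x : ℂ)‖ₑ := by
    rw [← ofReal_norm, ← ofReal_norm, Complex.norm_real]
  rw [h1, ofReal_fracInt, enorm_mul]
  have h2 : ‖(((2 * Real.pi) ^ s / fracConst s : ℝ) : ℂ)‖ₑ =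
      ‖(2 * Real.pi) ^ s / fracConst s‖ₑ := by
    rw [← ofReal_norm, ← ofReal_norm, Complex.norm_real]
  rw [h2]
  gcongr
  refine (enorm_integral_le_lintegral_enorm _).trans ?_
  refine (lintegral_enorm_secondDiff_le s (h := fun x => (f x : ℂ))
    (Complex.measurable_ofReal.comp hf) x).trans_eq ?_
  simp only [enorm_sub_eq_ofReal]
  rfl

theorem measurable_secondDiff (s : ℝ) {h : R3 → ℂ} (hm : Measurable h) :
    Measurable fun w : R3 × R3 =>
      (h w.1 - (h (w.1 + w.2) + h (w.1 - w.2)) / 2) * ((‖w.2‖ ^ (-(3 + s)) : ℝ) : ℂ) := by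
  have h1 : Measurable fun w : R3 × R3 => h (w.1 + w.2) := hm.comp (measurable_fst.add measurable_snd)
  have h2 : Measurable fun w : R3 × R3 => h (w.1 - w.2) := hm.comp (measurable_fst.sub measurable_snd)
  have h3 : Measurable fun w : R3 × R3 => ((‖w.2‖ ^ (-(3 + s)) : ℝ) : ℂ) := by fun_prop
  fun_prop

theorem integral_translate_mul {f g : R3 → ℂ} (z : R3) :
    ∫ x, f (x + z) * g x = ∫ x, f x * g (x - z) := by
  rw [← integral_add_right_eq_self (fun x => f x * g (x - z)) z]
  simp

/-- `Λ^s` is formally self-adjoint. -/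
theorem integral_mul_secondDiff_comm (s : ℝ) {f g : R3 → ℂ} (hf : Measurable f) (hg : Measurable g)
    (hf2 : MemLp f 2 volume) (hg2 : MemLp g 2 volume)
    (hfg : ∫⁻ x, ‖g x‖ₑ * ∫⁻ z, ‖f x - f (x - z)‖ₑ * ENNReal.ofReal (‖z‖ ^ (-(3 + s))) ≠ ⊤)
    (hgf : ∫⁻ x, ‖f x‖ₑ * ∫⁻ z, ‖g x - g (x - z)‖ₑ * ENNReal.ofReal (‖z‖ ^ (-(3 + s))) ≠ ⊤) :
    ∫ x, g x * ∫ z, (f x - (f (x + z) + f (x - z)) / 2) * ((‖z‖ ^ (-(3 + s)) : ℝ) : ℂ) =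
    ∫ x, f x * ∫ z, (g x - (g (x + z) + g (x - z)) / 2) * ((‖z‖ ^ (-(3 + s)) : ℝ) : ℂ) := by
  have key : ∀ {f g : R3 → ℂ}, Measurable f → Measurable g →
      ∫⁻ x, ‖g x‖ₑ * ∫⁻ z, ‖f x - f (x - z)‖ₑ * ENNReal.ofReal (‖z‖ ^ (-(3 + s))) ≠ ⊤ →
      ∫ x, g x * ∫ z, (f x - (f (x + z) + f (x - z)) / 2) * ((‖z‖ ^ (-(3 + s)) : ℝ) : ℂ) =
      ∫ z, ∫ x, g x * ((f x - (f (x + z) + f (x - z)) / 2) * ((‖z‖ ^ (-(3 + s)) : ℝ) : ℂ)) := by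
    intro f g hf hg h
    simp_rw [← integral_const_mul]
    have hmm : Measurable fun w : R3 × R3 => g w.1 *
        ((f w.1 - (f (w.1 + w.2) + f (w.1 - w.2)) / 2) * ((‖w.2‖ ^ (-(3 + s)) : ℝ) : ℂ)) :=
      (hg.comp measurable_fst).mul (measurable_secondDiff s hf)
    refine integral_integral_swap (f := fun x z => g x *
      ((f x - (f (x + z) + f (x - z)) / 2) * ((‖z‖ ^ (-(3 + s)) : ℝ) : ℂ))) ⟨hmm.aestronglyMeasurable, ?_⟩
    refine lt_of_le_of_lt ?_ h.lt_top
    refine (lintegral_prod _ (hmm.enorm.aemeasurable)).trans_le ?_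
    refine lintegral_mono fun x => ?_
    simp only
    simp_rw [enorm_mul (g x)]
    rw [lintegral_const_mul' _ _ enorm_ne_top]
    exact mul_le_mul' le_rfl (lintegral_enorm_secondDiff_le s hf x)
  rw [key hf hg hfg, key hg hf hgf]
  refine integral_congr_ae (ae_of_all _ fun z => ?_)
  simp only
  have tr : ∀ {f : R3 → ℂ}, MemLp f 2 volume → ∀ z : R3, MemLp (fun x => f (x + z)) 2 volume :=
    fun hf z => hf.comp_measurePreserving (measurePreserving_add_right volume z)
  have tr' : ∀ {f : R3 → ℂ}, MemLp f 2 volume → ∀ z : R3, MemLp (fun x => f (x - z)) 2 volume :=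
    fun hf z => hf.comp_measurePreserving (measurePreserving_sub_right volume z)
  -- For fixed z only ∫ f g and the correlations of f and g at z and -z occur; exchanging f and g
  -- swaps the two correlations.
  have expand : ∀ {f g : R3 → ℂ}, MemLp f 2 volume → MemLp g 2 volume →
      ∫ x, g x * ((f x - (f (x + z) + f (x - z)) / 2) * ((‖z‖ ^ (-(3 + s)) : ℝ) : ℂ)) =
      ((∫ x, f x * g x) - ((∫ x, f (x + z) * g x) + ∫ x, f (x - z) * g x) / 2) *
        ((‖z‖ ^ (-(3 + s)) : ℝ) : ℂ) := by
    intro f g hf hg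
    have i1 : Integrable fun x => f x * g x := hf.integrable_mul hg
    have i2 : Integrable fun x => f (x + z) * g x := (tr hf z).integrable_mul hg
    have i3 : Integrable fun x => f (x - z) * g x := (tr' hf z).integrable_mul hg
    have i4 : Integrable fun x => (f (x + z) * g x + f (x - z) * g x) / 2 := (i2.add i3).div_const 2
    rw [← integral_add i2 i3, ← integral_div, ← integral_sub i1 i4, ← integral_mul_const]
    congr 1; ext x; ring
  rw [expand hf2 hg2, expand hg2 hf2, integral_translate_mul (f := f), integral_translate_mul (f := g)]
  simp_rw [mul_comm (f _) (g _)]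
  ring

theorem lintegral_enorm_mul_absFrac_ne_top {s : ℝ} {f : R3 → ℝ} (hf : Measurable f)
    (h : ∫⁻ x, absFrac s f x ^ (2 : ℝ) ≠ ⊤) {g : R3 → ℂ} (hg : MemLp g 2 volume) :
    ∫⁻ x, ‖g x‖ₑ * absFrac s f x ≠ ⊤ := by
  have h1 := ENNReal.lintegral_mul_le_Lp_mul_Lq volume Real.HolderConjugate.two_two
    hg.1.enorm (measurable_absFrac s hf).aemeasurable
  refine (h1.trans_lt (ENNReal.mul_lt_top ?_ ?_)).ne
  · have := hg.2
    rw [eLpNorm_eq_lintegral_rpow_enorm_toReal (by norm_num) (by norm_num)] at this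
    simpa using this
  · exact ENNReal.rpow_lt_top_of_nonneg (by norm_num) h

/-- The choice a = m = 2, ϑ = s satisfies the exponent relation trivially. The functional L is the
real or the imaginary part in the application. -/
theorem exists_lintegral_absFrac_schwartz {s : ℝ} (hs0 : 0 < s) (hs1 : s < 1) (φ : 𝓢(R3, ℂ))
    (L : ℂ →L[ℝ] ℝ) : ∫⁻ x, absFrac s (fun x => L (φ x)) x ^ (2 : ℝ) ≠ ⊤ := by
  obtain ⟨C, hC⟩ := exists_lintegral_absFrac_le_of_contDiff (s := s) (ϑ := s) (a := 2) (m := 2) hs0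
    le_rfl hs1 (by norm_num) (by norm_num) (by ring)
  have h2 : ENNReal.ofReal 2 = 2 := by norm_num
  have m1 : MemLp (fun x => L (φ x)) (ENNReal.ofReal 2) volume := L.comp_memLp' (φ.memLp _ _)
  have hd : ∀ x, fderiv ℝ (fun x => L (φ x)) x = L.comp (SchwartzMap.fderivCLM ℝ R3 ℂ φ x) := by
    intro x
    rw [SchwartzMap.fderivCLM_apply]
    exact (L.hasFDerivAt.comp x (φ.differentiable x).hasFDerivAt).fderiv
  have m2 : MemLp (fderiv ℝ fun x => L (φ x)) (ENNReal.ofReal 2) volume := by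
    have : (fderiv ℝ fun x => L (φ x)) = fun x => (ContinuousLinearMap.compL ℝ R3 ℂ ℝ L)
        (SchwartzMap.fderivCLM ℝ R3 ℂ φ x) := by
      ext1 x; rw [hd]; rfl
    rw [this]
    exact ContinuousLinearMap.comp_memLp' _ (SchwartzMap.memLp _ _ _)
  obtain ⟨K, hK⟩ : ∃ K, K = eLpNorm (fun x => L (φ x)) (ENNReal.ofReal 2) volume +
    eLpNorm (fderiv ℝ fun x => L (φ x)) (ENNReal.ofReal 2) volume := ⟨_, rfl⟩
  refine ((hC _ (L.contDiff.comp (φ.smooth 1)) m1 m2 m1 K (hK ▸ le_self_add) (hK ▸ le_self_add)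
    (hK ▸ le_add_self)).trans_lt ?_).ne
  refine ENNReal.rpow_lt_top_of_nonneg (by norm_num) (ENNReal.mul_lt_top (by simp) ?_).ne
  rw [hK]
  exact ENNReal.add_lt_top.2 ⟨m1.2, m2.2⟩

/-- Λ^s of a Schwartz function is a singular integral, and the form of second differences is
symmetric. The L² bounds for the absolute singular integrals of f and of the test function justify
Fubini's theorem on both sides. -/
theorem hasFrac_fracInt {s : ℝ} (hs0 : 0 < s) (hs1 : s < 1) {f : R3 → ℝ} (hf : Measurable f)
    (hf2 : MemLp f 2 volume) (h : ∫⁻ x, absFrac s f x ^ (2 : ℝ) ≠ ⊤) :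
    HasFrac s f (fracInt s f) := by
  intro φ
  have hφ := φ.memLp 2 volume
  have hfc : MemLp (fun x => (f x : ℂ)) 2 volume := hf2.ofReal
  have h1 := lintegral_enorm_mul_absFrac_ne_top hf h hφ
  have h2 : ∫⁻ x, ‖(f x : ℂ)‖ₑ * ∫⁻ z, ‖φ x - φ (x - z)‖ₑ * ENNReal.ofReal (‖z‖ ^ (-(3 + s))) ≠ ⊤ := by
    have a1 := lintegral_enorm_mul_absFrac_ne_top (s := s) (f := fun x => (φ x).re)
      (Complex.measurable_re.comp φ.continuous.measurable)
      (exists_lintegral_absFrac_schwartz hs0 hs1 φ Complex.reCLM) hfc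
    have a2 := lintegral_enorm_mul_absFrac_ne_top (s := s) (f := fun x => (φ x).im)
      (Complex.measurable_im.comp φ.continuous.measurable)
      (exists_lintegral_absFrac_schwartz hs0 hs1 φ Complex.imCLM) hfc
    refine (lt_of_le_of_lt ?_ (ENNReal.add_lt_top.2 ⟨a1.lt_top, a2.lt_top⟩)).ne
    have hfm : Measurable fun x => ‖(f x : ℂ)‖ₑ := (Complex.measurable_ofReal.comp hf).enorm
    have hrm : Measurable fun x => ‖(f x : ℂ)‖ₑ * absFrac s (fun x => (φ x).re) x :=
      hfm.mul (measurable_absFrac s (Complex.measurable_re.comp φ.continuous.measurable))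
    rw [← lintegral_add_left hrm]
    refine lintegral_mono fun x => ?_
    rw [← mul_add]
    gcongr
    rw [absFrac, absFrac, ← lintegral_add_left]
    · refine lintegral_mono fun z => ?_
      rw [← add_mul]
      gcongr
      have : φ x - φ (x - z) = (((φ x).re - (φ (x - z)).re : ℝ) : ℂ) +
          (((φ x).im - (φ (x - z)).im : ℝ) : ℂ) * Complex.I := by
        rw [← Complex.sub_re, ← Complex.sub_im, Complex.re_add_im]
      rw [this]
      refine (enorm_add_le _ _).trans_eq ?_
      rw [enorm_mul]
      simp only [← ofReal_norm, Complex.norm_real, Complex.norm_I, ENNReal.ofReal_one, mul_one]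
    · have hc := φ.continuous
      have : Measurable fun z => ‖(φ x).re - (φ (x - z)).re‖ₑ :=
        (by fun_prop : Continuous fun z => (φ x).re - (φ (x - z)).re).measurable.enorm
      fun_prop
  have hmain := integral_mul_secondDiff_comm s (f := fun x => (f x : ℂ)) (g := φ)
    (Complex.measurable_ofReal.comp hf) φ.continuous.measurable hfc hφ
    (by simp only [enorm_sub_eq_ofReal]; exact h1) h2
  simp_rw [frac_eq_integral hs0 hs1, ofReal_fracInt]
  obtain ⟨c, hc⟩ : ∃ c : ℂ, c = (((2 * Real.pi) ^ s / fracConst s : ℝ) : ℂ) := ⟨_, rfl⟩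
  rw [← hc]
  have e1 : ∀ a b : ℂ, a * (c * b) = c * (a * b) := by intros; ring
  have e2 : ∀ a b : ℂ, (c * b) * a = c * (a * b) := by intros; ring
  simp_rw [e1, e2]
  rw [integral_const_mul, integral_const_mul, hmain]

/-! ### Cutoff functions and the Sobolev inequality -/

/-- Smooth cutoff functions that increase to `1`. -/
noncomputable def cut (n : ℕ) (x : R3) : ℝ :=
  (⟨1, 2, one_pos, one_lt_two⟩ : ContDiffBump (0 : R3)) (((n : ℝ) + 1)⁻¹ • x)

theorem contDiff_cut (n : ℕ) : ContDiff ℝ ∞ (cut n) :=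
  (ContDiffBump.contDiff _).comp (contDiff_const_smul _)

theorem cut_nonneg (n : ℕ) (x : R3) : 0 ≤ cut n x := ContDiffBump.nonneg _

theorem cut_le_one (n : ℕ) (x : R3) : cut n x ≤ 1 := ContDiffBump.le_one _

theorem hasCompactSupport_cut (n : ℕ) : HasCompactSupport (cut n) := by
  have : ((n : ℝ) + 1)⁻¹ ≠ 0 := by positivity
  exact (ContDiffBump.hasCompactSupport _).comp_smul this

theorem tendsto_cut (x : R3) : Tendsto (fun n => cut n x) atTop (𝓝 1) := by
  refine tendsto_const_nhds.congr' ?_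
  filter_upwards [eventually_ge_atTop ⌈‖x‖⌉₊] with n hn
  symm
  refine ContDiffBump.one_of_mem_closedBall _ ?_
  rw [mem_closedBall_zero_iff, norm_smul, norm_inv, Real.norm_of_nonneg (by positivity),
    inv_mul_le_iff₀ (by positivity)]
  have := Nat.ceil_le.1 hn
  simp only
  linarith

theorem exists_norm_fderiv_cut_le : ∃ C : ℝ≥0, ∀ n x, ‖fderiv ℝ (cut n) x‖ ≤ C * ((n : ℝ) + 1)⁻¹ := by
  set χ : ContDiffBump (0 : R3) := ⟨1, 2, one_pos, one_lt_two⟩ with hχ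
  have hd : Continuous (fderiv ℝ χ) := (χ.contDiff (n := 1)).continuous_fderiv (by norm_num)
  obtain ⟨C, hC⟩ := hd.bounded_above_of_compact_support (χ.hasCompactSupport.fderiv ℝ)
  refine ⟨C.toNNReal, fun n x => ?_⟩
  have h0 : HasFDerivAt (fun x : R3 => ((n : ℝ) + 1)⁻¹ • x)
      (((n : ℝ) + 1)⁻¹ • ContinuousLinearMap.id ℝ R3) x := (hasFDerivAt_id x).fun_const_smul _
  have h1 : HasFDerivAt (cut n) ((fderiv ℝ χ (((n : ℝ) + 1)⁻¹ • x)).comp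
      (((n : ℝ) + 1)⁻¹ • ContinuousLinearMap.id ℝ R3)) x :=
    HasFDerivAt.comp x ((χ.contDiff (n := 1)).differentiable (by norm_num) _).hasFDerivAt h0
  rw [h1.fderiv, ContinuousLinearMap.comp_smul, ContinuousLinearMap.comp_id, norm_smul, norm_inv,
    Real.norm_of_nonneg (by positivity), mul_comm]
  gcongr
  exact (hC _).trans (Real.le_coe_toNNReal C)

/-- The Gagliardo-Nirenberg-Sobolev inequality is applied to the cut-off mollifications of f, and
the L⁶ norm is lower semicontinuous under almost everywhere convergence. The gradient of the cutoff
accounts for the L² norm of f. -/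
theorem exists_eLpNorm_six_le :
    ∃ C : ℝ≥0, ∀ (f : R3 → ℝ) (g : Fin 3 → R3 → ℝ), MemLp f (ENNReal.ofReal 2) volume →
      (∀ i, MemLp (g i) (ENNReal.ofReal 2) volume) → (∀ i, HasWeakDeriv i f (g i)) →
      eLpNorm f 6 volume ≤ C * (eLpNorm f (ENNReal.ofReal 2) volume +
        ∑ i, eLpNorm (g i) (ENNReal.ofReal 2) volume) := by
  obtain ⟨K, hK⟩ := exists_norm_fderiv_cut_le
  refine ⟨SNormLESNormFDerivOfEqConst ℝ (volume : Measure R3) ((2 : ℝ≥0) : ℝ) * (K + 1), fun f g hf hg hfg => ?_⟩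
  have hle : Fact ((1 : ℝ≥0∞) ≤ ENNReal.ofReal 2) := ⟨by norm_num⟩
  have hloc : LocallyIntegrable f volume := hf.locallyIntegrable hle.out
  have hlim : ∀ᵐ x, Tendsto (fun n => cut n x * mol (ker n) f x) atTop (𝓝 (f x)) := by
    filter_upwards [ae_tendsto_mol hloc] with x hx
    simpa using (tendsto_cut x).mul hx
  have hsm : ∀ n, ContDiff ℝ ∞ (mol (ker n) f) := fun n => (isMollifier_ker n).contDiff_mol hloc
  refine (Lp.eLpNorm_lim_le_liminf_eLpNorm
    (fun n => ((contDiff_cut n).mul (hsm n)).continuous.aestronglyMeasurable) f hlim).trans ?_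
  refine (liminf_le_liminf (Eventually.of_forall fun n => ?_)).trans_eq (liminf_const _)
  have h1 := eLpNorm_le_eLpNorm_fderiv_of_eq (F := ℝ) (p := 2) (p' := 6) (volume : Measure R3)
    (u := fun x => cut n x * mol (ker n) f x)
    (((contDiff_cut n).mul (hsm n)).of_le (by norm_cast))
    ((hasCompactSupport_cut n).mul_right) (by norm_num) (by simp)
    (by simp only [finrank_euclideanSpace, Fintype.card_fin]; norm_num)
  have e6 : ((6 : ℝ≥0) : ℝ≥0∞) = 6 := by norm_num
  have e2 : ((2 : ℝ≥0) : ℝ≥0∞) = ENNReal.ofReal 2 := by norm_num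
  rw [e6, e2] at h1
  refine h1.trans ?_
  rw [ENNReal.coe_mul, mul_assoc]
  gcongr
  have hfd : ∀ x, fderiv ℝ (fun x => cut n x * mol (ker n) f x) x =
      cut n x • fderiv ℝ (mol (ker n) f) x + mol (ker n) f x • fderiv ℝ (cut n) x := fun x =>
    fderiv_mul ((contDiff_cut n).differentiable (by norm_num) x)
      ((hsm n).differentiable (by norm_num) x)
  have b1 : eLpNorm (fun x => cut n x • fderiv ℝ (mol (ker n) f) x) (ENNReal.ofReal 2) volume ≤
      ∑ i, eLpNorm (g i) (ENNReal.ofReal 2) volume := by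
    refine (eLpNorm_mono fun x => ?_).trans (eLpNorm_fderiv_mol_le (isMollifier_ker n) (by norm_num)
      hloc (fun i => (hg i).1) hfg)
    rw [norm_smul, Real.norm_of_nonneg (cut_nonneg n x)]
    exact mul_le_of_le_one_left (norm_nonneg _) (cut_le_one n x)
  have b2 : eLpNorm (fun x => mol (ker n) f x • fderiv ℝ (cut n) x) (ENNReal.ofReal 2) volume ≤
      K * eLpNorm f (ENNReal.ofReal 2) volume := by
    refine (eLpNorm_le_nnreal_smul_eLpNorm_of_ae_le_mul (c := K) (g := mol (ker n) f)
      (ae_of_all _ fun x => ?_) _).trans ?_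
    · rw [← NNReal.coe_le_coe]
      push_cast
      rw [norm_smul, mul_comm]
      gcongr
      refine (hK n x).trans (mul_le_of_le_one_right K.coe_nonneg (inv_le_one_of_one_le₀ ?_))
      have : (0 : ℝ) ≤ n := n.cast_nonneg
      linarith
    · rw [ENNReal.smul_def, smul_eq_mul]
      gcongr
      exact (isMollifier_ker n).eLpNorm_mol_le (by norm_num) hf.1
  have hc1 : Continuous (fderiv ℝ (mol (ker n) f)) := (hsm n).continuous_fderiv (by norm_num)
  have hc2 : Continuous (fderiv ℝ (cut n)) := (contDiff_cut n).continuous_fderiv (by norm_num)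
  have : fderiv ℝ (fun x => cut n x * mol (ker n) f x) =
      (fun x => cut n x • fderiv ℝ (mol (ker n) f) x) + fun x => mol (ker n) f x • fderiv ℝ (cut n) x := by
    ext1 x; exact hfd x
  rw [this]
  refine (eLpNorm_add_le ((contDiff_cut n).continuous.smul hc1).aestronglyMeasurable
    ((hsm n).continuous.smul hc2).aestronglyMeasurable hle.out).trans ((add_le_add b1 b2).trans ?_)
  rw [mul_add, add_comm]
  push_cast
  refine add_le_add (mul_le_mul' le_self_add le_rfl) (le_mul_of_one_le_left zero_le (le_add_self))

/-- Pointwise, |f| ^ q ≤ |f| ^ p + |f| ^ r. -/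
theorem memLp_of_memLp_of_memLp {f : R3 → ℝ} {p q r : ℝ} (hp : 0 < p) (hpq : p ≤ q) (hqr : q ≤ r)
    (h1 : MemLp f (ENNReal.ofReal p) volume) (h2 : MemLp f (ENNReal.ofReal r) volume) :
    MemLp f (ENNReal.ofReal q) volume := by
  have hq : 0 < q := hp.trans_le hpq
  have hr : 0 < r := hq.trans_le hqr
  have key : ∀ {p : ℝ}, 0 < p → (eLpNorm f (ENNReal.ofReal p) volume < ⊤ ↔ ∫⁻ x, ‖f x‖ₑ ^ p < ⊤) := by
    intro p hp
    rw [lintegral_enorm_rpow_eq hp]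
    simp [ENNReal.rpow_lt_top_iff_of_pos hp]
  refine ⟨h1.1, (key hq).2 ?_⟩
  refine lt_of_le_of_lt (lintegral_mono fun x => ?_) (?_ : ∫⁻ x, (‖f x‖ₑ ^ p + ‖f x‖ₑ ^ r) < ⊤)
  · rcases le_total ‖f x‖ₑ 1 with h | h
    · exact (ENNReal.rpow_le_rpow_of_exponent_ge h hpq).trans le_self_add
    · exact (ENNReal.rpow_le_rpow_of_exponent_le h hqr).trans le_add_self
  · rw [lintegral_add_left' (h1.1.enorm.pow_const _)]
    exact ENNReal.add_lt_top.2 ⟨(key hp).1 h1.2, (key hr).1 h2.2⟩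

/-! ### An embedding into the homogeneous Sobolev space -/

theorem homSobolevNorm_congr_ae {s m : ℝ} {f f' : R3 → ℝ} (h : f =ᵐ[volume] f') :
    homSobolevNorm s m f = homSobolevNorm s m f' := by
  have : ∀ g, HasFrac s f g ↔ HasFrac s f' g := by
    intro g
    refine forall_congr' fun φ => ?_
    rw [integral_congr_ae (h.mono fun x hx => by simp only [hx] :
      (fun x => (f x : ℂ) * frac s φ x) =ᵐ[volume] fun x => (f' x : ℂ) * frac s φ x)]
  simp only [homSobolevNorm, this, memLp_congr_ae h]

theorem frac_zero (φ : 𝓢(R3, ℂ)) : frac 0 φ = φ := by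
  have : (fun ξ => (symb 0 ξ : ℂ) * 𝓕 (φ : R3 → ℂ) ξ) = 𝓕 (φ : R3 → ℂ) := by
    ext ξ; simp [symb]
  rw [frac, this, ← SchwartzMap.fourier_coe, ← SchwartzMap.fourierInv_coe,
    FourierTransform.fourierInv_fourier_eq]

/-- For s > 0 the witness for Λ^s f is `fracInt s f`. The singular integral estimate with exponents
a, m bounds it in L^m; the same estimate with a = m = 2 shows that it is the distributional Λ^s f.
Sobolev's inequality puts f in L² ∩ L⁶, hence in L^{m*}. For s = 0 the hypothesis forces ϑ = 0 and m
= a, and f is its own witness. -/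
theorem exists_homSobolevNorm_le {s ϑ a m : ℝ} (hs0 : 0 ≤ s) (hsϑ : s ≤ ϑ) (hϑs : s = 0 → ϑ = 0)
    (hϑ : ϑ < 1) (ha : 1 < a) (hm : 0 < m) (hma : 1 / m = ϑ / 2 + (1 - ϑ) / a)
    (h2 : 2 ≤ 3 * m / (3 - s * m)) (h6 : 3 * m / (3 - s * m) ≤ 6) :
    ∃ C : ℝ≥0, ∀ (f : R3 → ℝ) (g : Fin 3 → R3 → ℝ), MemLp f (ENNReal.ofReal 2) volume →
      (∀ i, MemLp (g i) (ENNReal.ofReal 2) volume) → (∀ i, HasWeakDeriv i f (g i)) →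
      MemLp f (ENNReal.ofReal a) volume →
      homSobolevNorm s m f ≤ C * (eLpNorm f (ENNReal.ofReal a) volume +
        (eLpNorm f (ENNReal.ofReal 2) volume + ∑ i, eLpNorm (g i) (ENNReal.ofReal 2) volume)) := by
  rcases hs0.eq_or_lt with hs | hs
  · obtain rfl := hs.symm
    rw [hϑs rfl] at hma
    have hma : m = a := by
      rw [zero_div, zero_add, sub_zero, div_eq_div_iff hm.ne' (by positivity)] at hma
      linarith
    subst hma
    refine ⟨1, fun f g hf hg hfg hfa => ?_⟩
    have h0 : MemLp f (ENNReal.ofReal (3 * m / (3 - 0 * m))) volume := by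
      rwa [zero_mul, sub_zero, mul_div_cancel_left₀ _ (by norm_num)]
    have h1 : HasFrac 0 f f := fun φ => by rw [frac_zero]
    refine (iInf₂_le f ⟨h0, hfa, h1⟩).trans ?_
    rw [ENNReal.coe_one, one_mul]
    exact le_self_add
  · have hs1 : s < 1 := hsϑ.trans_lt hϑ
    obtain ⟨C, hC⟩ := exists_lintegral_absFrac_le hs hsϑ hϑ ha hm hma
    obtain ⟨C', hC'⟩ := exists_lintegral_absFrac_le (s := s) (ϑ := s) (a := 2) (m := 2) hs
      le_rfl hs1 (by norm_num) (by norm_num) (by ring)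
    obtain ⟨C6, hC6⟩ := exists_eLpNorm_six_le
    obtain ⟨c, hc⟩ : ∃ c : ℝ≥0, c = ‖(2 * Real.pi) ^ s / fracConst s‖₊ := ⟨_, rfl⟩
    refine ⟨c * C, fun f g hf hg hfg hfa => ?_⟩
    -- The singular integrals evaluate f pointwise and need joint measurability in x and z, while
    -- the claim depends only on the class of f.
    wlog hfm : Measurable f generalizing f
    · obtain ⟨f', hf'm, hae⟩ := hf.1
      rw [homSobolevNorm_congr_ae hae, eLpNorm_congr_ae hae, eLpNorm_congr_ae hae]
      refine this _ (hf.ae_eq hae) (fun i => ?_) (hfa.ae_eq hae) hf'm.measurable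
      intro φ h1 h2
      rw [← hfg i φ h1 h2]
      refine integral_congr_ae ?_
      filter_upwards [hae] with x hx
      rw [hx]
    obtain ⟨D, hD⟩ : ∃ D, D = eLpNorm f (ENNReal.ofReal a) volume +
      (eLpNorm f (ENNReal.ofReal 2) volume + ∑ i, eLpNorm (g i) (ENNReal.ofReal 2) volume) := ⟨_, rfl⟩
    have hDtop : D ≠ ⊤ := by
      rw [hD]
      exact ENNReal.add_ne_top.2 ⟨hfa.2.ne, ENNReal.add_ne_top.2 ⟨hf.2.ne,
        (ENNReal.sum_lt_top.2 fun i _ => (hg i).2).ne⟩⟩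
    have hDle : eLpNorm f (ENNReal.ofReal 2) volume + ∑ i, eLpNorm (g i) (ENNReal.ofReal 2) volume ≤ D :=
      hD ▸ le_add_self
    have hAm := hC f g hf hg hfg hfa
    rw [add_assoc, ← hD] at hAm
    have hA2 : ∫⁻ x, absFrac s f x ^ (2 : ℝ) ≠ ⊤ := by
      refine ((hC' f g hf hg hfg hf).trans_lt (ENNReal.rpow_lt_top_of_nonneg (by norm_num) ?_)).ne
      rw [add_assoc]
      exact ENNReal.mul_ne_top (by simp) (ENNReal.add_ne_top.2 ⟨hf.2.ne, ne_top_of_le_ne_top hDtop hDle⟩)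
    have hfrac := hasFrac_fracInt hs hs1 hfm (by simpa using hf) hA2
    have hgm : Measurable (fracInt s f) := by
      refine Measurable.const_mul ?_ _
      refine StronglyMeasurable.measurable (StronglyMeasurable.integral_prod_right
        (f := fun x z => (f x - (f (x + z) + f (x - z)) / 2) * ‖z‖ ^ (-(3 + s))) ?_)
      refine Measurable.stronglyMeasurable ?_
      have h1 : Measurable fun w : R3 × R3 => f (w.1 + w.2) :=
        hfm.comp (measurable_fst.add measurable_snd)
      have h2 : Measurable fun w : R3 × R3 => f (w.1 - w.2) :=
        hfm.comp (measurable_fst.sub measurable_snd)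
      have h3 : Measurable fun w : R3 × R3 => ‖w.2‖ ^ (-(3 + s)) := by fun_prop
      exact ((hfm.comp measurable_fst).sub ((h1.add h2).div_const 2)).mul h3
    have hgle : eLpNorm (fracInt s f) (ENNReal.ofReal m) volume ≤ c * C * D := by
      refine (ENNReal.rpow_le_rpow_iff hm).1 ?_
      rw [← lintegral_enorm_rpow_eq hm, mul_assoc, ENNReal.mul_rpow_of_nonneg _ _ hm.le]
      calc _ ≤ ∫⁻ x, (c : ℝ≥0∞) ^ m * absFrac s f x ^ m := by
            refine lintegral_mono fun x => ?_
            rw [← ENNReal.mul_rpow_of_nonneg _ _ hm.le]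
            refine ENNReal.rpow_le_rpow ?_ hm.le
            rw [hc]
            exact enorm_fracInt_le s hfm x
        _ ≤ _ := by
            rw [lintegral_const_mul _ ((measurable_absFrac s hfm).pow_const _)]
            exact mul_le_mul' le_rfl hAm
    have hgtop : (c * C * D : ℝ≥0∞) < ⊤ := ENNReal.mul_lt_top (by
      exact_mod_cast ENNReal.coe_lt_top (r := c * C)) hDtop.lt_top
    rw [ENNReal.coe_mul, ← hD]
    refine (iInf₂_le (fracInt s f) ⟨?_, ⟨hgm.aestronglyMeasurable, hgle.trans_lt hgtop⟩, hfrac⟩).trans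
      hgle
    refine memLp_of_memLp_of_memLp two_pos h2 h6 hf ⟨hf.1, ?_⟩
    have e6 : ENNReal.ofReal 6 = 6 := by norm_num
    rw [e6]
    refine (hC6 f g hf hg hfg).trans_lt (ENNReal.mul_lt_top (by simp) ?_)
    exact (ne_top_of_le_ne_top hDtop hDle).lt_top


/-! ### Pointwise bounds for mollified functions -/

theorem enorm_integral_smul_le {E : Type*} [NormedAddCommGroup E] [NormedSpace ℝ E] {k : R3 → ℝ}
    {f : R3 → E} (hk : AEStronglyMeasurable k volume) (hf : AEStronglyMeasurable f volume) :
    ‖∫ y, k y • f y‖ₑ ≤ eLpNorm k 2 volume * eLpNorm f 2 volume := by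
  refine (enorm_integral_le_lintegral_enorm _).trans ?_
  simp_rw [enorm_smul]
  refine (ENNReal.lintegral_mul_le_Lp_mul_Lq volume Real.HolderConjugate.two_two hk.enorm
    hf.enorm).trans_eq ?_
  rw [eLpNorm_eq_lintegral_rpow_enorm_toReal (by norm_num) (by norm_num),
    eLpNorm_eq_lintegral_rpow_enorm_toReal (by norm_num) (by norm_num)]
  simp

theorem eLpNorm_const_sub {E : Type*} [NormedAddCommGroup E] {k : R3 → E}
    (hk : AEStronglyMeasurable k volume) (p : ℝ≥0∞) (x : R3) :
    eLpNorm (fun y => k (x - y)) p volume = eLpNorm k p volume :=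
  eLpNorm_comp_measurePreserving hk (Measure.measurePreserving_sub_left volume x)

/-- The Cauchy-Schwarz inequality against η and against its derivative. -/
theorem IsMollifier.exists_enorm_mol_le {η : R3 → ℝ} (hη : IsMollifier η) (E : Type*)
    [NormedAddCommGroup E] [NormedSpace ℝ E] [CompleteSpace E] :
    ∃ C : ℝ≥0, ∀ f : R3 → E, MemLp f 2 volume → ∀ x,
      ‖mol η f x‖ₑ ≤ C * eLpNorm f 2 volume ∧ ‖fderiv ℝ (mol η f) x‖ₑ ≤ C * eLpNorm f 2 volume := by
  have hd := hη.smooth.continuous_fderiv (by norm_num)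
  have h1 : MemLp η 2 volume := hη.continuous.memLp_of_hasCompactSupport hη.compact
  have h2 : MemLp (fderiv ℝ η) 2 volume := hd.memLp_of_hasCompactSupport (hη.compact.fderiv ℝ)
  obtain ⟨A, hA⟩ : ∃ A : ℝ≥0, (A : ℝ≥0∞) = eLpNorm η 2 volume := ⟨_, ENNReal.coe_toNNReal h1.2.ne⟩
  obtain ⟨B, hB⟩ : ∃ B : ℝ≥0, (B : ℝ≥0∞) = eLpNorm (fderiv ℝ η) 2 volume :=
    ⟨_, ENNReal.coe_toNNReal h2.2.ne⟩
  refine ⟨A + B, fun f hf x => ⟨?_, ?_⟩⟩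
  · rw [mol_apply']
    have hc : Continuous fun y => η (x - y) := hη.continuous.comp (by fun_prop)
    refine (enorm_integral_smul_le hc.aestronglyMeasurable hf.1).trans ?_
    rw [eLpNorm_const_sub h1.1, ← hA]
    gcongr
    exact_mod_cast le_self_add
  · have hfin : (B * eLpNorm f 2 volume : ℝ≥0∞) ≠ ⊤ := ENNReal.mul_ne_top (by simp) hf.2.ne
    have key : ‖fderiv ℝ (mol η f) x‖ ≤ (B * eLpNorm f 2 volume : ℝ≥0∞).toReal := by
      refine ContinuousLinearMap.opNorm_le_bound _ ENNReal.toReal_nonneg fun v => ?_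
      rw [hη.fderiv_mol (hf.locallyIntegrable (by norm_num))]
      have hc : Continuous fun y => fderiv ℝ η (x - y) v :=
        (hd.comp (by fun_prop : Continuous fun y => x - y)).clm_apply continuous_const
      have h3 := enorm_integral_smul_le hc.aestronglyMeasurable hf.1
      have h4 : eLpNorm (fun y => fderiv ℝ η (x - y) v) 2 volume ≤ ‖v‖ₑ * B := by
        rw [hB, ← eLpNorm_const_sub h2.1 2 x]
        refine (eLpNorm_le_nnreal_smul_eLpNorm_of_ae_le_mul (c := ‖v‖₊)
          (g := fun y => fderiv ℝ η (x - y)) (ae_of_all _ fun y => ?_) 2)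
        rw [mul_comm]
        exact (fderiv ℝ η (x - y)).le_opNNNorm v
      have h5 := h3.trans (mul_le_mul' h4 le_rfl)
      rw [← toReal_enorm]
      have := ENNReal.toReal_mono (by finiteness) h5
      refine this.trans_eq ?_
      simp only [ENNReal.toReal_mul, toReal_enorm]
      ring
    rw [← ofReal_norm]
    refine (ENNReal.ofReal_le_of_le_toReal key).trans ?_
    gcongr
    exact_mod_cast le_add_self

/-! ### Cancellation in the trilinear form -/

/-- Twice the integrand is u·∇|w|². The divergence condition is tested with |w|² times a cutoff,
whose gradient tends to 0. Since w and its derivative are bounded, a multiple of |w||u| dominates.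
-/
theorem integral_inner_fderiv_self_eq_zero {u : L2V} (hu : IsDivFree u) {w : R3 → R3}
    (hw : ContDiff ℝ ∞ w) (hw2 : MemLp w 2 volume) {M : ℝ} (hM : ∀ x, ‖w x‖ ≤ M)
    (hM' : ∀ x, ‖fderiv ℝ w x‖ ≤ M) : ∫ x, inner ℝ (fderiv ℝ w x (u x)) (w x) = 0 := by
  obtain ⟨K, hK⟩ := exists_norm_fderiv_cut_le
  have hM0 : 0 ≤ M := (norm_nonneg _).trans (hM 0)
  have hd : ∀ n x v, fderiv ℝ (fun x => cut n x * ‖w x‖ ^ 2) x v =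
      cut n x * (2 * inner ℝ (w x) (fderiv ℝ w x v)) + ‖w x‖ ^ 2 * fderiv ℝ (cut n) x v := by
    intro n x v
    have h1 := ((contDiff_cut n).differentiable (by norm_num) x).hasFDerivAt
    have h2 := ((hw.differentiable (by norm_num) x).hasFDerivAt).norm_sq
    rw [(h1.fun_mul h2).fderiv]
    simp
  have hz : ∀ n, ∫ x, (cut n x * (2 * inner ℝ (w x) (fderiv ℝ w x (u x))) +
      ‖w x‖ ^ 2 * fderiv ℝ (cut n) x (u x)) = 0 := by
    intro n
    rw [← hu (fun x => cut n x * ‖w x‖ ^ 2) ((contDiff_cut n).mul (hw.norm_sq ℝ))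
      (hasCompactSupport_cut n).mul_right]
    simp_rw [hd]
  have hlu : MemLp u 2 volume := Lp.memLp u
  have hcw : Continuous (fderiv ℝ w) := hw.continuous_fderiv (by norm_num)
  have hmeas : AEStronglyMeasurable (fun x => fderiv ℝ w x (u x)) volume :=
    ContinuousLinearMap.aestronglyMeasurable_comp₂ (ContinuousLinearMap.id ℝ (R3 →L[ℝ] R3)) 
      hcw.aestronglyMeasurable hlu.1
  have hprod : Integrable (fun x => ‖w x‖ * ‖u x‖) := hw2.norm.integrable_mul hlu.norm
  have hlim := tendsto_integral_of_dominated_convergence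
    (F := fun n x => cut n x * (2 * inner ℝ (w x) (fderiv ℝ w x (u x))) +
      ‖w x‖ ^ 2 * fderiv ℝ (cut n) x (u x))
    (f := fun x => 2 * inner ℝ (w x) (fderiv ℝ w x (u x)))
    (μ := volume) (fun x => (2 * M + M * K) * (‖w x‖ * ‖u x‖)) ?_ (hprod.const_mul _) ?_ ?_
  · simp_rw [hz] at hlim
    have := tendsto_nhds_unique hlim tendsto_const_nhds
    rw [integral_const_mul] at this
    simp_rw [real_inner_comm (w _)]
    linarith
  · intro n
    have hc := (contDiff_cut n).continuous
    have hc' : Continuous (fderiv ℝ (cut n)) := (contDiff_cut n).continuous_fderiv (by norm_num)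
    have h1 : AEStronglyMeasurable (fun x => fderiv ℝ (cut n) x (u x)) volume :=
      ContinuousLinearMap.aestronglyMeasurable_comp₂ (ContinuousLinearMap.id ℝ (R3 →L[ℝ] ℝ)) 
        hc'.aestronglyMeasurable hlu.1
    have h2 := (hw2.1.inner (𝕜 := ℝ) hmeas).const_mul 2
    exact (hc.aestronglyMeasurable.mul h2).add ((hw2.1.norm.pow 2).mul h1)
  · intro n
    refine ae_of_all _ fun x => ?_
    refine (norm_add_le _ _).trans ?_
    rw [add_mul]
    refine add_le_add ?_ ?_
    · rw [norm_mul, Real.norm_of_nonneg (cut_nonneg n x), norm_mul, Real.norm_two]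
      refine (mul_le_of_le_one_left (by positivity) (cut_le_one n x)).trans ?_
      have h1 := norm_inner_le_norm (𝕜 := ℝ) (w x) (fderiv ℝ w x (u x))
      have h2 : ‖fderiv ℝ w x (u x)‖ ≤ M * ‖u x‖ :=
        (ContinuousLinearMap.le_opNorm _ _).trans (by gcongr; exact hM' x)
      nlinarith [mul_le_mul_of_nonneg_left h2 (norm_nonneg (w x))]
    · rw [norm_mul, norm_pow, norm_norm]
      have h1 : ‖fderiv ℝ (cut n) x (u x)‖ ≤ K * ‖u x‖ := by
        refine (ContinuousLinearMap.le_opNorm _ _).trans ?_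
        gcongr
        refine (hK n x).trans (mul_le_of_le_one_right K.coe_nonneg (inv_le_one_of_one_le₀ ?_))
        have : (0 : ℝ) ≤ n := n.cast_nonneg
        linarith
      calc _ ≤ (M * ‖w x‖) * (K * ‖u x‖) := by
            rw [pow_two]
            gcongr
            exact hM x
        _ = _ := by ring
  · refine ae_of_all _ fun x => ?_
    have h1 : Tendsto (fun n => fderiv ℝ (cut n) x (u x)) atTop (𝓝 0) := by
      refine squeeze_zero_norm (a := fun n : ℕ => (K * ‖u x‖) * (1 / ((n : ℝ) + 1))) (fun n => ?_) ?_
      · refine (ContinuousLinearMap.le_opNorm _ _).trans ?_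
        refine (mul_le_mul_of_nonneg_right (hK n x) (norm_nonneg _)).trans_eq ?_
        rw [one_div]; ring
      · simpa using (tendsto_one_div_add_atTop_nhds_zero_nat (𝕜 := ℝ)).const_mul (K * ‖u x‖)
    simpa using ((tendsto_cut x).mul_const (2 * inner ℝ (w x) (fderiv ℝ w x (u x)))).add
      (h1.const_mul (‖w x‖ ^ 2))

/-! ### Multipliers -/

/-- The supremum omits functions that vanish almost everywhere, for which the left side is 0.
Finiteness of the multiplier norm permits clearing the denominator even if X f = 0. -/
theorem le_multNorm_mul (X : (R3 → ℝ) → ℝ≥0∞) (p : ℝ≥0∞) (φ : R3 → ℝ)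
    (hφ : multNorm X (fun h => eLpNorm h p volume) φ ≠ ⊤) {f : R3 → ℝ} (hf : X f < ⊤) :
    eLpNorm (fun x => φ x * f x) p volume ≤
      multNorm X (fun h => eLpNorm h p volume) φ * X f := by
  by_cases h0 : f =ᵐ[volume] 0
  · have : (fun x => φ x * f x) =ᵐ[volume] 0 := by
      filter_upwards [h0] with x hx
      simp [hx]
    rw [eLpNorm_congr_ae this, eLpNorm_zero]
    exact zero_le
  · rw [← ENNReal.div_le_iff_le_mul (Or.inr hφ) (Or.inl hf.ne)]
    exact le_iSup_of_le f (le_iSup₂_of_le hf h0 le_rfl)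

theorem multNorm_le_multNormMat (X Y : (R3 → ℝ) → ℝ≥0∞) (G : Fin 3 → Fin 3 → R3 → ℝ) (i j : Fin 3) :
    multNorm X Y (G i j) ≤ multNormMat X Y G := by
  have h1 : multNorm X Y (G i j) ^ 2 ≤ ∑ i, ∑ j, multNorm X Y (G i j) ^ 2 :=
    (Finset.single_le_sum (f := fun j => multNorm X Y (G i j) ^ 2) (fun _ _ => zero_le)
      (Finset.mem_univ j)).trans
      (Finset.single_le_sum (f := fun i => ∑ j, multNorm X Y (G i j) ^ 2) (fun _ _ => zero_le)
        (Finset.mem_univ i))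
  have h2 := ENNReal.rpow_le_rpow h1 (by norm_num : (0 : ℝ) ≤ 1 / 2)
  rwa [← ENNReal.rpow_natCast, ← ENNReal.rpow_mul, show ((2 : ℕ) : ℝ) * (1 / 2) = 1 by norm_num,
    ENNReal.rpow_one] at h2

/-- The product (η ⋆ g) v is an average of the products g(· - t) v. The bound is assumed for all
translates and obtained for all translates, so the lemma can be applied twice in succession. -/
theorem IsMollifier.eLpNorm_mol_mul_le {η : R3 → ℝ} (hη : IsMollifier η) {p : ℝ} (hp : 1 ≤ p)
    {g v : R3 → ℝ} (hg : AEStronglyMeasurable g volume) (hv : AEStronglyMeasurable v volume)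
    {K : ℝ≥0∞} (hK : ∀ z, eLpNorm (fun x => g (x - z) * v x) (ENNReal.ofReal p) volume ≤ K) (z : R3) :
    eLpNorm (fun x => mol η g (x - z) * v x) (ENNReal.ofReal p) volume ≤ K := by
  obtain ⟨g', hg', hgg'⟩ := hg
  obtain ⟨v', hv', hvv'⟩ := hv
  have hq : ∀ z, Measure.QuasiMeasurePreserving (fun x : R3 => x - z) volume volume := fun z =>
    (measurePreserving_sub_right volume z).quasiMeasurePreserving
  have e1 : (fun x => mol η g (x - z) * v x) =ᵐ[volume]
      fun x => ∫ t, η t • (g' (x - z - t) * v' x) := by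
    filter_upwards [hvv'] with x hx
    rw [mol_congr_ae η hgg', mol_apply, hx, ← integral_mul_const]
    simp only [smul_eq_mul, mul_assoc]
  rw [eLpNorm_congr_ae e1]
  refine hη.eLpNorm_integral_le hp ?_ (fun t _ => ?_)
  · have h1 : StronglyMeasurable fun w : R3 × R3 => g' (w.1 - z - w.2) :=
      hg'.comp_measurable (by fun_prop)
    exact h1.mul (hv'.comp_measurable measurable_fst)
  · refine le_trans (le_of_eq (eLpNorm_congr_ae ?_)) (hK (z + t))
    filter_upwards [hvv', (hq (z + t)).ae_eq_comp hgg'] with x hx hx'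
    simp only [Function.comp_apply] at hx'
    rw [hx, hx', sub_sub]

theorem hasWeakDeriv_of_contDiff {f : R3 → ℝ} (hf : ContDiff ℝ 1 f) (i : Fin 3) :
    HasWeakDeriv i f (fun x => fderiv ℝ f x (e i)) := by
  intro φ hφ hc
  have hcf : Continuous fun x => fderiv ℝ f x (e i) :=
    (hf.continuous_fderiv (by norm_num)).clm_apply continuous_const
  have hcφ : Continuous fun x => fderiv ℝ φ x (e i) :=
    (hφ.continuous_fderiv (by norm_num)).clm_apply continuous_const
  have hcc : HasCompactSupport fun x => fderiv ℝ φ x (e i) := hc.fderiv_apply ℝ (e i)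
  exact integral_mul_fderiv_eq_neg_fderiv_mul_of_integrable
    ((hcf.mul hφ.continuous).integrable_of_hasCompactSupport hc.mul_left)
    ((hf.continuous.mul hcφ).integrable_of_hasCompactSupport hcc.mul_left)
    ((hf.continuous.mul hφ.continuous).integrable_of_hasCompactSupport hc.mul_left)
    (fun x _ => hf.differentiable (by norm_num) x) (fun x _ => hφ.differentiable (by norm_num) x)

theorem HasWeakDeriv.sub {i : Fin 3} {f g f' g' : R3 → ℝ} (h : HasWeakDeriv i f g)
    (h' : HasWeakDeriv i f' g') (hf : LocallyIntegrable f volume) (hg : LocallyIntegrable g volume)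
    (hf' : LocallyIntegrable f' volume) (hg' : LocallyIntegrable g' volume) :
    HasWeakDeriv i (fun x => f x - f' x) (fun x => g x - g' x) := by
  intro φ hφ hc
  have hcφ : Continuous fun x => fderiv ℝ φ x (e i) :=
    (hφ.continuous_fderiv (by norm_num)).clm_apply continuous_const
  have hcc : HasCompactSupport fun x => fderiv ℝ φ x (e i) := hc.fderiv_apply ℝ (e i)
  have I : ∀ {f : R3 → ℝ}, LocallyIntegrable f volume → ∀ {k : R3 → ℝ}, Continuous k →
      HasCompactSupport k → Integrable fun x => f x * k x := fun hf k hk hkc => by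
    simpa [mul_comm, smul_eq_mul] using hf.integrable_smul_left_of_hasCompactSupport hk hkc
  simp_rw [sub_mul]
  rw [integral_sub (I hf hcφ hcc) (I hf' hcφ hcc), integral_sub (I hg hφ.continuous hc)
    (I hg' hφ.continuous hc), h φ hφ hc, h' φ hφ hc]
  ring


/-! ### The trilinear estimate -/

theorem integrable_inner_of_memLp {E : Type*} [NormedAddCommGroup E] [InnerProductSpace ℝ E]
    {f g : R3 → E} (hf : MemLp f 2 volume) (hg : MemLp g 2 volume) :
    Integrable fun x => inner ℝ (f x) (g x) :=
  Integrable.mono' (hf.norm.integrable_mul hg.norm) (hf.1.inner hg.1)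
    (ae_of_all _ fun _ => norm_inner_le_norm _ _)

theorem IsMollifier.integrable_smul {E : Type*} [NormedAddCommGroup E] [NormedSpace ℝ E]
    {η : R3 → ℝ} (hη : IsMollifier η) {f : R3 → E} (hf : LocallyIntegrable f volume) (x : R3) :
    Integrable fun t => η t • f (x - t) :=
  hη.compact.convolutionExists_left (ContinuousLinearMap.lsmul ℝ ℝ) hη.continuous hf x

theorem IsMollifier.clm_mol {E F : Type*} [NormedAddCommGroup E] [NormedSpace ℝ E]
    [NormedAddCommGroup F] [NormedSpace ℝ F] [CompleteSpace E] [CompleteSpace F] {η : R3 → ℝ}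
    (hη : IsMollifier η) {f : R3 → E} (hf : LocallyIntegrable f volume) (L : E →L[ℝ] F) (x : R3) :
    L (mol η f x) = mol η (fun y => L (f y)) x := by
  rw [mol_apply, mol_apply, ← L.integral_comp_comm (hη.integrable_smul hf x)]
  simp only [map_smul]

theorem IsMollifier.mol_sub {E : Type*} [NormedAddCommGroup E] [NormedSpace ℝ E]
    {η : R3 → ℝ} (hη : IsMollifier η) {f g : R3 → E} (hf : LocallyIntegrable f volume)
    (hg : LocallyIntegrable g volume) (x : R3) :
    mol η (fun y => f y - g y) x = mol η f x - mol η g x := by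
  simp_rw [mol_apply, smul_sub]
  exact integral_sub (hη.integrable_smul hf x) (hη.integrable_smul hg x)

theorem IsMollifier.continuous_mol {E : Type*} [NormedAddCommGroup E] [NormedSpace ℝ E]
    [CompleteSpace E] {η : R3 → ℝ} (hη : IsMollifier η) {f : R3 → E}
    (hf : LocallyIntegrable f volume) : Continuous (mol η f) := (hη.contDiff_mol hf).continuous

theorem IsMollifier.memLp_mol {E : Type*} [NormedAddCommGroup E] [NormedSpace ℝ E]
    [CompleteSpace E] {η : R3 → ℝ} (hη : IsMollifier η) {p : ℝ} (hp : 1 ≤ p) {f : R3 → E}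
    (hf : MemLp f (ENNReal.ofReal p) volume) : MemLp (mol η f) (ENNReal.ofReal p) volume :=
  ⟨(hη.continuous_mol (hf.locallyIntegrable (by simpa using hp))).aestronglyMeasurable,
    (hη.eLpNorm_mol_le hp hf.1).trans_lt hf.2⟩

theorem HasWeakDeriv.mol {η : R3 → ℝ} (hη : IsMollifier η) {i : Fin 3} {f g : R3 → ℝ}
    (h : HasWeakDeriv i f g) (hf : LocallyIntegrable f volume) :
    HasWeakDeriv i (mol η f) (mol η g) := by
  have h1 := hasWeakDeriv_of_contDiff ((hη.contDiff_mol hf).of_le (by norm_cast)) i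
  simpa only [h.fderiv_mol hη hf] using h1

/-- The distance of `f` from its twofold mollification. -/
noncomputable def molGap (η : R3 → ℝ) (p : ℝ) (f : R3 → ℝ) : ℝ≥0∞ :=
  eLpNorm (fun x => f x - mol η (mol η f) x) (ENNReal.ofReal p) volume

theorem IsMollifier.molGap_le {η : R3 → ℝ} (hη : IsMollifier η) {p : ℝ} (hp : 1 ≤ p) {f : R3 → ℝ}
    (hf : MemLp f (ENNReal.ofReal p) volume) :
    molGap η p f ≤ 2 * eLpNorm f (ENNReal.ofReal p) volume := by
  have h1 : (1 : ℝ≥0∞) ≤ ENNReal.ofReal p := by simpa using hp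
  have hm := hη.memLp_mol hp hf
  refine (eLpNorm_sub_le hf.1 (hη.memLp_mol hp hm).1 h1).trans ?_
  rw [two_mul]
  gcongr
  exact (hη.eLpNorm_mol_le hp hm.1).trans (hη.eLpNorm_mol_le hp hf.1)

/-- With d = η ⋆ f - f, the gap is the norm of -(d + η ⋆ d). -/
theorem tendsto_molGap {p : ℝ} (hp : 1 ≤ p) {f : R3 → ℝ} (hf : MemLp f (ENNReal.ofReal p) volume) :
    Tendsto (fun n => molGap (ker n) p f) atTop (𝓝 0) := by
  have h1 : (1 : ℝ≥0∞) ≤ ENNReal.ofReal p := by simpa using hp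
  have h2 := ENNReal.Tendsto.const_mul (a := 2) (tendsto_eLpNorm_mol_sub hp hf) (Or.inr (by norm_num))
  rw [mul_zero] at h2
  refine tendsto_of_tendsto_of_tendsto_of_le_of_le tendsto_const_nhds h2 (fun _ => zero_le) fun n => ?_
  have hη := isMollifier_ker n
  have hm := hη.memLp_mol hp hf
  have hd : MemLp (fun x => mol (ker n) f x - f x) (ENNReal.ofReal p) volume := hm.sub hf
  have e1 : (fun x => f x - mol (ker n) (mol (ker n) f) x) =
      fun x => -((fun x => mol (ker n) f x - f x) x +
        mol (ker n) (fun x => mol (ker n) f x - f x) x) := by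
    ext x
    simp only
    rw [hη.mol_sub (hm.locallyIntegrable h1) (hf.locallyIntegrable h1)]
    ring
  simp only [molGap]
  rw [e1]
  refine (eLpNorm_neg ((fun x => mol (ker n) f x - f x) +
    mol (ker n) (fun x => mol (ker n) f x - f x)) _ _).trans_le
    ((eLpNorm_add_le hd.1 (hη.memLp_mol hp hd).1 h1).trans ?_)
  rw [two_mul]
  gcongr
  exact hη.eLpNorm_mol_le hp hd.1

/-- The distance of `u` from its twofold mollification, in `L^a ∩ H¹`. -/
noncomputable def defect (η : R3 → ℝ) (a : ℝ) (u : R3 → R3) (G : Fin 3 → Fin 3 → R3 → ℝ) : ℝ≥0∞ :=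
  ∑ j, (molGap η a (fun x => u x j) + (molGap η 2 (fun x => u x j) + ∑ i, molGap η 2 (G i j)))

theorem memLp_apply {p : ℝ≥0∞} {u : R3 → R3} (hu : MemLp u p volume) (j : Fin 3) :
    MemLp (fun x => u x j) p volume :=
  (EuclideanSpace.proj (𝕜 := ℝ) j).comp_memLp' hu

theorem eLpNorm_apply_le (p : ℝ≥0∞) (u : R3 → R3) (j : Fin 3) :
    eLpNorm (fun x => u x j) p volume ≤ eLpNorm u p volume :=
  eLpNorm_mono fun x => PiLp.norm_apply_le (u x) j

theorem IsMollifier.defect_le {η : R3 → ℝ} (hη : IsMollifier η) {a : ℝ} (ha : 1 ≤ a) {u : R3 → R3}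
    {G : Fin 3 → Fin 3 → R3 → ℝ} (hua : MemLp u (ENNReal.ofReal a) volume)
    (hu2 : MemLp u (ENNReal.ofReal 2) volume) (hG : ∀ i j, MemLp (G i j) (ENNReal.ofReal 2) volume) :
    defect η a u G ≤ 6 * (eLpNorm u (ENNReal.ofReal a) volume + (eLpNorm u (ENNReal.ofReal 2) volume +
      ∑ i, ∑ j, eLpNorm (G i j) (ENNReal.ofReal 2) volume)) := by
  have h : ∀ j ∈ Finset.univ, (molGap η a (fun x => u x j) + (molGap η 2 (fun x => u x j) +
      ∑ i, molGap η 2 (G i j))) ≤ 2 * (eLpNorm u (ENNReal.ofReal a) volume +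
      (eLpNorm u (ENNReal.ofReal 2) volume +
      ∑ i, ∑ j, eLpNorm (G i j) (ENNReal.ofReal 2) volume)) := by
    intro j _
    rw [mul_add, mul_add, Finset.mul_sum]
    refine add_le_add ?_ (add_le_add ?_ (Finset.sum_le_sum fun i _ => ?_))
    · exact (hη.molGap_le ha (memLp_apply hua j)).trans (by gcongr; exact eLpNorm_apply_le _ _ j)
    · exact (hη.molGap_le (by norm_num) (memLp_apply hu2 j)).trans
        (by gcongr; exact eLpNorm_apply_le _ _ j)
    · refine (hη.molGap_le (by norm_num) (hG i j)).trans ?_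
      gcongr
      exact Finset.single_le_sum (f := fun j => eLpNorm (G i j) (ENNReal.ofReal 2) volume)
        (fun _ _ => zero_le) (Finset.mem_univ j)
  refine (Finset.sum_le_sum h).trans_eq ?_
  rw [Finset.sum_const, Finset.card_univ, Fintype.card_fin, nsmul_eq_mul, ← mul_assoc]
  norm_num

theorem tendsto_defect {a : ℝ} (ha : 1 ≤ a) {u : R3 → R3}
    {G : Fin 3 → Fin 3 → R3 → ℝ} (hua : MemLp u (ENNReal.ofReal a) volume)
    (hu2 : MemLp u (ENNReal.ofReal 2) volume) (hG : ∀ i j, MemLp (G i j) (ENNReal.ofReal 2) volume) :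
    Tendsto (fun n => defect (ker n) a u G) atTop (𝓝 0) := by
  have h2 : (1 : ℝ) ≤ 2 := by norm_num
  have := tendsto_finsetSum (f := fun j n => molGap (ker n) a (fun x => u x j) +
    (molGap (ker n) 2 (fun x => u x j) + ∑ i, molGap (ker n) 2 (G i j))) (x := atTop)
    (a := fun _ => 0 + (0 + ∑ _i : Fin 3, 0))
    Finset.univ fun j _ => (tendsto_molGap ha (memLp_apply hua j)).add
      ((tendsto_molGap h2 (memLp_apply hu2 j)).add
        (tendsto_finsetSum Finset.univ fun i _ => tendsto_molGap h2 (hG i j)))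
  simpa [defect] using this

theorem lintegral_enorm_mul_le {a r : ℝ} (h : a.HolderConjugate r) {f g : R3 → ℝ}
    (hf : AEStronglyMeasurable f volume) (hg : AEStronglyMeasurable g volume) :
    ∫⁻ x, ‖f x‖ₑ * ‖g x‖ₑ ≤
      eLpNorm f (ENNReal.ofReal a) volume * eLpNorm g (ENNReal.ofReal r) volume := by
  refine (ENNReal.lintegral_mul_le_Lp_mul_Lq volume h hf.enorm hg.enorm).trans_eq ?_
  have ha := h.pos
  have hr := h.symm.pos
  rw [lintegral_enorm_rpow_eq ha, lintegral_enorm_rpow_eq hr, ← ENNReal.rpow_mul, ← ENNReal.rpow_mul,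
    mul_one_div_cancel ha.ne', mul_one_div_cancel hr.ne', ENNReal.rpow_one, ENNReal.rpow_one]

/-- The heart of the proof. With W the twofold mollification, the term with W in the last slot
vanishes because div u = 0, so u may be replaced there by u - W. Hölder's inequality with exponents
a and r leaves the L^r norm of each product (η ⋆ η ⋆ ∂ᵢuⱼ)(u - W)ⱼ, bounded by the multiplier norm
of the gradient and the Ẇ^{s,m} norm of the translates of (u - W)ⱼ. By `hC` the latter is at most C
times the j-th summand of `defect`. -/
theorem IsMollifier.enorm_trilinear_le {η : R3 → ℝ} (hη : IsMollifier η) {s m a r : ℝ}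
    (har : a.HolderConjugate r) {C : ℝ≥0}
    (hC : ∀ (f : R3 → ℝ) (g : Fin 3 → R3 → ℝ), MemLp f (ENNReal.ofReal 2) volume →
      (∀ i, MemLp (g i) (ENNReal.ofReal 2) volume) → (∀ i, HasWeakDeriv i f (g i)) →
      MemLp f (ENNReal.ofReal a) volume →
      homSobolevNorm s m f ≤ C * (eLpNorm f (ENNReal.ofReal a) volume +
        (eLpNorm f (ENNReal.ofReal 2) volume + ∑ i, eLpNorm (g i) (ENNReal.ofReal 2) volume)))
    {u : L2V} (hu : IsDivFree u) {G : Fin 3 → Fin 3 → R3 → ℝ} (hG : IsWeakGrad u G)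
    (hG2 : ∀ i j, MemLp (G i j) (ENNReal.ofReal 2) volume) (hua : MemLp u (ENNReal.ofReal a) volume)
    (hA : sobMultNorm s m r G ≠ ⊤) :
    ‖∫ x, inner ℝ (fderiv ℝ (mol η (mol η u)) x (u x)) (u x)‖ₑ ≤
      9 * C * (sobMultNorm s m r G * eLpNorm u (ENNReal.ofReal a) volume) * defect η a u G := by
  have e2 : ENNReal.ofReal 2 = 2 := by norm_num
  have hle2 : (1 : ℝ) ≤ 2 := by norm_num
  have ha1 : 1 ≤ a := har.lt.le
  have hr1 : 1 ≤ r := har.symm.lt.le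
  have hu2 : MemLp u (ENNReal.ofReal 2) volume := by rw [e2]; exact Lp.memLp u
  have hloc : LocallyIntegrable u volume := hu2.locallyIntegrable (by simp)
  have hw2 := hη.memLp_mol hle2 hu2
  have hW2 := hη.memLp_mol hle2 hw2
  have two : ∀ {f : R3 → R3}, MemLp f (ENNReal.ofReal 2) volume → MemLp f 2 volume := fun h => by
    rwa [e2] at h
  have hwloc := hw2.locallyIntegrable (by simp)
  obtain ⟨W, hW⟩ : ∃ W, W = mol η (mol η u) := ⟨_, rfl⟩
  have hWs : ContDiff ℝ ∞ W := hW ▸ hη.contDiff_mol hwloc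
  rw [← hW] at hW2 ⊢
  have hlocj : ∀ j, LocallyIntegrable (fun x => u x j) volume := fun j =>
    (memLp_apply hu2 j).locallyIntegrable (by simp)
  have hlocwj : ∀ j, LocallyIntegrable (mol η fun x => u x j) volume := fun j =>
    (hη.memLp_mol hle2 (memLp_apply hu2 j)).locallyIntegrable (by simp)
  have hlocG : ∀ i j, LocallyIntegrable (G i j) volume := fun i j => (hG i j).1
  have hlocwG : ∀ i j, LocallyIntegrable (mol η (G i j)) volume := fun i j =>
    (hη.memLp_mol hle2 (hG2 i j)).locallyIntegrable (by simp)
  have hGw : ∀ i j, HasWeakDeriv i (fun x => u x j) (G i j) := fun i j => (hG i j).2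
  have hWj : ∀ j x, W x j = mol η (mol η fun x => u x j) x := by
    intro j x
    have h1 := hη.clm_mol hwloc (EuclideanSpace.proj (𝕜 := ℝ) j) x
    have h2 : (fun y => EuclideanSpace.proj (𝕜 := ℝ) j (mol η u y)) = mol η fun x => u x j :=
      funext fun y => hη.clm_mol hloc (EuclideanSpace.proj (𝕜 := ℝ) j) y
    rw [h2, ← hW] at h1
    exact h1
  have hWd : ∀ i j x, (fderiv ℝ W x (e i)) j = mol η (mol η (G i j)) x := by
    intro i j x
    rw [← ((hGw i j).mol hη (hlocj j)).fderiv_mol hη (hlocwj j) x, ← funext (hWj j)]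
    have h1 : HasFDerivAt (fun x => W x j) _ x :=
      (EuclideanSpace.proj (𝕜 := ℝ) j).hasFDerivAt.comp x
        (hWs.differentiable (by norm_num) x).hasFDerivAt
    rw [h1.fderiv]
    rfl
  -- boundedness of `W`
  obtain ⟨K, hK⟩ := hη.exists_enorm_mol_le R3
  obtain ⟨M, hM⟩ : ∃ M : ℝ, M = (K * eLpNorm (mol η u) 2 volume : ℝ≥0∞).toReal := ⟨_, rfl⟩
  have hfin : (K * eLpNorm (mol η u) 2 volume : ℝ≥0∞) ≠ ⊤ :=
    ENNReal.mul_ne_top (by simp) (two hw2).2.ne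
  have hM1 : ∀ x, ‖W x‖ ≤ M := fun x => by
    have := ENNReal.toReal_mono hfin (hK _ (two hw2) x).1
    rwa [toReal_enorm, ← hM, ← hW] at this
  have hM2 : ∀ x, ‖fderiv ℝ W x‖ ≤ M := fun x => by
    have := ENNReal.toReal_mono hfin (hK _ (two hw2) x).2
    rwa [toReal_enorm, ← hM, ← hW] at this
  have hcW : Continuous (fderiv ℝ W) := hWs.continuous_fderiv (by norm_num)
  have hDu : MemLp (fun x => fderiv ℝ W x (u x)) 2 volume := by
    refine (two hu2).of_le_mul (c := M)
      (ContinuousLinearMap.aestronglyMeasurable_comp₂ (ContinuousLinearMap.id ℝ (R3 →L[ℝ] R3))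
        hcW.aestronglyMeasurable hu2.1) (ae_of_all _ fun x => ?_)
    exact (ContinuousLinearMap.le_opNorm _ _).trans (by gcongr; exact hM2 x)
  have hzero := integral_inner_fderiv_self_eq_zero hu hWs (two hW2) hM1 hM2
  have hcancel : ∫ x, inner ℝ (fderiv ℝ W x (u x)) (u x) =
      ∫ x, inner ℝ (fderiv ℝ W x (u x)) (u x - W x) := by
    simp_rw [inner_sub_right]
    rw [integral_sub (integrable_inner_of_memLp hDu (two hu2)) (integrable_inner_of_memLp hDu (two hW2)), hzero, sub_zero]
  rw [hcancel]
  -- the estimate of a single term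
  obtain ⟨A, hAdef⟩ : ∃ A, A = sobMultNorm s m r G := ⟨_, rfl⟩
  obtain ⟨B, hBdef⟩ : ∃ B, B = eLpNorm u (ENNReal.ofReal a) volume := ⟨_, rfl⟩
  rw [← hAdef, ← hBdef]
  rw [← hAdef] at hA
  set v : Fin 3 → R3 → ℝ := fun j x => u x j - mol η (mol η fun x => u x j) x with hv
  set N : Fin 3 → ℝ≥0∞ := fun j => molGap η a (fun x => u x j) + (molGap η 2 (fun x => u x j) +
    ∑ i, molGap η 2 (G i j)) with hN
  have hvp : ∀ {p : ℝ}, 1 ≤ p → MemLp u (ENNReal.ofReal p) volume → ∀ j,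
      MemLp (v j) (ENNReal.ofReal p) volume := fun hp hu j =>
    (memLp_apply hu j).sub (hη.memLp_mol hp (hη.memLp_mol hp (memLp_apply hu j)))
  have hgp : ∀ i j, MemLp (fun x => G i j x - mol η (mol η (G i j)) x) (ENNReal.ofReal 2) volume :=
    fun i j => (hG2 i j).sub (hη.memLp_mol hle2 (hη.memLp_mol hle2 (hG2 i j)))
  have hvG : ∀ i j, HasWeakDeriv i (v j) (fun x => G i j x - mol η (mol η (G i j)) x) := fun i j =>
    (hGw i j).sub (((hGw i j).mol hη (hlocj j)).mol hη (hlocwj j)) (hlocj j) (hlocG i j)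
      (hη.continuous_mol (hlocwj j)).locallyIntegrable (hη.continuous_mol (hlocwG i j)).locallyIntegrable
  have htr : ∀ {f : R3 → ℝ} {p : ℝ≥0∞} (z : R3), AEStronglyMeasurable f volume →
      eLpNorm (fun x => f (x + z)) p volume = eLpNorm f p volume := fun z hf =>
    eLpNorm_comp_measurePreserving hf (measurePreserving_add_right volume z)
  have htrm : ∀ {f : R3 → ℝ} {p : ℝ≥0∞} (z : R3), MemLp f p volume →
      MemLp (fun x => f (x + z)) p volume := fun z hf =>
    hf.comp_measurePreserving (measurePreserving_add_right volume z)
  have hX : ∀ j z, homSobolevNorm s m (fun x => v j (x + z)) ≤ C * N j := by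
    intro j z
    refine (hC _ (fun i x => G i j (x + z) - mol η (mol η (G i j)) (x + z)) (htrm z (hvp hle2 hu2 j))
      (fun i => htrm z (hgp i j)) (fun i => (hvG i j).translate z) (htrm z (hvp ha1 hua j))).trans_eq ?_
    rw [htr z (hvp hle2 hu2 j).1, htr z (hvp hle2 hu2 j).1]
    simp_rw [fun i => htr (p := ENNReal.ofReal 2) z (hgp i j).1]
    rfl
  have hNtop : ∀ j, (C * N j : ℝ≥0∞) < ⊤ := by
    intro j
    refine ENNReal.mul_lt_top (by simp) (ENNReal.add_lt_top.2 ⟨(hvp ha1 hua j).2,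
      ENNReal.add_lt_top.2 ⟨(hvp hle2 hu2 j).2, ENNReal.sum_lt_top.2 fun i _ => (hgp i j).2⟩⟩)
  -- The change of variables x ↦ x + z moves the translation from G to v, and the bound `hX` for the
  -- translates of v does not depend on z.
  have hGv : ∀ i j z, eLpNorm (fun x => G i j (x - z) * v j x) (ENNReal.ofReal r) volume ≤
      A * (C * N j) := by
    intro i j z
    have h1 : multNorm (homSobolevNorm s m) (fun h => eLpNorm h (ENNReal.ofReal r) volume) (G i j) ≤ A :=
      hAdef ▸ multNorm_le_multNormMat _ _ G i j
    have h2 := le_multNorm_mul (homSobolevNorm s m) (ENNReal.ofReal r) (G i j)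
      (ne_top_of_le_ne_top hA h1) ((hX j z).trans_lt (hNtop j))
    refine le_trans (le_of_eq ?_) (h2.trans (mul_le_mul' h1 (hX j z)))
    have h3 : AEStronglyMeasurable (fun x => G i j (x - z) * v j x) volume :=
      ((hG2 i j).1.comp_measurePreserving (measurePreserving_sub_right volume z)).mul
        (hvp hle2 hu2 j).1
    rw [← htr z h3]
    simp only [add_sub_cancel_right]
  have hmm : ∀ i j, eLpNorm (fun x => mol η (mol η (G i j)) x * v j x) (ENNReal.ofReal r) volume ≤
      A * (C * N j) := by
    intro i j
    have := hη.eLpNorm_mol_mul_le hr1 (hlocwG i j).aestronglyMeasurable (hvp hle2 hu2 j).1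
      (hη.eLpNorm_mol_mul_le hr1 (hlocG i j).aestronglyMeasurable (hvp hle2 hu2 j).1 (hGv i j)) 0
    simpa only [sub_zero] using this
  -- summation
  have hexp : ∀ x, inner ℝ (fderiv ℝ W x (u x)) (u x - W x) =
      ∑ j, ∑ i, u x i * (mol η (mol η (G i j)) x * v j x) := by
    intro x
    have h1 : u x = ∑ i, u x i • e i := by
      ext k
      fin_cases k <;> simp [e, Fin.sum_univ_three]
    rw [PiLp.inner_apply]
    refine Finset.sum_congr rfl fun j _ => ?_
    conv_lhs => rw [h1]
    simp only [map_sum, map_smul, PiLp.sub_apply, hWj j x]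
    rw [← h1]
    simp only [WithLp.ofLp_sum, Finset.sum_apply, PiLp.smul_apply, hWd, smul_eq_mul, hv,
      RCLike.inner_apply, conj_trivial, Finset.mul_sum]
    exact Finset.sum_congr rfl fun i _ => by ring
  simp_rw [hexp]
  have hmeas : ∀ i j, AEStronglyMeasurable (fun x => mol η (mol η (G i j)) x * v j x) volume :=
    fun i j => (hη.continuous_mol (hlocwG i j)).aestronglyMeasurable.mul (hvp hle2 hu2 j).1
  have hum : ∀ i, AEStronglyMeasurable (fun x => u x i) volume := fun i => (memLp_apply hu2 i).1
  calc _ ≤ ∫⁻ x, ∑ j, ∑ i, ‖u x i‖ₑ * ‖mol η (mol η (G i j)) x * v j x‖ₑ := by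
        refine (enorm_integral_le_lintegral_enorm _).trans (lintegral_mono fun x => ?_)
        refine (enorm_sum_le _ _).trans (Finset.sum_le_sum fun j _ => ?_)
        refine (enorm_sum_le _ _).trans (Finset.sum_le_sum fun i _ => ?_)
        rw [enorm_mul]
    _ = ∑ j, ∑ i, ∫⁻ x, ‖u x i‖ₑ * ‖mol η (mol η (G i j)) x * v j x‖ₑ := by
        have hae : ∀ i j, AEMeasurable
            (fun x => ‖u x i‖ₑ * ‖mol η (mol η (G i j)) x * v j x‖ₑ) volume :=
          fun i j => (hum i).enorm.mul (hmeas i j).enorm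
        rw [lintegral_finsetSum' _ fun j _ => Finset.aemeasurable_fun_sum _ fun i _ => hae i j]
        refine Finset.sum_congr rfl fun j _ => ?_
        rw [lintegral_finsetSum' _ fun i _ => hae i j]
    _ ≤ ∑ j, ∑ i : Fin 3, B * (A * (C * N j)) := by
        refine Finset.sum_le_sum fun j _ => Finset.sum_le_sum fun i _ => ?_
        refine (lintegral_enorm_mul_le har (hum i) (hmeas i j)).trans (mul_le_mul' ?_ (hmm i j))
        rw [hBdef]
        exact eLpNorm_apply_le _ _ i
    _ ≤ 9 * C * (A * B) * defect η a u G := by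
        have hd : defect η a u G = ∑ j, N j := rfl
        rw [hd]
        simp only [Finset.sum_const, Finset.card_univ, Fintype.card_fin, nsmul_eq_mul]
        rw [← Finset.mul_sum, ← Finset.mul_sum, ← Finset.mul_sum, ← Finset.mul_sum]
        generalize ∑ j, N j = S
        calc _ = 3 * C * (A * B) * S := by push_cast; ring
          _ ≤ _ := by gcongr; norm_num


/-! ### Mollification and multiplication as operators on `L²` -/

theorem IsMollifier.memLp_mol_two {E : Type*} [NormedAddCommGroup E] [NormedSpace ℝ E]
    [CompleteSpace E] {η : R3 → ℝ} (hη : IsMollifier η) {f : R3 → E} (hf : MemLp f 2 volume) :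
    MemLp (mol η f) 2 volume := by
  have e2 : ENNReal.ofReal 2 = 2 := by norm_num
  have h : MemLp (mol η f) (ENNReal.ofReal 2) volume := hη.memLp_mol (by norm_num) (by rwa [e2])
  rwa [e2] at h

/-- Mollification on `L²`. -/
noncomputable def molL {E : Type*} [NormedAddCommGroup E] [NormedSpace ℝ E] [CompleteSpace E]
    {η : R3 → ℝ} (hη : IsMollifier η) :
    Lp E 2 (volume : Measure R3) →L[ℝ] Lp E 2 (volume : Measure R3) :=
  LinearMap.mkContinuous
    { toFun := fun f => (hη.memLp_mol_two (Lp.memLp f)).toLp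
      map_add' := fun f g => by
        have hf := (Lp.memLp f).locallyIntegrable (by norm_num)
        have hg := (Lp.memLp g).locallyIntegrable (by norm_num)
        rw [← MemLp.toLp_add]
        refine MemLp.toLp_congr _ _ (ae_of_all _ fun x => ?_)
        rw [mol_congr_ae η (Lp.coeFn_add f g)]
        simp only [mol_apply, Pi.add_apply, smul_add]
        exact integral_add (hη.integrable_smul hf x) (hη.integrable_smul hg x)
      map_smul' := fun c f => by
        rw [RingHom.id_apply, ← MemLp.toLp_const_smul]
        refine MemLp.toLp_congr _ _ (ae_of_all _ fun x => ?_)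
        rw [mol_congr_ae η (Lp.coeFn_smul c f)]
        simp only [mol_apply, Pi.smul_apply, smul_comm _ c]
        exact integral_smul c _ } 1 fun f => by
    have e2 : ENNReal.ofReal 2 = 2 := by norm_num
    have h := hη.eLpNorm_mol_le (p := 2) (by norm_num) (Lp.memLp f).1
    rw [e2] at h
    rw [one_mul]
    simp only [LinearMap.coe_mk, AddHom.coe_mk, Lp.norm_toLp]
    exact ENNReal.toReal_mono (Lp.memLp f).2.ne h

section

variable {E F : Type*} [NormedAddCommGroup E] [NormedSpace ℝ E] [CompleteSpace E]
  [NormedAddCommGroup F] [NormedSpace ℝ F] [CompleteSpace F]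

theorem coeFn_molL {η : R3 → ℝ} (hη : IsMollifier η) (f : Lp E 2 (volume : Measure R3)) :
    molL hη f =ᵐ[volume] mol η f :=
  MemLp.coeFn_toLp (hη.memLp_mol_two (Lp.memLp f))

theorem norm_molL_le {η : R3 → ℝ} (hη : IsMollifier η) (f : Lp E 2 (volume : Measure R3)) :
    ‖molL hη f‖ ≤ ‖f‖ := by
  have e2 : ENNReal.ofReal 2 = 2 := by norm_num
  have h := hη.eLpNorm_mol_le (p := 2) (by norm_num) (Lp.memLp f).1
  rw [e2] at h
  rw [Lp.norm_def, Lp.norm_def, eLpNorm_congr_ae (coeFn_molL hη f)]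
  exact ENNReal.toReal_mono (Lp.memLp f).2.ne h

theorem tendsto_molL (f : Lp E 2 (volume : Measure R3)) :
    Tendsto (fun n => molL (isMollifier_ker n) f) atTop (𝓝 f) := by
  have e2 : ENNReal.ofReal 2 = 2 := by norm_num
  have h := tendsto_eLpNorm_mol_sub (p := 2) (by norm_num) (e2.symm ▸ Lp.memLp f : MemLp f _ volume)
  rw [e2] at h
  rw [tendsto_iff_edist_tendsto_0]
  refine h.congr fun n => ?_
  rw [Lp.edist_def]
  refine eLpNorm_congr_ae ?_
  filter_upwards [coeFn_molL (isMollifier_ker n) f] with x hx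
  simp [hx]

theorem compLpL_molL {η : R3 → ℝ} (hη : IsMollifier η) (L : E →L[ℝ] F)
    (f : Lp E 2 (volume : Measure R3)) :
    L.compLpL 2 volume (molL hη f) = molL hη (L.compLpL 2 volume f) := by
  refine Lp.ext ?_
  filter_upwards [L.coeFn_compLpL (molL hη f), coeFn_molL hη f,
    coeFn_molL hη (L.compLpL 2 volume f)] with x h1 h2 h3
  rw [h1, h2, h3, mol_congr_ae η (L.coeFn_compLpL f)]
  exact hη.clm_mol ((Lp.memLp f).locallyIntegrable (by norm_num)) L x

end

/-- Multiplication by a bounded real function on `L²(ℝ³; ℂ)`. -/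
noncomputable def mulL {m : R3 → ℝ} (hm : MemLp m ⊤ volume) :
    Lp ℂ 2 (volume : Measure R3) →L[ℝ] Lp ℂ 2 (volume : Measure R3) :=
  (ContinuousLinearMap.lsmul ℝ ℝ : ℝ →L[ℝ] ℂ →L[ℝ] ℂ).holderL volume ⊤ 2 2 (hm.toLp m)

theorem coeFn_mulL {m : R3 → ℝ} (hm : MemLp m ⊤ volume) (f : Lp ℂ 2 (volume : Measure R3)) :
    mulL hm f =ᵐ[volume] fun ξ => (m ξ : ℂ) * f ξ := by
  have h := (ContinuousLinearMap.lsmul ℝ ℝ : ℝ →L[ℝ] ℂ →L[ℝ] ℂ).coeFn_holder (r := 2) (hm.toLp m) f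
  filter_upwards [h, hm.coeFn_toLp] with x h1 h2
  rw [mulL, ContinuousLinearMap.holderL_apply_apply, h1, h2]
  simp

/-! ### The symbol of a mollifier -/

/-- The Fourier transform of an even mollifier. -/
noncomputable def hat (η : R3 → ℝ) (ξ : R3) : ℝ := (𝓕 (fun x => (η x : ℂ)) ξ).re

/-- Conjugation of the Fourier integral amounts to x ↦ -x, which leaves an even real function
unchanged. -/
theorem IsMollifier.fourier_eq {η : R3 → ℝ} (hη : IsMollifier η) (ξ : R3) :
    𝓕 (fun x => (η x : ℂ)) ξ = (hat η ξ : ℂ) := by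
  have h : (starRingEnd ℂ) (𝓕 (fun x => (η x : ℂ)) ξ) = 𝓕 (fun x => (η x : ℂ)) ξ := by
    rw [Real.fourier_eq, ← integral_conj, ← integral_neg_eq_self]
    refine integral_congr_ae (ae_of_all _ fun x => ?_)
    simp [Circle.smul_def, hη.even, Real.fourierChar_apply, ← Complex.exp_conj, Complex.conj_ofNat]
  exact (Complex.conj_eq_iff_re.1 h).symm

theorem IsMollifier.abs_hat_le_one {η : R3 → ℝ} (hη : IsMollifier η) (ξ : R3) : |hat η ξ| ≤ 1 := by
  refine (Complex.abs_re_le_norm _).trans ?_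
  refine (VectorFourier.norm_fourierIntegral_le_integral_norm _ _ _ _ _).trans_eq ?_
  rw [← hη.integral_eq]
  refine integral_congr_ae (ae_of_all _ fun x => ?_)
  simp [hη.nonneg x]

/-- A smooth compactly supported real function as a complex Schwartz function. -/
noncomputable def toSchwartz {f : R3 → ℝ} (hf : ContDiff ℝ ∞ f) (hc : HasCompactSupport f) : 𝓢(R3, ℂ) :=
  have h1 : HasCompactSupport fun x => (f x : ℂ) :=
    hc.comp_left (g := fun r : ℝ => (r : ℂ)) Complex.ofReal_zero
  have h2 : ContDiff ℝ ∞ fun x => (f x : ℂ) := Complex.ofRealCLM.contDiff.comp hf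
  h1.toSchwartzMap h2

@[simp]
theorem toSchwartz_apply {f : R3 → ℝ} (hf : ContDiff ℝ ∞ f) (hc : HasCompactSupport f) (x : R3) :
    toSchwartz hf hc x = f x := rfl

theorem IsMollifier.fourier_toSchwartz {η : R3 → ℝ} (hη : IsMollifier η) (ξ : R3) :
    𝓕 (toSchwartz hη.smooth hη.compact) ξ = (hat η ξ : ℂ) := by
  rw [SchwartzMap.fourier_coe]
  exact hη.fourier_eq ξ

theorem IsMollifier.continuous_hat {η : R3 → ℝ} (hη : IsMollifier η) : Continuous (hat η) := by
  have h : hat η = fun ξ => (𝓕 (toSchwartz hη.smooth hη.compact) ξ).re := by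
    ext ξ; rw [hη.fourier_toSchwartz, Complex.ofReal_re]
  rw [h]
  exact Complex.continuous_re.comp (SchwartzMap.continuous _)

theorem IsMollifier.memLp_hat {η : R3 → ℝ} (hη : IsMollifier η) : MemLp (hat η) ⊤ volume :=
  memLp_top_of_bound hη.continuous_hat.aestronglyMeasurable 1 (ae_of_all _ hη.abs_hat_le_one)

/-- The value at ξ is the mollification of a continuous character, evaluated at the origin, where
the character equals 1. -/
theorem tendsto_hat_ker (ξ : R3) : Tendsto (fun n => hat (ker n) ξ) atTop (𝓝 1) := by
  have hg : Continuous fun x : R3 => Complex.exp (2 * Real.pi * inner ℝ x ξ * Complex.I) := by fun_prop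
  have h := ContDiffBump.convolution_tendsto_right_of_continuous (μ := volume) tendsto_bump_rOut hg 0
  have h2 := (Complex.continuous_re.tendsto _).comp h
  simp only [inner_zero_left, Complex.ofReal_zero, mul_zero, zero_mul, Complex.exp_zero,
    Complex.one_re] at h2
  refine h2.congr fun n => ?_
  simp only [Function.comp_apply, hat]
  congr 1
  rw [Real.fourier_eq]
  refine integral_congr_ae (ae_of_all _ fun x => ?_)
  simp [Circle.smul_def, Real.fourierChar_apply, ker, mul_comm]

/-! ### The Fourier transform on `L²` -/

theorem integral_mul_fourier (f : Lp ℂ 2 (volume : Measure R3)) (φ : 𝓢(R3, ℂ)) :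
    ∫ ξ, φ ξ * (𝓕 f) ξ = ∫ x, (𝓕 φ) x * f x := by
  have h := congrArg (fun T => T φ) (Lp.fourier_toTemperedDistribution_eq f)
  simp only [TemperedDistribution.fourier_apply, Lp.toTemperedDistribution_apply, smul_eq_mul] at h
  exact h.symm

/-- Both sides are continuous in f, and on the dense subspace of Schwartz functions this is the
convolution theorem. -/
theorem fourier_molL {η : R3 → ℝ} (hη : IsMollifier η) (f : Lp ℂ 2 (volume : Measure R3)) :
    𝓕 (molL hη f) = mulL hη.memLp_hat (𝓕 f) := by
  refine DenseRange.induction_on (p := fun f : Lp ℂ 2 (volume : Measure R3) =>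
    𝓕 (molL hη f) = mulL hη.memLp_hat (𝓕 f))
    (SchwartzMap.denseRange_toLpCLM (p := 2) ENNReal.ofNat_ne_top) f ?_ ?_
  · exact isClosed_eq ((Lp.fourierTransformₗᵢ R3 ℂ).continuous.comp (molL hη).continuous)
      ((mulL hη.memLp_hat).continuous.comp (Lp.fourierTransformₗᵢ R3 ℂ).continuous)
  · intro f
    rw [SchwartzMap.toLpCLM_apply]
    obtain ⟨k, hk⟩ : ∃ k, k = SchwartzMap.convolution (ContinuousLinearMap.mul ℂ ℂ)
      (toSchwartz hη.smooth hη.compact) f := ⟨_, rfl⟩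
    have h1 : molL hη (f.toLp 2) = k.toLp 2 := by
      refine Lp.ext ?_
      filter_upwards [coeFn_molL hη (f.toLp 2), k.coeFn_toLp 2 volume] with x h1 h2
      rw [h1, h2, mol_congr_ae η (f.coeFn_toLp 2 volume), hk, SchwartzMap.convolution_apply, mol_apply,
        convolution_def]
      simp
    rw [h1, SchwartzMap.toLp_fourier_eq, SchwartzMap.toLp_fourier_eq]
    refine Lp.ext ?_
    filter_upwards [coeFn_mulL hη.memLp_hat ((𝓕 f).toLp 2), (𝓕 k).coeFn_toLp 2 volume,
      (𝓕 f).coeFn_toLp 2 volume] with ξ h2 h3 h4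
    rw [h2, h3, h4, hk, SchwartzMap.fourier_convolution, SchwartzMap.pairing_apply_apply,
      hη.fourier_toSchwartz]
    rfl

/-- `fhat` as a continuous linear map. -/
noncomputable def fhatL (j : Fin 3) : L2V →L[ℝ] Lp ℂ 2 (volume : Measure R3) :=
  ((Lp.fourierTransformₗᵢ R3 ℂ).toLinearIsometry.toContinuousLinearMap.restrictScalars ℝ).comp
    ((Complex.ofRealCLM.comp (EuclideanSpace.proj (𝕜 := ℝ) j)).compLpL 2 volume)

theorem fhat_molL {η : R3 → ℝ} (hη : IsMollifier η) (f : L2V) (j : Fin 3) :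
    fhat (molL hη f) j = mulL hη.memLp_hat (fhat f j) := by
  have := compLpL_molL hη (Complex.ofRealCLM.comp (EuclideanSpace.proj (𝕜 := ℝ) j)) f
  exact (congrArg (fun g : Lp ℂ 2 (volume : Measure R3) => 𝓕 g) this).trans (fourier_molL hη _)

theorem inner_fourier_fourier (f g : Lp ℂ 2 (volume : Measure R3)) :
    inner ℝ (𝓕 f) (𝓕 g) = inner ℝ f g := by
  have h : ∀ f g : Lp ℂ 2 (volume : Measure R3), (inner ℝ f g : ℝ) = (inner ℂ f g : ℂ).re := by
    intro f g
    rw [L2.inner_def, L2.inner_def]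
    have h := integral_re (L2.integrable_inner (𝕜 := ℂ) f g)
    simp only [RCLike.re_to_complex] at h
    rw [← h]
    rfl
  rw [h, h, Lp.inner_fourier_eq]

theorem inner_eq_sum_fhat (f g : L2V) : inner ℝ f g = ∑ j, inner ℝ (fhat f j) (fhat g j) := by
  simp only [fhat, inner_fourier_fourier]
  simp only [L2.inner_def]
  rw [← integral_finsetSum _ fun j _ => L2.integrable_inner (𝕜 := ℝ) _ _]
  refine integral_congr_ae ?_
  have h : ∀ f : L2V, ∀ᵐ x, ∀ j, (Complex.ofRealCLM.comp (EuclideanSpace.proj (𝕜 := ℝ) j)).compLp f x =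
      ((f x j : ℝ) : ℂ) := fun f => ae_all_iff.2 fun j => by
    filter_upwards [ContinuousLinearMap.coeFn_compLp
      (Complex.ofRealCLM.comp (EuclideanSpace.proj (𝕜 := ℝ) j)) f] with x hx
    rw [hx]; rfl
  filter_upwards [h f, h g] with x hf hg
  rw [PiLp.inner_apply]
  refine Finset.sum_congr rfl fun j _ => ?_
  rw [hf, hg]
  simp [Complex.inner]


/-! ### Divergence-free fields on the Fourier side -/

theorem norm_e_le (i : Fin 3) : ‖e i‖ ≤ 1 := (norm_e i).le

theorem inner_e (ξ : R3) (i : Fin 3) : inner ℝ ξ (e i) = ξ i := by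
  rw [e, EuclideanSpace.inner_single_right]; simp

/-- Extension of a first-order identity from compactly supported to square-integrable test
functions. -/
theorem sum_integral_fderiv_eq_zero {ι : Type*} [Fintype ι] (d : ι → Fin 3)
    (F : ι → Lp ℂ 2 (volume : Measure R3))
    (h : ∀ φ : R3 → ℝ, ContDiff ℝ ∞ φ → HasCompactSupport φ →
      ∫ x, ∑ k, (fderiv ℝ φ x (e (d k)) : ℂ) * F k x = 0)
    {φ : R3 → ℝ} (hφ : ContDiff ℝ ∞ φ) (hφ2 : MemLp φ 2 volume)
    (hφ' : MemLp (fderiv ℝ φ) 2 volume) :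
    ∫ x, ∑ k, (fderiv ℝ φ x (e (d k)) : ℂ) * F k x = 0 := by
  obtain ⟨K, hK⟩ := exists_norm_fderiv_cut_le
  have hd : ∀ n x v, fderiv ℝ (fun x => cut n x * φ x) x v =
      cut n x * fderiv ℝ φ x v + φ x * fderiv ℝ (cut n) x v := by
    intro n x v
    rw [fderiv_fun_mul ((contDiff_cut n).differentiable (by norm_num) x)
      (hφ.differentiable (by norm_num) x)]
    simp
  have hz : ∀ n, ∫ x, ∑ k, ((cut n x * fderiv ℝ φ x (e (d k)) +
      φ x * fderiv ℝ (cut n) x (e (d k)) : ℝ) : ℂ) * F k x = 0 := by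
    intro n
    rw [← h (fun x => cut n x * φ x) ((contDiff_cut n).mul hφ) (hasCompactSupport_cut n).mul_right]
    simp_rw [hd]
  have hF : ∀ k, MemLp (F k) 2 volume := fun k => Lp.memLp _
  have hbd : Integrable fun x => ∑ k, (‖fderiv ℝ φ x‖ + K * ‖φ x‖) * ‖F k x‖ :=
    integrable_finsetSum _ fun k _ =>
      MemLp.integrable_mul (hφ'.norm.add (hφ2.norm.const_mul (K : ℝ))) (hF k).norm
  have hlim := tendsto_integral_of_dominated_convergence
    (F := fun n x => ∑ k, ((cut n x * fderiv ℝ φ x (e (d k)) +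
      φ x * fderiv ℝ (cut n) x (e (d k)) : ℝ) : ℂ) * F k x)
    (f := fun x => ∑ k, (fderiv ℝ φ x (e (d k)) : ℂ) * F k x)
    (μ := volume) (fun x => ∑ k, (‖fderiv ℝ φ x‖ + K * ‖φ x‖) * ‖F k x‖) ?_ hbd ?_ ?_
  · simp_rw [hz] at hlim
    exact tendsto_nhds_unique hlim tendsto_const_nhds
  · intro n
    refine Finset.aestronglyMeasurable_fun_sum _ fun k _ => AEStronglyMeasurable.mul ?_ (hF k).1
    have c1 : Continuous fun x => fderiv ℝ φ x (e (d k)) :=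
      (hφ.continuous_fderiv (by norm_num)).clm_apply continuous_const
    have c2 : Continuous fun x => fderiv ℝ (cut n) x (e (d k)) :=
      ((contDiff_cut n).continuous_fderiv (by norm_num)).clm_apply continuous_const
    exact (Complex.continuous_ofReal.comp (((contDiff_cut n).continuous.mul c1).add
      (hφ.continuous.mul c2))).aestronglyMeasurable
  · intro n
    refine ae_of_all _ fun x => (norm_sum_le _ _).trans (Finset.sum_le_sum fun k _ => ?_)
    rw [norm_mul, Complex.norm_real]
    gcongr
    refine (norm_add_le _ _).trans (add_le_add ?_ ?_)
    · rw [norm_mul, Real.norm_of_nonneg (cut_nonneg n x)]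
      refine (mul_le_of_le_one_left (norm_nonneg _) (cut_le_one n x)).trans ?_
      exact (ContinuousLinearMap.le_opNorm _ _).trans
        (mul_le_of_le_one_right (norm_nonneg _) (norm_e_le _))
    · rw [norm_mul, mul_comm]
      gcongr
      refine ((ContinuousLinearMap.le_opNorm _ _).trans
        (mul_le_of_le_one_right (norm_nonneg _) (norm_e_le _))).trans ?_
      refine (hK n x).trans (mul_le_of_le_one_right K.coe_nonneg (inv_le_one_of_one_le₀ ?_))
      have : (0 : ℝ) ≤ n := n.cast_nonneg
      linarith
  · refine ae_of_all _ fun x => tendsto_finsetSum _ fun k _ => Tendsto.mul_const _ ?_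
    refine (Complex.continuous_ofReal.tendsto _).comp ?_
    have h1 : Tendsto (fun n => fderiv ℝ (cut n) x (e (d k))) atTop (𝓝 0) := by
      refine squeeze_zero_norm (a := fun n : ℕ => K * (1 / ((n : ℝ) + 1))) (fun n => ?_) ?_
      · refine ((ContinuousLinearMap.le_opNorm _ _).trans
          (mul_le_of_le_one_right (norm_nonneg _) (norm_e_le _))).trans ?_
        rw [one_div]
        exact hK n x
      · simpa using (tendsto_one_div_add_atTop_nhds_zero_nat (𝕜 := ℝ)).const_mul (K : ℝ)
    simpa using ((tendsto_cut x).mul_const (fderiv ℝ φ x (e (d k)))).add (h1.const_mul (φ x))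

theorem contDiff_clm_schwartz (φ : 𝓢(R3, ℂ)) (L : ℂ →L[ℝ] ℝ) :
    ContDiff ℝ ∞ fun x => L (φ x) := L.contDiff.comp (φ.smooth _)

theorem fderiv_clm_schwartz (φ : 𝓢(R3, ℂ)) (L : ℂ →L[ℝ] ℝ) (x : R3) :
    fderiv ℝ (fun x => L (φ x)) x = L.comp (SchwartzMap.fderivCLM ℝ R3 ℂ φ x) := by
  rw [SchwartzMap.fderivCLM_apply]
  exact (L.hasFDerivAt.comp x (φ.differentiable x).hasFDerivAt).fderiv

theorem memLp_fderiv_clm_schwartz (φ : 𝓢(R3, ℂ)) (L : ℂ →L[ℝ] ℝ) :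
    MemLp (fderiv ℝ fun x => L (φ x)) 2 volume := by
  have : (fderiv ℝ fun x => L (φ x)) = fun x => (ContinuousLinearMap.compL ℝ R3 ℂ ℝ L)
      (SchwartzMap.fderivCLM ℝ R3 ℂ φ x) := by
    ext1 x; rw [fderiv_clm_schwartz]; rfl
  rw [this]
  exact ContinuousLinearMap.comp_memLp' _ (SchwartzMap.memLp _ _ _)

theorem integral_lineDeriv_fourier_mul (F : Lp ℂ 2 (volume : Measure R3)) (ψ : 𝓢(R3, ℂ)) (i : Fin 3) :
    ∫ x, (∂_{e i} (𝓕 ψ)) x * F x =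
      -(2 * Real.pi * Complex.I) * ∫ ξ, ψ ξ * ((ξ i : ℂ) * (𝓕 F) ξ) := by
  rw [SchwartzMap.lineDerivOp_fourier_eq, ← integral_mul_fourier, ← integral_const_mul]
  refine integral_congr_ae (ae_of_all _ fun ξ => ?_)
  have : (inner ℝ · (e i) : R3 → ℝ).HasTemperateGrowth := by fun_prop
  simp only [smul_apply, SchwartzMap.smulLeftCLM_apply_apply this, smul_eq_mul, Complex.real_smul]
  rw [inner_e]
  ring

theorem locallyIntegrable_coord_mul (F : Lp ℂ 2 (volume : Measure R3)) (i : Fin 3) :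
    LocallyIntegrable (fun ξ : R3 => (ξ i : ℂ) * F ξ) volume := by
  have h : Continuous fun ξ : R3 => (ξ i : ℂ) := by fun_prop
  have := ((Lp.memLp F).locallyIntegrable (by norm_num)).locallyIntegrableOn univ
  rw [← locallyIntegrableOn_univ]
  exact this.continuousOn_mul h.continuousOn isOpen_univ.isLocallyClosed

/-- Testing with 𝓕 ψ turns derivatives into multiplication by the coordinates of ξ. Since 𝓕 ψ need
not have compact support and is complex, its real and imaginary parts are used as square-integrable
tests. The free choice of directions `d` covers both the divergence and the single components of a
curl. -/
theorem sum_coord_mul_fourier_eq_zero {ι : Type*} [Fintype ι] (d : ι → Fin 3)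
    (F : ι → Lp ℂ 2 (volume : Measure R3))
    (h : ∀ φ : R3 → ℝ, ContDiff ℝ ∞ φ → HasCompactSupport φ →
      ∫ x, ∑ k, (fderiv ℝ φ x (e (d k)) : ℂ) * F k x = 0) :
    ∀ᵐ ξ : R3, ∑ k, (ξ (d k) : ℂ) * (𝓕 (F k)) ξ = 0 := by
  have key : ∀ ψ : 𝓢(R3, ℂ), ∑ k, ∫ ξ, ψ ξ * ((ξ (d k) : ℂ) * (𝓕 (F k)) ξ) = 0 := by
    intro ψ
    have hr := sum_integral_fderiv_eq_zero d F h (contDiff_clm_schwartz (𝓕 ψ) Complex.reCLM)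
      (Complex.reCLM.comp_memLp' ((𝓕 ψ).memLp 2 volume)) (memLp_fderiv_clm_schwartz _ _)
    have hi := sum_integral_fderiv_eq_zero d F h (contDiff_clm_schwartz (𝓕 ψ) Complex.imCLM)
      (Complex.imCLM.comp_memLp' ((𝓕 ψ).memLp 2 volume)) (memLp_fderiv_clm_schwartz _ _)
    have hI : ∀ (L : ℂ →L[ℝ] ℝ) k, Integrable fun x =>
        (fderiv ℝ (fun x => L ((𝓕 ψ) x)) x (e (d k)) : ℂ) * F k x := by
      intro L k
      refine MemLp.integrable_mul (p := 2) (q := 2) ?_ (Lp.memLp (F k))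
      exact (((ContinuousLinearMap.apply ℝ ℝ (e (d k))).comp_memLp'
        (memLp_fderiv_clm_schwartz (𝓕 ψ) L))).ofReal
    rw [integral_finsetSum _ fun k _ => hI _ k] at hr hi
    have h1 : ∀ k, ∫ x, (∂_{e (d k)} (𝓕 ψ)) x * F k x =
        (∫ x, (fderiv ℝ (fun x => Complex.reCLM ((𝓕 ψ) x)) x (e (d k)) : ℂ) * F k x) +
        Complex.I * ∫ x, (fderiv ℝ (fun x => Complex.imCLM ((𝓕 ψ) x)) x (e (d k)) : ℂ) * F k x := by
      intro k
      rw [← integral_const_mul, ← integral_add (hI _ k) ((hI _ k).const_mul _)]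
      refine integral_congr_ae (ae_of_all _ fun x => ?_)
      simp only
      rw [fderiv_clm_schwartz, fderiv_clm_schwartz, SchwartzMap.lineDerivOp_apply_eq_fderiv,
        SchwartzMap.fderivCLM_apply]
      simp only [ContinuousLinearMap.comp_apply, Complex.reCLM_apply, Complex.imCLM_apply]
      have h3 := Complex.re_add_im (fderiv ℝ (⇑(𝓕 ψ : 𝓢(R3, ℂ))) x (e (d k)))
      linear_combination (-F k x) * h3
    have h2 : ∑ k, ∫ x, (∂_{e (d k)} (𝓕 ψ)) x * F k x = 0 := by
      simp_rw [h1]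
      rw [Finset.sum_add_distrib, ← Finset.mul_sum, hr, hi]
      simp
    simp_rw [integral_lineDeriv_fourier_mul, ← Finset.mul_sum] at h2
    exact (mul_eq_zero.1 h2).resolve_left (by simp [Real.pi_ne_zero])
  refine ae_eq_zero_of_integral_contDiff_smul_eq_zero ?_ fun g hg hc => ?_
  · exact locallyIntegrable_finsetSum _ fun k _ => locallyIntegrable_coord_mul (𝓕 (F k)) (d k)
  · rw [← key (toSchwartz hg hc), ← integral_finsetSum]
    · refine integral_congr_ae (ae_of_all _ fun ξ => ?_)
      simp [Finset.mul_sum]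
    · intro k _
      have := (locallyIntegrable_coord_mul (𝓕 (F k)) (d k)).integrable_smul_left_of_hasCompactSupport
        hg.continuous hc
      simpa using this

/-- The components of a real field as complex-valued functions. -/
noncomputable def cpx (f : L2V) (j : Fin 3) : Lp ℂ 2 (volume : Measure R3) :=
  (Complex.ofRealCLM.comp (EuclideanSpace.proj (𝕜 := ℝ) j)).compLp f

theorem coeFn_cpx (f : L2V) : ∀ᵐ x, ∀ j, cpx f j x = ((f x j : ℝ) : ℂ) :=
  ae_all_iff.2 fun j => by
    filter_upwards [ContinuousLinearMap.coeFn_compLp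
      (Complex.ofRealCLM.comp (EuclideanSpace.proj (𝕜 := ℝ) j)) f] with x hx
    rw [cpx, hx]; rfl

theorem fhat_eq (f : L2V) (j : Fin 3) : fhat f j = 𝓕 (cpx f j) := rfl

theorem eq_sum_smul_e (v : R3) : v = ∑ i, v i • e i := by
  ext k
  fin_cases k <;> simp [e, Fin.sum_univ_three]

theorem IsDivFree.sum_coord_mul_fhat {f : L2V} (hf : IsDivFree f) :
    ∀ᵐ ξ : R3, ∑ i, (ξ i : ℂ) * fhat f i ξ = 0 := by
  refine sum_coord_mul_fourier_eq_zero (fun i => i) (cpx f) fun φ hφ hc => ?_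
  have h := hf φ hφ hc
  have h1 : ∫ x, ∑ k, (fderiv ℝ φ x (e k) : ℂ) * cpx f k x =
      ∫ x, ((fderiv ℝ φ x (f x) : ℝ) : ℂ) := by
    refine integral_congr_ae ?_
    filter_upwards [coeFn_cpx f] with x hx
    simp only [hx]
    conv_rhs => rw [eq_sum_smul_e (f x)]
    simp only [map_sum, map_smul, smul_eq_mul, Complex.ofReal_sum, Complex.ofReal_mul]
    exact Finset.sum_congr rfl fun i _ => mul_comm _ _
  rw [h1, integral_complex_ofReal, h, Complex.ofReal_zero]

/-- The divergence-free field `∂ⱼΦ eᵢ - ∂ᵢΦ eⱼ`. -/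
noncomputable def curlField (Φ : R3 → ℝ) (i j : Fin 3) (x : R3) : R3 :=
  fderiv ℝ Φ x (e j) • e i - fderiv ℝ Φ x (e i) • e j

/-- Orthogonality to the curl fields says ∂ⱼXᵢ - ∂ᵢXⱼ = 0 in distributions; the minus sign is
carried by the second entry of the family. -/
theorem coord_mul_fhat_comm {X : L2V}
    (hX : ∀ Φ : R3 → ℝ, ContDiff ℝ ∞ Φ → HasCompactSupport Φ → ∀ i j,
      ∫ x, inner ℝ (X x) (curlField Φ i j x) = 0) (i j : Fin 3) :
    ∀ᵐ ξ : R3, (ξ j : ℂ) * fhat X i ξ = (ξ i : ℂ) * fhat X j ξ := by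
  have h := sum_coord_mul_fourier_eq_zero (![j, i]) (![cpx X i, -cpx X j]) fun φ hφ hc => ?_
  · have hneg : 𝓕 (-cpx X j) = -fhat X j := (Lp.fourierTransformₗᵢ R3 ℂ).map_neg _
    filter_upwards [h, Lp.coeFn_neg (fhat X j)] with ξ h1 h2
    simp only [Fin.sum_univ_two, Matrix.cons_val_zero, Matrix.cons_val_one, hneg, h2, Pi.neg_apply] at h1
    rw [fhat_eq]
    linear_combination h1
  · have h1 : ∫ x, ∑ k, (fderiv ℝ φ x (e (![j, i] k)) : ℂ) * (![cpx X i, -cpx X j] k) x =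
        ∫ x, ((inner ℝ (X x) (curlField φ i j x) : ℝ) : ℂ) := by
      refine integral_congr_ae ?_
      filter_upwards [coeFn_cpx X, Lp.coeFn_neg (cpx X j)] with x hx hn
      simp only [Fin.sum_univ_two, Matrix.cons_val_zero, Matrix.cons_val_one, hx, hn, Pi.neg_apply,
        curlField, inner_sub_right, real_inner_smul_right, inner_e]
      push_cast
      ring
    rw [h1, integral_complex_ofReal, hX φ hφ hc i j, Complex.ofReal_zero]

/-- This is the Helmholtz decomposition: the transform of X is parallel to ξ and that of Y is
orthogonal to ξ. The identity is first multiplied by |ξ|², which is nonzero almost everywhere. -/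
theorem inner_eq_zero_of_curl {X Y : L2V}
    (hX : ∀ Φ : R3 → ℝ, ContDiff ℝ ∞ Φ → HasCompactSupport Φ → ∀ i j,
      ∫ x, inner ℝ (X x) (curlField Φ i j x) = 0)
    (hY : ∀ᵐ ξ : R3, ∑ i, (ξ i : ℂ) * fhat Y i ξ = 0) : inner ℝ X Y = 0 := by
  have hne : ∀ᵐ ξ : R3, ξ ≠ 0 := by
    rw [ae_iff]; simp
  rw [inner_eq_sum_fhat]
  simp only [L2.inner_def]
  rw [← integral_finsetSum _ fun j _ => L2.integrable_inner (𝕜 := ℝ) _ _]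
  refine integral_eq_zero_of_ae ?_
  filter_upwards [hY, hne, ae_all_iff.2 fun i => ae_all_iff.2 fun j => coord_mul_fhat_comm hX i j]
    with ξ h1 h0 h2
  have h3 : (∑ i, (ξ i : ℂ) ^ 2) * ∑ j, (starRingEnd ℂ) (fhat X j ξ) * fhat Y j ξ = 0 := by
    have h2' : ∀ i j, (ξ j : ℂ) * (starRingEnd ℂ) (fhat X i ξ) = (ξ i : ℂ) * (starRingEnd ℂ) (fhat X j ξ) := by
      intro i j
      simpa using congrArg (starRingEnd ℂ) (h2 i j)
    calc _ = (∑ i, (ξ i : ℂ) * (starRingEnd ℂ) (fhat X i ξ)) * ∑ j, (ξ j : ℂ) * fhat Y j ξ := by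
          rw [Finset.sum_mul_sum, Finset.sum_mul_sum]
          refine Finset.sum_congr rfl fun i _ => Finset.sum_congr rfl fun j _ => ?_
          linear_combination (-(ξ i : ℂ) * fhat Y j ξ) * h2' i j
      _ = 0 := by rw [h1, mul_zero]
  have h4 : (∑ i, (ξ i : ℂ) ^ 2) ≠ 0 := by
    have : (∑ i, (ξ i : ℂ) ^ 2) = ((‖ξ‖ ^ 2 : ℝ) : ℂ) := by
      rw [EuclideanSpace.real_norm_sq_eq]; push_cast; rfl
    rw [this]
    exact_mod_cast (pow_pos (norm_pos_iff.2 h0) 2).ne'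
  have h5 := (mul_eq_zero.1 h3).resolve_left h4
  have h6 : ∑ j, inner ℝ (fhat X j ξ) (fhat Y j ξ) =
      (∑ j, (starRingEnd ℂ) (fhat X j ξ) * fhat Y j ξ).re := by
    rw [Complex.re_sum]
    refine Finset.sum_congr rfl fun j _ => ?_
    rw [Complex.inner, mul_comm]
  simp only [Pi.zero_apply]
  rw [h6, h5, Complex.zero_re]


/-! ### Weak derivatives of `H¹` fields -/

/-- The inverse transform of 2πi ξᵢ f̂ⱼ is in L² and agrees with g against all test functions, so g
equals it almost everywhere. Plancherel's theorem gives the norm. -/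
theorem HasWeakDeriv.memLp_of_fourier {f : L2V} {g : R3 → ℝ} {i j : Fin 3}
    (h : HasWeakDeriv i (fun x => f x j) g) (hg : LocallyIntegrable g volume) {B : ℝ≥0∞}
    (hB : eLpNorm (fun ξ : R3 => (2 * Real.pi * Complex.I) * ((ξ i : ℂ) * fhat f j ξ)) 2 volume ≤ B)
    (hBt : B ≠ ⊤) : MemLp g 2 volume ∧ eLpNorm g 2 volume ≤ B := by
  have hm : AEStronglyMeasurable (fun ξ : R3 => (2 * Real.pi * Complex.I) * ((ξ i : ℂ) * fhat f j ξ))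
      volume :=
    (locallyIntegrable_coord_mul (fhat f j) i).aestronglyMeasurable.const_mul _
  have hmem : MemLp (fun ξ : R3 => (2 * Real.pi * Complex.I) * ((ξ i : ℂ) * fhat f j ξ)) 2 volume :=
    ⟨hm, hB.trans_lt hBt.lt_top⟩
  obtain ⟨H, hH⟩ : ∃ H, H = hmem.toLp := ⟨_, rfl⟩
  obtain ⟨γ, hγ⟩ : ∃ γ : Lp ℂ 2 (volume : Measure R3), γ = 𝓕⁻ H := ⟨_, rfl⟩
  have hγH : 𝓕 γ = H := by rw [hγ, fourier_fourierInv_eq]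
  have hae : ∀ᵐ x, (g x : ℂ) = γ x := by
    refine ae_eq_of_integral_contDiff_smul_eq (f := fun x => (g x : ℂ)) ?_
      ((Lp.memLp γ).locallyIntegrable (by norm_num)) fun φ hφ hc => ?_
    · exact fun x => (hg x).imp fun s hs => ⟨hs.1, hs.2.ofReal⟩
    · have h1 := h φ hφ hc
      obtain ⟨ψ, hψ⟩ : ∃ ψ : 𝓢(R3, ℂ), 𝓕 ψ = toSchwartz hφ hc :=
        ⟨𝓕⁻ (toSchwartz hφ hc), fourier_fourierInv_eq _⟩
      have h2 := integral_lineDeriv_fourier_mul (cpx f j) ψ i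
      have h3 := integral_mul_fourier γ ψ
      rw [hψ] at h2 h3
      have e1 : ∫ x, (∂_{e i} (toSchwartz hφ hc)) x * cpx f j x =
          ((∫ x, f x j * fderiv ℝ φ x (e i) : ℝ) : ℂ) := by
        rw [← integral_complex_ofReal]
        refine integral_congr_ae ?_
        filter_upwards [coeFn_cpx f] with x hx
        rw [hx, SchwartzMap.lineDerivOp_apply_eq_fderiv]
        have h4 : HasFDerivAt (fun x => ((φ x : ℝ) : ℂ)) (Complex.ofRealCLM.comp (fderiv ℝ φ x)) x :=
          Complex.ofRealCLM.hasFDerivAt.comp x (hφ.differentiable (by norm_num) x).hasFDerivAt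
        have h5 : fderiv ℝ (toSchwartz hφ hc) x = Complex.ofRealCLM.comp (fderiv ℝ φ x) := h4.fderiv
        rw [h5]
        simp [mul_comm]
      have e2 : -(2 * Real.pi * Complex.I) * ∫ ξ, ψ ξ * ((ξ i : ℂ) * (𝓕 (cpx f j)) ξ) =
          -∫ ξ, ψ ξ * (𝓕 γ) ξ := by
        rw [← integral_const_mul, ← integral_neg, hγH]
        refine integral_congr_ae ?_
        filter_upwards [hmem.coeFn_toLp] with ξ hξ
        rw [hH, hξ, fhat_eq]
        ring
      rw [e1, e2, h3, h1, Complex.ofReal_neg, neg_inj, ← integral_complex_ofReal] at h2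
      simp only [toSchwartz_apply] at h2
      simp only [Complex.real_smul]
      rw [← h2]
      refine integral_congr_ae (ae_of_all _ fun x => ?_)
      push_cast
      ring
  have hn : eLpNorm g 2 volume = eLpNorm γ 2 volume :=
    eLpNorm_congr_norm_ae (hae.mono fun x hx => by rw [← hx, Complex.norm_real])
  have hle : eLpNorm γ 2 volume ≤ B := by
    have h1 : ‖γ‖ = ‖H‖ := by rw [← hγH, Lp.norm_fourier_eq]
    have h2 : ‖γ‖ₑ = ‖H‖ₑ := by rw [← ofReal_norm, h1, ofReal_norm]
    rw [Lp.enorm_def, Lp.enorm_def] at h2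
    rw [h2, hH, eLpNorm_congr_ae hmem.coeFn_toLp]
    exact hB
  exact ⟨⟨hg.aestronglyMeasurable, by rw [hn]; exact hle.trans_lt hBt.lt_top⟩, hn ▸ hle⟩

/-- This is where α ≥ 1 gives control of the gradient: |2πξᵢ|² ≤ 1 + |2πξ|² ≤ (1 + |2πξ|²) ^ α. -/
theorem eLpNorm_coord_mul_fhat_le {α : ℝ} (hα : 1 ≤ α) (f : L2V) (i j : Fin 3) :
    eLpNorm (fun ξ : R3 => (2 * Real.pi * Complex.I) * ((ξ i : ℂ) * fhat f j ξ)) 2 volume ≤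
      sobolevNorm α f := by
  rw [eLpNorm_eq_lintegral_rpow_enorm_toReal (by norm_num) (by norm_num), sobolevNorm]
  simp only [ENNReal.toReal_ofNat]
  refine ENNReal.rpow_le_rpow ?_ (by norm_num)
  refine le_trans (lintegral_mono fun ξ => ?_) (Finset.single_le_sum
    (f := fun j => ∫⁻ ξ, ENNReal.ofReal ((1 + (2 * Real.pi * ‖ξ‖) ^ 2) ^ α) * ‖fhat f j ξ‖ₑ ^ 2)
    (fun _ _ => zero_le) (Finset.mem_univ j))
  rw [show (2 : ℝ) = ((2 : ℕ) : ℝ) by norm_num, ENNReal.rpow_natCast, ← mul_assoc, enorm_mul, mul_pow]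
  push_cast
  gcongr
  have h1 : ‖(2 * Real.pi * Complex.I) * (ξ i : ℂ)‖ₑ = ENNReal.ofReal (2 * Real.pi * |ξ i|) := by
    rw [← ofReal_norm]
    congr 1
    simp [Real.pi_pos.le]
  rw [h1, ← ENNReal.ofReal_pow (by positivity)]
  refine ENNReal.ofReal_le_ofReal ?_
  have h2 : |ξ i| ≤ ‖ξ‖ := PiLp.norm_apply_le ξ i
  calc (2 * Real.pi * |ξ i|) ^ 2 ≤ (2 * Real.pi * ‖ξ‖) ^ 2 := by gcongr
    _ ≤ 1 + (2 * Real.pi * ‖ξ‖) ^ 2 := by linarith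
    _ ≤ _ := Real.self_le_rpow_of_one_le (by nlinarith [sq_nonneg (2 * Real.pi * ‖ξ‖)]) hα

theorem IsWeakGrad.eLpNorm_le {α : ℝ} (hα : 1 ≤ α) {f : L2V} {G : Fin 3 → Fin 3 → R3 → ℝ}
    (hG : IsWeakGrad f G) (hf : sobolevNorm α f ≠ ⊤) (i j : Fin 3) :
    MemLp (G i j) 2 volume ∧ eLpNorm (G i j) 2 volume ≤ sobolevNorm α f :=
  HasWeakDeriv.memLp_of_fourier (hG i j).2 (hG i j).1 (eLpNorm_coord_mul_fhat_le hα f i j) hf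

/-! ### Fractional powers of the Laplacian of mollified fields -/

/-- Reconciles the L² inverse transform, used for `fhat`, with the integral that defines `frac`.
Both have the same pairings with test functions. -/
theorem fourierInv_ae_eq {H : Lp ℂ 2 (volume : Measure R3)} {h : R3 → ℂ} (hi : Integrable h)
    (hH : H =ᵐ[volume] h) : (𝓕⁻ H : Lp ℂ 2 (volume : Measure R3)) =ᵐ[volume] 𝓕⁻ h := by
  have hc : Continuous (𝓕⁻ h) :=
    VectorFourier.fourierIntegral_continuous Real.continuous_fourierChar
      (by exact (continuous_fst.inner continuous_snd).neg) hi
  refine ae_eq_of_integral_contDiff_smul_eq ((Lp.memLp _).locallyIntegrable (by norm_num))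
    hc.locallyIntegrable fun φ hφ hφc => ?_
  obtain ⟨Φ, hΦ⟩ : ∃ Φ, Φ = toSchwartz hφ hφc := ⟨_, rfl⟩
  have h1 : ∫ x, Φ x * (𝓕⁻ H : Lp ℂ 2 (volume : Measure R3)) x = ∫ ξ, (𝓕⁻ Φ) ξ * H ξ := by
    have h := congrArg (fun T => T Φ) (Lp.fourierInv_toTemperedDistribution_eq H)
    simp only [TemperedDistribution.fourierInv_apply, Lp.toTemperedDistribution_apply, smul_eq_mul] at h
    exact h.symm
  have h2 := VectorFourier.integral_fourierIntegral_smul_eq_flip (μ := volume) (ν := volume)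
    (e := Real.fourierChar) (L := -innerₗ R3) Real.continuous_fourierChar
    (by exact (continuous_fst.inner continuous_snd).neg) (Φ.integrable (μ := volume)) hi
  have h3 : (-innerₗ R3 : R3 →ₗ[ℝ] R3 →ₗ[ℝ] ℝ).flip = -innerₗ R3 := by
    ext x y; simp [real_inner_comm]
  rw [h3] at h2
  have h4 : ∀ ξ, VectorFourier.fourierIntegral Real.fourierChar volume (-innerₗ R3) Φ ξ = (𝓕⁻ Φ) ξ := by
    intro ξ; rw [SchwartzMap.fourierInv_coe]; rfl
  simp only [h4, smul_eq_mul] at h2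
  have h5 : ∫ ξ, (𝓕⁻ Φ) ξ * H ξ = ∫ ξ, (𝓕⁻ Φ) ξ * h ξ :=
    integral_congr_ae (hH.mono fun ξ hξ => by simp only [hξ])
  rw [h5, h2] at h1
  have h6 : ∀ x, Φ x = φ x := fun x => by rw [hΦ]; rfl
  simp only [h6] at h1
  exact h1

theorem measurable_symb (s : ℝ) : Measurable (symb s) := by
  have : Measurable fun ξ : R3 => (2 * Real.pi * ‖ξ‖) ^ s := by fun_prop
  exact this

theorem symb_nonneg (s : ℝ) (ξ : R3) : 0 ≤ symb s ξ := by unfold symb; positivity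

/-- The transform of η is a Schwartz function and absorbs any power of |ξ|. -/
theorem IsMollifier.memLp_symb_mul_hat {η : R3 → ℝ} (hη : IsMollifier η) {s : ℝ} (hs : 0 ≤ s) :
    MemLp (fun ξ => symb s ξ * hat η ξ) ⊤ volume := by
  obtain ⟨C, hC⟩ := (𝓕 (toSchwartz hη.smooth hη.compact)).decay ⌈s⌉₊ 0
  refine memLp_top_of_bound ((measurable_symb s).mul hη.continuous_hat.measurable).aestronglyMeasurable
    (1 + (2 * Real.pi) ^ ⌈s⌉₊ * C) (ae_of_all _ fun ξ => ?_)
  have h1 := hC.2 ξ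
  rw [norm_iteratedFDeriv_zero, hη.fourier_toSchwartz, Complex.norm_real] at h1
  rw [norm_mul, Real.norm_of_nonneg (symb_nonneg s ξ)]
  have h2 : symb s ξ ≤ 1 + (2 * Real.pi * ‖ξ‖) ^ ⌈s⌉₊ := by
    rw [symb]
    have h0 : 0 ≤ 2 * Real.pi * ‖ξ‖ := by positivity
    rcases le_total (2 * Real.pi * ‖ξ‖) 1 with h | h
    · exact (Real.rpow_le_one h0 h hs).trans (by simp [h0])
    · rw [← Real.rpow_natCast]
      exact (Real.rpow_le_rpow_of_exponent_le h (Nat.le_ceil s)).trans (by linarith)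
  calc symb s ξ * ‖hat η ξ‖ ≤ (1 + (2 * Real.pi * ‖ξ‖) ^ ⌈s⌉₊) * ‖hat η ξ‖ := by gcongr
    _ = ‖hat η ξ‖ + (2 * Real.pi) ^ ⌈s⌉₊ * (‖ξ‖ ^ ⌈s⌉₊ * ‖hat η ξ‖) := by rw [mul_pow]; ring
    _ ≤ _ := by
      gcongr
      exact hη.abs_hat_le_one ξ

theorem IsMollifier.fourier_mol {η : R3 → ℝ} (hη : IsMollifier η) {φ : R3 → ℝ}
    (hφ : ContDiff ℝ ∞ φ) (hc : HasCompactSupport φ) (ξ : R3) :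
    𝓕 (fun x => ((mol η φ x : ℝ) : ℂ)) ξ = hat η ξ * 𝓕 (toSchwartz hφ hc) ξ := by
  have h1 : (fun x => ((mol η φ x : ℝ) : ℂ)) = SchwartzMap.convolution (ContinuousLinearMap.mul ℂ ℂ)
      (toSchwartz hη.smooth hη.compact) (toSchwartz hφ hc) := by
    ext x
    rw [SchwartzMap.convolution_apply, mol_apply, convolution_def, ← integral_complex_ofReal]
    simp
  rw [h1, ← SchwartzMap.fourier_coe, SchwartzMap.fourier_convolution, SchwartzMap.pairing_apply_apply,
    hη.fourier_toSchwartz]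
  rfl

/-- Mollifying the test function makes the total symbol bounded. By Plancherel's theorem the
multiplier can then act on an arbitrary u in L². -/
theorem IsMollifier.integral_mul_frac_mol {η : R3 → ℝ} (hη : IsMollifier η) {s : ℝ} (hs : 0 ≤ s)
    {φ : R3 → ℝ} (hφ : ContDiff ℝ ∞ φ) (hc : HasCompactSupport φ) (u : L2V) (j : Fin 3) :
    ∫ x, u x j * (frac s (fun y => ((mol η φ y : ℝ) : ℂ)) x).re =
      inner ℝ (mulL (hη.memLp_symb_mul_hat hs) (fhat u j)) (𝓕 ((toSchwartz hφ hc).toLp 2)) := by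
  obtain ⟨Φ, hΦ⟩ : ∃ Φ, Φ = toSchwartz hφ hc := ⟨_, rfl⟩
  have hm := hη.memLp_symb_mul_hat hs
  obtain ⟨H, hH⟩ : ∃ H : Lp ℂ 2 (volume : Measure R3), H = mulL hm (𝓕 (Φ.toLp 2 volume)) :=
    ⟨_, rfl⟩
  have hHae : H =ᵐ[volume] fun ξ => (symb s ξ : ℂ) * 𝓕 (fun y => ((mol η φ y : ℝ) : ℂ)) ξ := by
    rw [hH, SchwartzMap.toLp_fourier_eq]
    filter_upwards [coeFn_mulL hm ((𝓕 Φ).toLp 2), (𝓕 Φ).coeFn_toLp 2 volume] with ξ h1 h2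
    rw [h1, h2, hη.fourier_mol hφ hc, hΦ]
    push_cast
    ring
  have hint : Integrable fun ξ => (symb s ξ : ℂ) * 𝓕 (fun y => ((mol η φ y : ℝ) : ℂ)) ξ := by
    have h1 : Integrable fun ξ => ((symb s ξ * hat η ξ : ℝ) : ℂ) * (𝓕 Φ) ξ :=
      ((𝓕 Φ).integrable (μ := volume)).bdd_mul (c := (eLpNorm (fun ξ => symb s ξ * hat η ξ) ⊤ volume).toReal)
        (Complex.continuous_ofReal.comp_aestronglyMeasurable hm.1) (by
          have := ae_le_eLpNormEssSup (f := fun ξ => symb s ξ * hat η ξ) (μ := volume)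
          filter_upwards [this] with ξ hξ
          rw [Complex.norm_real, ← toReal_enorm]
          rw [eLpNorm_exponent_top]
          exact ENNReal.toReal_mono (by rw [← eLpNorm_exponent_top]; exact hm.2.ne) hξ)
    refine h1.congr (ae_of_all _ fun ξ => ?_)
    simp only
    rw [hη.fourier_mol hφ hc, hΦ]
    push_cast
    ring
  have hfr := fourierInv_ae_eq hint hHae
  have h1 : inner ℝ (mulL hm (fhat u j)) (𝓕 (Φ.toLp 2)) = inner ℝ (fhat u j) H := by
    rw [hH, L2.inner_def, L2.inner_def]
    refine integral_congr_ae ?_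
    filter_upwards [coeFn_mulL hm (fhat u j), coeFn_mulL hm (𝓕 (Φ.toLp 2))] with ξ h1 h2
    rw [h1, h2]
    simp only [Complex.inner, map_mul, Complex.conj_ofReal]
    congr 1
    ring
  rw [← hΦ, h1]
  have h2 : inner ℝ (fhat u j) H = inner ℝ (cpx u j) (𝓕⁻ H) := by
    rw [← inner_fourier_fourier (cpx u j), fourier_fourierInv_eq, fhat_eq]
  rw [h2, L2.inner_def]
  refine integral_congr_ae ?_
  filter_upwards [hfr, coeFn_cpx u] with x h3 h4
  rw [h3, h4, Complex.inner, frac, Complex.conj_ofReal, mul_comm (_ : ℂ), Complex.re_ofReal_mul]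


/-! ### The mollified equation -/

/-- A bound for mollification from `L²` to `W^{1,∞}`. -/
noncomputable def molConst {η : R3 → ℝ} (hη : IsMollifier η) : ℝ≥0 :=
  (hη.exists_enorm_mol_le R3).choose

theorem norm_fderiv_mol_le {η : R3 → ℝ} (hη : IsMollifier η) (φ : L2V) (x : R3) :
    ‖fderiv ℝ (mol η φ) x‖ ≤ molConst hη * ‖φ‖ := by
  have h := ((hη.exists_enorm_mol_le R3).choose_spec φ (Lp.memLp φ) x).2
  have h2 := ENNReal.toReal_mono (ENNReal.mul_ne_top (by simp) (Lp.memLp φ).2.ne) h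
  rwa [toReal_enorm, ENNReal.toReal_mul, ENNReal.coe_toReal, ← Lp.norm_def] at h2

theorem IsMollifier.contDiff_mol_L2 {η : R3 → ℝ} (hη : IsMollifier η) (φ : L2V) :
    ContDiff ℝ ∞ (mol η φ) :=
  hη.contDiff_mol ((Lp.memLp φ).locallyIntegrable (by norm_num))

theorem IsMollifier.memLp_adv {η : R3 → ℝ} (hη : IsMollifier η) (φ u : L2V) :
    MemLp (fun x => fderiv ℝ (mol η φ) x (u x)) 2 volume := by
  have hc : Continuous (fderiv ℝ (mol η φ)) := (hη.contDiff_mol_L2 φ).continuous_fderiv (by norm_num)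
  refine (Lp.memLp u).of_le_mul (c := molConst hη * ‖φ‖)
      (ContinuousLinearMap.aestronglyMeasurable_comp₂ (ContinuousLinearMap.id ℝ (R3 →L[ℝ] R3))
        hc.aestronglyMeasurable (Lp.memLp u).1) (ae_of_all _ fun x => ?_)
  exact (ContinuousLinearMap.le_opNorm _ _).trans (by gcongr; exact norm_fderiv_mol_le hη φ x)

theorem fderiv_mol_add {η : R3 → ℝ} (hη : IsMollifier η) (φ ψ : L2V) (x : R3) :
    fderiv ℝ (mol η (φ + ψ : L2V)) x = fderiv ℝ (mol η φ) x + fderiv ℝ (mol η ψ) x := by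
  have h : mol η (φ + ψ : L2V) = fun x => mol η φ x + mol η ψ x := by
    ext1 x
    rw [mol_congr_ae η (Lp.coeFn_add φ ψ)]
    simp only [mol_apply, Pi.add_apply, smul_add]
    exact integral_add (hη.integrable_smul ((Lp.memLp φ).locallyIntegrable (by norm_num)) x)
      (hη.integrable_smul ((Lp.memLp ψ).locallyIntegrable (by norm_num)) x)
  rw [h, fderiv_fun_add ((hη.contDiff_mol_L2 φ).differentiable (by norm_num) x)
    ((hη.contDiff_mol_L2 ψ).differentiable (by norm_num) x)]

theorem fderiv_mol_smul {η : R3 → ℝ} (hη : IsMollifier η) (c : ℝ) (φ : L2V) (x : R3) :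
    fderiv ℝ (mol η (c • φ : L2V)) x = c • fderiv ℝ (mol η φ) x := by
  have h : mol η (c • φ : L2V) = fun x => c • mol η φ x := by
    ext1 x
    rw [mol_congr_ae η (Lp.coeFn_smul c φ)]
    simp only [mol_apply, Pi.smul_apply, smul_comm _ c]
    exact integral_smul c _
  rw [h, fderiv_fun_const_smul ((hη.contDiff_mol_L2 φ).differentiable (by norm_num) x)]

/-- The bilinear operator `(φ, u) ↦ (u · ∇)(η ⋆ φ)`. -/
noncomputable def adv {η : R3 → ℝ} (hη : IsMollifier η) : L2V →L[ℝ] L2V →L[ℝ] L2V :=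
  LinearMap.mkContinuous₂
    (LinearMap.mk₂ ℝ (fun φ u => (hη.memLp_adv φ u).toLp)
      (fun φ ψ u => by
        rw [← MemLp.toLp_add]
        refine MemLp.toLp_congr _ _ (ae_of_all _ fun x => ?_)
        show fderiv ℝ (mol η (φ + ψ : L2V)) x (u x) = _
        rw [fderiv_mol_add hη]
        rfl)
      (fun c φ u => by
        rw [← MemLp.toLp_const_smul]
        refine MemLp.toLp_congr _ _ (ae_of_all _ fun x => ?_)
        show fderiv ℝ (mol η (c • φ : L2V)) x (u x) = _
        rw [fderiv_mol_smul hη]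
        rfl)
      (fun φ u v => by
        rw [← MemLp.toLp_add]
        refine MemLp.toLp_congr _ _ ?_
        filter_upwards [Lp.coeFn_add u v] with x hx
        rw [hx]
        simp)
      (fun c φ u => by
        rw [← MemLp.toLp_const_smul]
        refine MemLp.toLp_congr _ _ ?_
        filter_upwards [Lp.coeFn_smul c u] with x hx
        rw [hx]
        simp)) (molConst hη) fun φ u => by
    refine Lp.norm_le_mul_norm_of_ae_le_mul ?_
    filter_upwards [(hη.memLp_adv φ u).coeFn_toLp] with x hx
    rw [LinearMap.mk₂_apply, hx]
    exact (ContinuousLinearMap.le_opNorm _ _).trans (by gcongr; exact norm_fderiv_mol_le hη φ x)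

theorem coeFn_adv {η : R3 → ℝ} (hη : IsMollifier η) (φ u : L2V) :
    adv hη φ u =ᵐ[volume] fun x => fderiv ℝ (mol η φ) x (u x) :=
  (hη.memLp_adv φ u).coeFn_toLp

/-- The mollified dissipation operator. -/
noncomputable def dissip {η : R3 → ℝ} (hη : IsMollifier η) {s : ℝ} (hs : 0 ≤ s) : L2V →L[ℝ] L2V :=
  ∑ j, (ContinuousLinearMap.adjoint (fhatL j)).comp ((mulL (hη.memLp_symb_mul_hat hs)).comp (fhatL j))

theorem inner_dissip {η : R3 → ℝ} (hη : IsMollifier η) {s : ℝ} (hs : 0 ≤ s) (u φ : L2V) :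
    inner ℝ (dissip hη hs u) φ =
      ∑ j, inner ℝ (mulL (hη.memLp_symb_mul_hat hs) (fhat u j)) (fhat φ j) := by
  rw [dissip, sum_apply, sum_inner]
  refine Finset.sum_congr rfl fun j _ => ?_
  rw [ContinuousLinearMap.comp_apply, ContinuousLinearMap.adjoint_inner_left]
  rfl

/-- The mollified nonlinearity. -/
noncomputable def nonlin {η : R3 → ℝ} (hη : IsMollifier η) (u : L2V) : L2V :=
  -- The Riesz representative of the bounded functional φ ↦ ⟪u, (u · ∇)(η ⋆ φ)⟫.
  (InnerProductSpace.toDual ℝ L2V).symm ((innerSL ℝ u).comp ((adv hη).flip u))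

theorem inner_nonlin {η : R3 → ℝ} (hη : IsMollifier η) (u φ : L2V) :
    inner ℝ (nonlin hη u) φ = ∫ x, inner ℝ (fderiv ℝ (mol η φ) x (u x)) (u x) := by
  rw [nonlin, InnerProductSpace.toDual_symm_apply, ContinuousLinearMap.comp_apply, innerSL_apply_apply,
    ContinuousLinearMap.flip_apply, real_inner_comm, L2.inner_def]
  refine integral_congr_ae ?_
  filter_upwards [coeFn_adv hη φ u] with x hx
  rw [hx]

theorem continuous_nonlin {η : R3 → ℝ} (hη : IsMollifier η) : Continuous (nonlin hη) := by
  refine (InnerProductSpace.toDual ℝ L2V).symm.continuous.comp ?_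
  exact ((innerSL ℝ).continuous).clm_comp (adv hη).flip.continuous

/-- The time derivative of the mollified solution, up to a gradient. -/
noncomputable def drift {η : R3 → ℝ} (hη : IsMollifier η) {s : ℝ} (hs : 0 ≤ s) (u : L2V) : L2V :=
  nonlin hη u - dissip hη hs u

theorem continuous_drift {η : R3 → ℝ} (hη : IsMollifier η) {s : ℝ} (hs : 0 ≤ s) :
    Continuous (drift hη hs) := (continuous_nonlin hη).sub (dissip hη hs).continuous

theorem exists_norm_drift_le {η : R3 → ℝ} (hη : IsMollifier η) {s : ℝ} (hs : 0 ≤ s) (M : ℝ) :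
    ∃ K : ℝ, ∀ u : L2V, ‖u‖ ≤ M → ‖drift hη hs u‖ ≤ K := by
  refine ⟨M * (‖(adv hη).flip‖ * M) + ‖dissip hη hs‖ * M, fun u hu => ?_⟩
  have hM : 0 ≤ M := (norm_nonneg u).trans hu
  refine (norm_sub_le _ _).trans (add_le_add ?_ ?_)
  · rw [nonlin, LinearIsometryEquiv.norm_map]
    refine (ContinuousLinearMap.opNorm_comp_le _ _).trans ?_
    rw [innerSL_apply_norm]
    gcongr
    exact (ContinuousLinearMap.le_opNorm _ _).trans (by gcongr)
  · exact (ContinuousLinearMap.le_opNorm _ _).trans (by gcongr)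

theorem inner_molL_left {η : R3 → ℝ} (hη : IsMollifier η) (f g : L2V) :
    inner ℝ (molL hη f) g = inner ℝ f (molL hη g) := by
  rw [inner_eq_sum_fhat, inner_eq_sum_fhat]
  refine Finset.sum_congr rfl fun j _ => ?_
  rw [fhat_molL, fhat_molL, L2.inner_def, L2.inner_def]
  refine integral_congr_ae ?_
  filter_upwards [coeFn_mulL hη.memLp_hat (fhat f j), coeFn_mulL hη.memLp_hat (fhat g j)] with ξ h1 h2
  rw [h1, h2]
  simp only [Complex.inner, map_mul, Complex.conj_ofReal]
  congr 1
  ring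

/-! ### Test fields -/

theorem contDiff_curlField {Φ : R3 → ℝ} (hΦ : ContDiff ℝ ∞ Φ) (i j : Fin 3) :
    ContDiff ℝ ∞ (curlField Φ i j) := by
  have h : ContDiff ℝ ∞ (fderiv ℝ Φ) := hΦ.fderiv_right (by norm_cast)
  exact ((h.clm_apply contDiff_const).smul contDiff_const).sub
    ((h.clm_apply contDiff_const).smul contDiff_const)

theorem hasCompactSupport_curlField {Φ : R3 → ℝ} (hc : HasCompactSupport Φ) (i j : Fin 3) :
    HasCompactSupport (curlField Φ i j) :=
  ((hc.fderiv_apply ℝ (e j)).smul_right).sub ((hc.fderiv_apply ℝ (e i)).smul_right)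

theorem memLp_curlField {Φ : R3 → ℝ} (hΦ : ContDiff ℝ ∞ Φ) (hc : HasCompactSupport Φ) (i j : Fin 3) :
    MemLp (curlField Φ i j) 2 volume :=
  (contDiff_curlField hΦ i j).continuous.memLp_of_hasCompactSupport (hasCompactSupport_curlField hc i j)

/-- The set of the fields `curlField Φ i j` in `L²`. -/
def curls : Set L2V :=
  {f | ∃ (Φ : R3 → ℝ) (i j : Fin 3), ContDiff ℝ ∞ Φ ∧ HasCompactSupport Φ ∧
    f =ᵐ[volume] curlField Φ i j}

theorem mem_orthogonal_curls {X : L2V} (h : ∀ c ∈ curls, inner ℝ X c = 0) (Φ : R3 → ℝ)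
    (hΦ : ContDiff ℝ ∞ Φ) (hc : HasCompactSupport Φ) (i j : Fin 3) :
    ∫ x, inner ℝ (X x) (curlField Φ i j x) = 0 := by
  have hm := memLp_curlField hΦ hc i j
  rw [← h hm.toLp ⟨Φ, i, j, hΦ, hc, hm.coeFn_toLp⟩, L2.inner_def]
  refine integral_congr_ae ?_
  filter_upwards [hm.coeFn_toLp] with x hx
  rw [hx]

theorem IsMollifier.mol_curlField {η : R3 → ℝ} (hη : IsMollifier η) {Φ : R3 → ℝ}
    (hΦ : ContDiff ℝ ∞ Φ) (i j : Fin 3) (x : R3) :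
    mol η (curlField Φ i j) x = curlField (mol η Φ) i j x := by
  have h1 : ContDiff ℝ 1 Φ := hΦ.of_le (by norm_cast)
  have hl : LocallyIntegrable Φ volume := hΦ.continuous.locallyIntegrable
  have h2 : ∀ k, fderiv ℝ (mol η Φ) x (e k) = mol η (fun x => fderiv ℝ Φ x (e k)) x := fun k =>
    (hasWeakDeriv_of_contDiff h1 k).fderiv_mol hη hl x
  have hc : ∀ k, Continuous fun x => fderiv ℝ Φ x (e k) := fun k =>
    (hΦ.continuous_fderiv (by norm_num)).clm_apply continuous_const
  have h3 : ∀ k l, mol η (fun x => fderiv ℝ Φ x (e k) • e l) x =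
      mol η (fun x => fderiv ℝ Φ x (e k)) x • e l := by
    intro k l
    exact (hη.clm_mol (hc k).locallyIntegrable ((1 : ℝ →L[ℝ] ℝ).smulRight (e l)) x).symm
  have h4 : curlField Φ i j = fun x => fderiv ℝ Φ x (e j) • e i - fderiv ℝ Φ x (e i) • e j := rfl
  have ci : ∀ k l, Continuous fun x => fderiv ℝ Φ x (e k) • e l := fun k l =>
    (hc k).smul continuous_const
  rw [h4, hη.mol_sub (ci j i).locallyIntegrable (ci i j).locallyIntegrable, h3, h3, curlField, h2, h2]

/-- The two terms of the divergence are mixed second derivatives of Φ in opposite orders. -/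
theorem sum_fderiv_curlField {Φ : R3 → ℝ} (hΦ : ContDiff ℝ ∞ Φ) (i j : Fin 3) (x : R3) :
    ∑ k, (fderiv ℝ (curlField Φ i j) x (e k)) k = 0 := by
  have h : ContDiff ℝ ∞ (fderiv ℝ Φ) := hΦ.fderiv_right (by norm_cast)
  have hd : ∀ k, DifferentiableAt ℝ (fun x => fderiv ℝ Φ x (e k)) x := fun k =>
    (h.clm_apply contDiff_const).differentiable (by norm_num) x
  have hdd : ∀ k v, fderiv ℝ (fun x => fderiv ℝ Φ x (e k)) x v = fderiv ℝ (fderiv ℝ Φ) x v (e k) := by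
    intro k v
    rw [fderiv_clm_apply (h.differentiable (by norm_num) x) (differentiableAt_const _)]
    simp
  have h1 : ∀ v, fderiv ℝ (curlField Φ i j) x v =
      fderiv ℝ (fderiv ℝ Φ) x v (e j) • e i - fderiv ℝ (fderiv ℝ Φ) x v (e i) • e j := by
    intro v
    have : curlField Φ i j = fun x => fderiv ℝ Φ x (e j) • e i - fderiv ℝ Φ x (e i) • e j := rfl
    rw [this, fderiv_fun_sub ((hd j).smul_const _) ((hd i).smul_const _),
      fderiv_smul_const (hd j), fderiv_smul_const (hd i)]
    simp [hdd]
  have hsymm : IsSymmSndFDerivAt ℝ Φ x := hΦ.contDiffAt.isSymmSndFDerivAt (by simp; norm_cast)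
  have hcoord : ∀ k l : Fin 3, (e l) k = if k = l then 1 else 0 := by
    intro k l; simp [e]
  simp only [h1, PiLp.sub_apply, PiLp.smul_apply, hcoord, smul_eq_mul, mul_ite, mul_one, mul_zero,
    Finset.sum_sub_distrib, Finset.sum_ite_eq', Finset.mem_univ, if_true]
  rw [hsymm.eq (e i) (e j), sub_self]


/-! ### Calculus in time -/

theorem isOpen_openTime (T : ℝ≥0∞) : IsOpen (openTime T) :=
  isOpen_Ioi.inter (isOpen_Iio.preimage ENNReal.continuous_ofReal)

theorem Ioc_subset_openTime {T : ℝ≥0∞} {t : ℝ} (ht : t ∈ halfTime T) : Ioc 0 t ⊆ openTime T :=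
  fun _ hs => ⟨hs.1, (ENNReal.ofReal_le_ofReal hs.2).trans_lt ht.2⟩

theorem openTime_subset_halfTime (T : ℝ≥0∞) : openTime T ⊆ halfTime T := fun _ h => ⟨h.1.le, h.2⟩

theorem exists_lt_mem_openTime {T : ℝ≥0∞} {t : ℝ} (ht : t ∈ halfTime T) : ∃ b ∈ openTime T, t < b := by
  obtain ⟨c, hc1, hc2⟩ := exists_between ht.2
  have hct : c ≠ ⊤ := (hc2.trans_le le_top).ne
  have h : t < c.toReal := by
    rwa [← ENNReal.ofReal_toReal hct, ENNReal.ofReal_lt_ofReal_iff_of_nonneg ht.1] at hc1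
  exact ⟨c.toReal, ⟨ht.1.trans_lt h, by rwa [ENNReal.ofReal_toReal hct]⟩, h⟩

section
variable {E F G : Type*} [NormedAddCommGroup E] [NormedSpace ℝ E] [CompleteSpace E]
  [NormedAddCommGroup F] [NormedSpace ℝ F] [CompleteSpace F] [NormedAddCommGroup G] [NormedSpace ℝ G] [CompleteSpace G]

/-- Fubini's theorem on the triangle t ≤ s. It takes the place of integration by parts for functions
that are merely integrable. -/
theorem integral_bilin_swap {μ : Measure ℝ} [SFinite μ] (B : E →L[ℝ] F →L[ℝ] G) {f : ℝ → E}
    {g : ℝ → F} (hf : Integrable f μ) (hg : Integrable g μ) :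
    ∫ s, B (f s) (∫ t in Iic s, g t ∂μ) ∂μ = ∫ t, B (∫ s in Ici t, f s ∂μ) (g t) ∂μ := by
  have hF : Integrable ({p : ℝ × ℝ | p.2 ≤ p.1}.indicator fun p => B (f p.1) (g p.2)) (μ.prod μ) := by
    refine Integrable.indicator ?_ (measurableSet_le measurable_snd measurable_fst)
    exact hf.op_fst_snd (op := fun x y => B x y) B.continuous₂
      ⟨‖B‖, fun x y => B.le_opNorm₂ x y⟩ hg
  have h := integral_integral_swap (f := fun s t => {p : ℝ × ℝ | p.2 ≤ p.1}.indicator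
    (fun p => B (f p.1) (g p.2)) (s, t)) hF
  have h1 : ∀ s, ∫ t, {p : ℝ × ℝ | p.2 ≤ p.1}.indicator (fun p => B (f p.1) (g p.2)) (s, t) ∂μ =
      B (f s) (∫ t in Iic s, g t ∂μ) := by
    intro s
    rw [← (B (f s)).integral_comp_comm hg.integrableOn, ← integral_indicator measurableSet_Iic]
    rfl
  have h2 : ∀ t, ∫ s, {p : ℝ × ℝ | p.2 ≤ p.1}.indicator (fun p => B (f p.1) (g p.2)) (s, t) ∂μ =
      B (∫ s in Ici t, f s ∂μ) (g t) := by
    intro t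
    have := (B.flip (g t)).integral_comp_comm hf.integrableOn (μ := μ.restrict (Ici t))
    rw [← B.flip_apply, ← this, ← integral_indicator measurableSet_Ici]
    rfl
  simp only [h1, h2] at h
  exact h

/-- Vector-valued functions with an integrable weak derivative are primitives. -/
theorem ae_eq_add_setIntegral {T : ℝ≥0∞} {w g : ℝ → E} {w₀ : E}
    (hw : ∀ b ∈ openTime T, IntegrableOn w (Ioc 0 b)) (hg : ∀ b ∈ openTime T, IntegrableOn g (Ioc 0 b))
    (h : ∀ χ : ℝ → ℝ, ContDiff ℝ ∞ χ → HasCompactSupport χ →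
      tsupport χ ⊆ {t | ENNReal.ofReal t < T} →
      (∫ t in openTime T, (deriv χ t • w t + χ t • g t)) + χ 0 • w₀ = 0) :
    ∀ᵐ t ∂(volume.restrict (openTime T)), w t = w₀ + ∫ τ in Ioc 0 t, g τ := by
  have hcont : ContinuousOn (fun t => ∫ τ in Ioc 0 t, g τ) (openTime T) := by
    intro t ht
    obtain ⟨b, hb, htb⟩ := exists_lt_mem_openTime (openTime_subset_halfTime T ht)
    have h1 := intervalIntegral.continuousOn_primitive ((integrableOn_Icc_iff_integrableOn_Ioc (by simp)).2 (hg b hb))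
    exact (h1.continuousAt (Icc_mem_nhds ht.1 htb)).continuousWithinAt
  have key := (isOpen_openTime T).ae_eq_zero_of_integral_contDiff_smul_eq_zero (μ := volume)
    (f := fun t => w t - (w₀ + ∫ τ in Ioc 0 t, g τ)) ?_ ?_
  · rw [ae_restrict_iff' (isOpen_openTime T).measurableSet]
    filter_upwards [key] with t ht1 ht2
    exact sub_eq_zero.1 (ht1 ht2)
  · refine LocallyIntegrableOn.sub ?_ ((continuousOn_const.add hcont).locallyIntegrableOn
      (isOpen_openTime T).measurableSet)
    intro t ht
    obtain ⟨b, hb, htb⟩ := exists_lt_mem_openTime (openTime_subset_halfTime T ht)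
    exact ⟨Ioc 0 b, mem_nhdsWithin_of_mem_nhds (Ioc_mem_nhds ht.1 htb), hw b hb⟩
  intro k hk hkc hks
  by_cases hne : (tsupport k).Nonempty
  swap
  · rw [not_nonempty_iff_eq_empty, tsupport_eq_empty_iff] at hne
    simp [hne]
  obtain ⟨b, hbk, hb⟩ := hkc.isCompact.exists_isGreatest hne
  have hbT : b ∈ openTime T := hks hbk
  have hk0 : ∀ t, t ∉ Ioc 0 b → k t = 0 := by
    intro t ht
    by_contra hkt
    have hts := subset_tsupport k hkt
    exact ht ⟨(hks hts).1, hb hts⟩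
  -- The primitive of the given test function k that vanishes to the right of its support.
  set K : ℝ → ℝ := fun t => ∫ s in b..t, k s with hK
  have hKd : ∀ t, HasDerivAt K (k t) t := fun t =>
    intervalIntegral.integral_hasDerivAt_right (hk.continuous.intervalIntegrable _ _)
      (hk.continuous.stronglyMeasurableAtFilter _ _) hk.continuous.continuousAt
  have hKs : ContDiff ℝ ∞ K := by
    rw [contDiff_infty_iff_deriv]
    refine ⟨fun t => (hKd t).differentiableAt, ?_⟩
    rwa [funext fun t => (hKd t).deriv]
  have hKb : ∀ t, b ≤ t → K t = 0 := by
    intro t ht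
    refine intervalIntegral.integral_zero_ae (ae_of_all _ fun s hs => hk0 s fun hs' => ?_)
    rw [uIoc_of_le ht] at hs
    exact absurd hs.1 (not_lt.2 hs'.2)
  -- K need not vanish to the left of the support of k. The transition factor cuts it off on [-1, 0]
  -- and changes nothing for t ≥ 0, so χ 0 = -∫ k is what brings the initial value into the
  -- identity.
  set χ : ℝ → ℝ := fun t => Real.smoothTransition (t + 1) * K t with hχ
  have hχK : ∀ t, 0 ≤ t → χ t = K t := by
    intro t ht
    rw [hχ]
    simp only
    rw [Real.smoothTransition.one_of_one_le (by linarith), one_mul]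
  have hsupp : tsupport χ ⊆ Icc (-1) b := by
    refine closure_minimal (fun t ht => ?_) isClosed_Icc
    by_contra hcon
    refine ht ?_
    rw [mem_Icc, not_and_or, not_le, not_le] at hcon
    simp only [hχ]
    rcases hcon with hcon | hcon
    · rw [Real.smoothTransition.zero_of_nonpos (by linarith), zero_mul]
    · rw [hKb t hcon.le, mul_zero]
  have hχd : ∀ t, 0 < t → deriv χ t = k t := by
    intro t ht
    have : χ =ᶠ[𝓝 t] K := by
      filter_upwards [lt_mem_nhds ht] with s hs using hχK s hs.le
    rw [this.deriv_eq, (hKd t).deriv]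
  have hχs : ContDiff ℝ ∞ χ :=
    (Real.smoothTransition.contDiff.comp (contDiff_id.add contDiff_const)).mul hKs
  have h1 := h χ hχs (HasCompactSupport.of_support_subset_isCompact isCompact_Icc
    ((subset_tsupport χ).trans hsupp)) (hsupp.trans fun t ht =>
      (ENNReal.ofReal_le_ofReal ht.2).trans_lt hbT.2)
  have hsub := Ioc_subset_openTime (openTime_subset_halfTime T hbT)
  have h2 : ∫ t in openTime T, (deriv χ t • w t + χ t • g t) =
      ∫ t in Ioc 0 b, (k t • w t + K t • g t) := by
    rw [setIntegral_eq_of_subset_of_forall_sdiff_eq_zero (isOpen_openTime T).measurableSet hsub]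
    · refine setIntegral_congr_fun measurableSet_Ioc fun t ht => ?_
      show deriv χ t • w t + χ t • g t = _
      rw [hχd t ht.1, hχK t ht.1.le]
    · intro t ht
      have hbt : b ≤ t := by
        by_contra hcon
        exact ht.2 ⟨ht.1.1, (not_le.1 hcon).le⟩
      rw [hχd t ht.1.1, hχK t ht.1.1.le, hKb t hbt, hk0 t ht.2]
      simp
  have hki : Integrable k (volume.restrict (Ioc 0 b)) :=
    (hk.continuous.integrable_of_hasCompactSupport hkc).restrict
  have hKi : ∀ t ∈ Ioc 0 b, K t = -∫ s in Ici t, k s ∂(volume.restrict (Ioc 0 b)) := by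
    intro t ht
    have : Ici t ∩ Ioc 0 b = Icc t b := by
      ext s
      simp only [mem_inter_iff, mem_Ici, mem_Ioc, mem_Icc]
      constructor
      · rintro ⟨h1, h2, h3⟩; exact ⟨h1, h3⟩
      · rintro ⟨h1, h2⟩; exact ⟨h1, ht.1.trans_le h1, h2⟩
    rw [Measure.restrict_restrict measurableSet_Ici, this, integral_Icc_eq_integral_Ioc,
      ← intervalIntegral.integral_of_le ht.2, hK]
    simp only
    rw [intervalIntegral.integral_symm]
  have h3 := integral_bilin_swap (ContinuousLinearMap.lsmul ℝ ℝ : ℝ →L[ℝ] E →L[ℝ] E) hki (hg b hbT)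
  simp only [ContinuousLinearMap.lsmul_apply] at h3
  have hgI : ∀ t ∈ Ioc 0 b, ∫ τ in Iic t, g τ ∂(volume.restrict (Ioc 0 b)) = ∫ τ in Ioc 0 t, g τ := by
    intro t ht
    have : Iic t ∩ Ioc 0 b = Ioc 0 t := by
      ext s
      simp only [mem_inter_iff, mem_Iic, mem_Ioc]
      constructor
      · rintro ⟨h1, h2, h3⟩; exact ⟨h2, h1⟩
      · rintro ⟨h1, h2⟩; exact ⟨h2, h1, h2.trans ht.2⟩
    rw [Measure.restrict_restrict measurableSet_Iic, this]
  have h4 : ∫ t in Ioc 0 b, K t • g t = -∫ t in Ioc 0 b, k t • ∫ τ in Ioc 0 t, g τ := by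
    have h6 : ∫ t in Ioc 0 b, k t • ∫ τ in Iic t, g τ ∂(volume.restrict (Ioc 0 b)) =
        ∫ t in Ioc 0 b, k t • ∫ τ in Ioc 0 t, g τ :=
      setIntegral_congr_fun measurableSet_Ioc fun t ht => by simp only [hgI t ht]
    rw [← h6, h3, ← integral_neg]
    refine setIntegral_congr_fun measurableSet_Ioc fun t ht => ?_
    show K t • g t = _
    rw [hKi t ht, neg_smul]
  have h5 : χ 0 = -∫ t in Ioc 0 b, k t := by
    rw [hχK 0 le_rfl, hK]
    simp only
    rw [intervalIntegral.integral_symm, intervalIntegral.integral_of_le hbT.1.le]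
  obtain ⟨Ck, hCk⟩ := hk.continuous.bounded_above_of_compact_support hkc
  have i1 : IntegrableOn (fun t => k t • w t) (Ioc 0 b) :=
    (hw b hbT).bdd_smul Ck hk.continuous.aestronglyMeasurable (ae_of_all _ hCk)
  obtain ⟨CK, hCK⟩ := isCompact_Icc.exists_bound_of_continuousOn (s := Icc 0 b) hKs.continuous.continuousOn
  have i2 : IntegrableOn (fun t => K t • g t) (Ioc 0 b) :=
    (hg b hbT).bdd_smul CK hKs.continuous.aestronglyMeasurable
      ((ae_restrict_iff' measurableSet_Ioc).2 (ae_of_all _ fun t ht => hCK t (Ioc_subset_Icc_self ht)))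
  have hcb : ContinuousOn (fun t => ∫ τ in Ioc 0 t, g τ) (Icc 0 b) :=
    intervalIntegral.continuousOn_primitive ((integrableOn_Icc_iff_integrableOn_Ioc (by simp)).2 (hg b hbT))
  have i3 : IntegrableOn (fun t => k t • ∫ τ in Ioc 0 t, g τ) (Ioc 0 b) :=
    ((hk.continuous.continuousOn.smul hcb).integrableOn_Icc).mono_set Ioc_subset_Icc_self
  have i4 : IntegrableOn (fun t => k t • w₀) (Ioc 0 b) := hki.smul_const w₀
  rw [h2, integral_add i1 i2, h4, h5, neg_smul, ← integral_smul_const] at h1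
  rw [← setIntegral_eq_integral_of_forall_compl_eq_zero (s := Ioc 0 b)
    (fun t ht => by rw [hk0 t ht, zero_smul])]
  simp only [smul_sub, smul_add]
  have e1 := integral_sub i1 (i4.add i3)
  simp only [Pi.add_apply] at e1
  rw [e1, integral_add i4 i3, ← h1]
  abel

end

/-- The square of the integral is a double integral over (0, b]², and by symmetry twice the one over
a triangle. -/
theorem norm_setIntegral_sq {H : Type*} [NormedAddCommGroup H] [InnerProductSpace ℝ H]
    [CompleteSpace H] {g : ℝ → H} {b : ℝ} (hg : IntegrableOn g (Ioc 0 b)) :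
    ‖∫ t in Ioc 0 b, g t‖ ^ 2 = 2 * ∫ t in Ioc 0 b, inner ℝ (g t) (∫ τ in Ioc 0 t, g τ) := by
  have h : ∫ s in Ioc 0 b, inner ℝ (g s) (∫ t in Iic s, g t ∂(volume.restrict (Ioc 0 b))) =
      ∫ t in Ioc 0 b, inner ℝ (∫ s in Ici t, g s ∂(volume.restrict (Ioc 0 b))) (g t) :=
    integral_bilin_swap (innerSL ℝ : H →L[ℝ] H →L[ℝ] ℝ) hg hg
  have hA : ∀ t ∈ Ioc 0 b, ∫ τ in Iic t, g τ ∂(volume.restrict (Ioc 0 b)) = ∫ τ in Ioc 0 t, g τ := by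
    intro t ht
    have : Iic t ∩ Ioc 0 b = Ioc 0 t := by
      ext s
      simp only [mem_inter_iff, mem_Iic, mem_Ioc]
      constructor
      · rintro ⟨h1, h2, h3⟩; exact ⟨h2, h1⟩
      · rintro ⟨h1, h2⟩; exact ⟨h2, h1, h2.trans ht.2⟩
    rw [Measure.restrict_restrict measurableSet_Iic, this]
  have hB : ∀ t ∈ Ioc 0 b, ∫ τ in Ici t, g τ ∂(volume.restrict (Ioc 0 b)) =
      (∫ τ in Ioc 0 b, g τ) - ∫ τ in Ioc 0 t, g τ := by
    intro t ht
    rw [← hA t ht, eq_sub_iff_add_eq', integral_Iic_eq_integral_Iio, ← compl_Ici]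
    rw [add_comm]
    exact integral_add_compl measurableSet_Ici hg
  have hc : ContinuousOn (fun t => ∫ τ in Ioc 0 t, g τ) (Icc 0 b) :=
    intervalIntegral.continuousOn_primitive ((integrableOn_Icc_iff_integrableOn_Ioc (by simp)).2 hg)
  obtain ⟨C, hC⟩ := isCompact_Icc.exists_bound_of_continuousOn hc
  have i1 : IntegrableOn (fun t => inner ℝ (g t) (∫ τ in Ioc 0 t, g τ)) (Ioc 0 b) := by
    refine Integrable.mono' (hg.norm.mul_const C)
      (hg.1.inner ((hc.mono Ioc_subset_Icc_self).aestronglyMeasurable measurableSet_Ioc))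
      ((ae_restrict_iff' measurableSet_Ioc).2 (ae_of_all _ fun t ht => ?_))
    exact (norm_inner_le_norm _ _).trans (by gcongr; exact hC t (Ioc_subset_Icc_self ht))
  have i2 : IntegrableOn (fun t => inner ℝ (∫ τ in Ioc 0 b, g τ) (g t)) (Ioc 0 b) := hg.const_inner _
  have h1 : ∫ t in Ioc 0 b, inner ℝ (g t) (∫ τ in Iic t, g τ ∂(volume.restrict (Ioc 0 b))) =
      ∫ t in Ioc 0 b, inner ℝ (g t) (∫ τ in Ioc 0 t, g τ) :=
    setIntegral_congr_fun measurableSet_Ioc fun t ht => by simp only [hA t ht]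
  have h2 : ∫ t in Ioc 0 b, inner ℝ (∫ s in Ici t, g s ∂(volume.restrict (Ioc 0 b))) (g t) =
      ∫ t in Ioc 0 b, (inner ℝ (∫ τ in Ioc 0 b, g τ) (g t) - inner ℝ (g t) (∫ τ in Ioc 0 t, g τ)) :=
    setIntegral_congr_fun measurableSet_Ioc fun t ht => by
      simp only [hB t ht, inner_sub_left]
      rw [real_inner_comm (g t) (∫ τ in Ioc 0 t, g τ)]
  rw [h1, h2, integral_sub i2 i1, integral_inner hg, real_inner_self_eq_norm_sq] at h
  linarith


/-! ### The projection onto solenoidal fields -/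

/-- The closed span of the curls. -/
noncomputable def solenoidal : Submodule ℝ L2V := (Submodule.span ℝ curls)ᗮᗮ

instance : CompleteSpace solenoidal :=
  (Submodule.isClosed_orthogonal (Submodule.span ℝ curls)ᗮ).completeSpace_coe

instance : solenoidal.HasOrthogonalProjection := Submodule.HasOrthogonalProjection.ofCompleteSpace _

/-- The orthogonal projection onto the closed span of the curls. -/
noncomputable def leray : L2V →L[ℝ] L2V := solenoidal.starProjection

theorem mem_orthogonal_span_curls {X : L2V} (h : ∀ c ∈ curls, inner ℝ X c = 0) :
    X ∈ (Submodule.span ℝ curls)ᗮ := by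
  rw [Submodule.mem_orthogonal']
  intro c hc
  induction hc using Submodule.span_induction with
  | mem c hc => exact h c hc
  | zero => exact inner_zero_right _
  | add x y _ _ hx hy => rw [inner_add_right, hx, hy, add_zero]
  | smul a x _ hx => rw [inner_smul_right, hx, mul_zero]

theorem leray_eq_zero {X : L2V} (h : ∀ c ∈ curls, inner ℝ X c = 0) : leray X = 0 := by
  rw [leray, Submodule.starProjection_apply_eq_zero_iff]
  exact Submodule.le_orthogonal_orthogonal _ (mem_orthogonal_span_curls h)

/-- Every X orthogonal to the curls is orthogonal to Y by `inner_eq_zero_of_curl`, so Y lies in the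
double orthogonal complement. -/
theorem leray_eq_self {Y : L2V} (hY : ∀ᵐ ξ : R3, ∑ i, (ξ i : ℂ) * fhat Y i ξ = 0) : leray Y = Y := by
  rw [leray, Submodule.starProjection_eq_self_iff, solenoidal, Submodule.mem_orthogonal]
  intro X hX
  refine inner_eq_zero_of_curl (mem_orthogonal_curls fun c hc => ?_) hY
  exact (Submodule.mem_orthogonal' _ _).1 hX c (Submodule.subset_span hc)

theorem inner_leray_left (X Y : L2V) : inner ℝ (leray X) Y = inner ℝ X (leray Y) :=
  Submodule.inner_starProjection_left_eq_right _ X Y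

/-- Mollification multiplies all components of the transform by the same scalar and so preserves
orthogonality to ξ. -/
theorem IsDivFree.leray_molL {η : R3 → ℝ} (hη : IsMollifier η) {u : L2V} (hu : IsDivFree u) :
    leray (molL hη u) = molL hη u := by
  refine leray_eq_self ?_
  have h : ∀ᵐ ξ : R3, ∀ i, fhat (molL hη u) i ξ = (hat η ξ : ℂ) * fhat u i ξ :=
    ae_all_iff.2 fun i => by rw [fhat_molL]; exact coeFn_mulL hη.memLp_hat (fhat u i)
  filter_upwards [h, hu.sum_coord_mul_fhat] with ξ h1 h2
  simp only [h1]
  rw [← mul_zero (hat η ξ : ℂ), ← h2, Finset.mul_sum]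
  exact Finset.sum_congr rfl fun i _ => by ring

/-! ### The weak formulation tested with mollified curls -/

theorem pairFrac_mol {η : R3 → ℝ} (hη : IsMollifier η) {s : ℝ} (hs : 0 ≤ s) {Ψ : R3 → R3}
    (hΨ : ContDiff ℝ ∞ Ψ) (hc : HasCompactSupport Ψ) {c : L2V} (hcΨ : c =ᵐ[volume] Ψ) (u : L2V) :
    pairFrac s u (mol η Ψ) = inner ℝ (dissip hη hs u) c := by
  rw [inner_dissip, pairFrac]
  refine Finset.sum_congr rfl fun j _ => ?_
  have h1 : ContDiff ℝ ∞ fun y => Ψ y j := (EuclideanSpace.proj (𝕜 := ℝ) j).contDiff.comp hΨ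
  have h2 : HasCompactSupport fun y => Ψ y j := hc.comp_left (g := fun v : R3 => v j) rfl
  have h3 : (fun y => ((mol η Ψ y j : ℝ) : ℂ)) = fun y => ((mol η (fun y => Ψ y j) y : ℝ) : ℂ) := by
    ext y
    exact congrArg _ (hη.clm_mol hΨ.continuous.locallyIntegrable (EuclideanSpace.proj (𝕜 := ℝ) j) y)
  have h4 : (toSchwartz h1 h2).toLp 2 volume = cpx c j := by
    refine Lp.ext ?_
    filter_upwards [(toSchwartz h1 h2).coeFn_toLp 2 volume, coeFn_cpx c, hcΨ] with x a1 a2 a3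
    rw [a1, a2, a3, toSchwartz_apply]
  rw [h3, hη.integral_mul_frac_mol hs h1 h2, h4, fhat_eq c]

theorem IsMollifier.hasCompactSupport_mol {E : Type*} [NormedAddCommGroup E] [NormedSpace ℝ E]
    {η : R3 → ℝ} (hη : IsMollifier η) {f : R3 → E} (hf : HasCompactSupport f) :
    HasCompactSupport (mol η f) := hη.compact.convolution _ hf

/-- A mollified curl is the curl of the mollified potential, hence again divergence-free, smooth and
compactly supported. -/
theorem isTestField_mol_curlField {η : R3 → ℝ} (hη : IsMollifier η) {T : ℝ≥0∞} {χ : ℝ → ℝ}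
    (hχ : ContDiff ℝ ∞ χ) (hχc : HasCompactSupport χ) (hχT : tsupport χ ⊆ {t | ENNReal.ofReal t < T})
    {Φ : R3 → ℝ} (hΦ : ContDiff ℝ ∞ Φ) (hc : HasCompactSupport Φ) (i j : Fin 3) :
    IsTestField T fun t x => χ t • mol η (curlField Φ i j) x := by
  have hK := contDiff_curlField hΦ i j
  have hKc := hη.hasCompactSupport_mol (hasCompactSupport_curlField hc i j)
  have hm : ContDiff ℝ ∞ (mol η (curlField Φ i j)) := hη.contDiff_mol hK.continuous.locallyIntegrable
  have hs : tsupport (fun z : ℝ × R3 => χ z.1 • mol η (curlField Φ i j) z.2) ⊆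
      tsupport χ ×ˢ tsupport (mol η (curlField Φ i j)) := by
    refine closure_minimal (fun z hz => ⟨subset_tsupport _ fun h => hz ?_, subset_tsupport _ fun h => hz ?_⟩)
      ((isClosed_tsupport _).prod (isClosed_tsupport _))
    · simp only [h, zero_smul]
    · simp only [h, smul_zero]
  refine ⟨(hχ.comp contDiff_fst).smul (hm.comp contDiff_snd),
    (hχc.isCompact.prod hKc.isCompact).of_isClosed_subset (isClosed_tsupport _) hs,
    fun z hz => hχT (hs hz).1, fun t x => ?_⟩
  have h1 : mol η (curlField Φ i j) = curlField (mol η Φ) i j := funext (hη.mol_curlField hΦ i j)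
  rw [fderiv_fun_const_smul (hm.differentiable (by norm_num) x)]
  simp only [smul_apply, PiLp.smul_apply, ← Finset.smul_sum]
  rw [h1, sum_fderiv_curlField (hη.contDiff_mol hΦ.continuous.locallyIntegrable), smul_zero]

/-- Moving the mollification from the test field to the solution turns the weak form into a linear
functional of c, represented by an L² field. -/
theorem weakIntegrand_mol_curlField {η : R3 → ℝ} (hη : IsMollifier η) {α : ℝ} (hα : 0 ≤ 2 * α)
    (u : ℝ → L2V) {χ : ℝ → ℝ} (hχ : Differentiable ℝ χ) {K : R3 → R3} (hK : ContDiff ℝ ∞ K)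
    (hKc : HasCompactSupport K) {c : L2V} (hcK : c =ᵐ[volume] K) (t : ℝ) :
    weakIntegrand α u (fun t x => χ t • mol η K x) t =
      inner ℝ (deriv χ t • molL hη (u t) + χ t • drift hη hα (u t)) c := by
  have hmc : mol η K = mol η c := (mol_congr_ae η hcK).symm
  have h1 : ∫ x, inner ℝ (deriv (fun τ => χ τ • mol η K x) t) (u t x) =
      deriv χ t * inner ℝ (molL hη (u t)) c := by
    simp_rw [deriv_smul_const (hχ t), real_inner_smul_left]
    rw [integral_const_mul, inner_molL_left, real_inner_comm, L2.inner_def]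
    congr 1
    refine integral_congr_ae ?_
    filter_upwards [coeFn_molL hη c] with x hx
    rw [hx, hmc]
  have h2 : ∫ x, inner ℝ (fderiv ℝ (fun x => χ t • mol η K x) x (u t x)) (u t x) =
      χ t * inner ℝ (nonlin hη (u t)) c := by
    rw [inner_nonlin, ← integral_const_mul]
    refine integral_congr_ae (ae_of_all _ fun x => ?_)
    simp only
    rw [hmc, fderiv_fun_const_smul ((hη.contDiff_mol_L2 c).differentiable (by norm_num) x), smul_apply,
      real_inner_smul_left]
  have h3 : pairFrac (2 * α) (u t) (fun x => χ t • mol η K x) =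
      χ t * inner ℝ (dissip hη hα (u t)) c := by
    have e1 : (fun x => χ t • mol η K x) = mol η (fun x => χ t • K x) := by
      ext1 x
      simp only [mol_apply, smul_comm _ (χ t)]
      exact (integral_smul _ _).symm
    have e2 : (χ t • c : L2V) =ᵐ[volume] fun x => χ t • K x := by
      filter_upwards [Lp.coeFn_smul (χ t) c, hcK] with x a1 a2
      rw [a1, Pi.smul_apply, a2]
    have e3 : ContDiff ℝ ∞ fun x => χ t • K x := (contDiff_const (c := χ t)).smul hK
    rw [e1, pairFrac_mol hη hα e3 (hKc.smul_left (f := fun _ => χ t)) e2, real_inner_smul_right]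
  rw [weakIntegrand, h1, h2, h3, inner_add_left, real_inner_smul_left, real_inner_smul_left, drift,
    inner_sub_left]
  ring

/-! ### The evolution of the mollified solution -/

/-- The continuous version of the mollified solution. -/
noncomputable def mollified {η : R3 → ℝ} (hη : IsMollifier η) {s : ℝ} (hs : 0 ≤ s) (u₀ : L2V)
    (u : ℝ → L2V) (t : ℝ) : L2V :=
  molL hη u₀ + ∫ τ in Ioc 0 t, leray (drift hη hs (u τ))

section
variable {α : ℝ} {T : ℝ≥0∞} {u₀ : L2V} {u : ℝ → L2V}

theorem IsLerayHopf.exists_norm_le (hu : IsLerayHopf α T u₀ u) :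
    ∃ M : ℝ, ∀ᵐ t ∂(volume.restrict (openTime T)), ‖u t‖ ≤ M := by
  refine ⟨(eLpNorm u ∞ (volume.restrict (openTime T))).toReal, ?_⟩
  have h := ae_le_eLpNormEssSup (f := u) (μ := volume.restrict (openTime T))
  filter_upwards [h] with t ht
  rw [← toReal_enorm]
  refine ENNReal.toReal_mono hu.mem_Linfty_L2.2.ne ?_
  rwa [eLpNorm_exponent_top]

theorem IsLerayHopf.integrableOn_comp {E : Type*} [NormedAddCommGroup E] (hu : IsLerayHopf α T u₀ u)
    {F : L2V → E} (hF : Continuous F) (hFb : ∀ M : ℝ, ∃ K : ℝ, ∀ v, ‖v‖ ≤ M → ‖F v‖ ≤ K)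
    {s : Set ℝ} (hs : s ⊆ openTime T) (hsv : volume s ≠ ⊤) : IntegrableOn (fun t => F (u t)) s := by
  obtain ⟨M, hM⟩ := hu.exists_norm_le
  obtain ⟨K, hK⟩ := hFb M
  have : IsFiniteMeasure (volume.restrict s) := isFiniteMeasure_restrict.2 hsv
  refine Integrable.of_bound (C := K) ?_ ?_
  · exact (hF.comp_aestronglyMeasurable hu.mem_Linfty_L2.1).mono_measure (Measure.restrict_mono_set _ hs)
  · filter_upwards [ae_restrict_of_ae_restrict_of_subset hs hM] with t ht using hK _ ht

theorem IsLerayHopf.integrableOn_molL {η : R3 → ℝ} (hη : IsMollifier η) (hu : IsLerayHopf α T u₀ u)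
    {s : Set ℝ} (hs : s ⊆ openTime T) (hsv : volume s ≠ ⊤) :
    IntegrableOn (fun t => molL hη (u t)) s :=
  hu.integrableOn_comp (molL hη).continuous (fun M => ⟨M, fun _ hv => (norm_molL_le hη _).trans hv⟩) hs hsv

theorem IsLerayHopf.integrableOn_drift {η : R3 → ℝ} (hη : IsMollifier η) (hα : 0 ≤ 2 * α)
    (hu : IsLerayHopf α T u₀ u) {s : Set ℝ} (hs : s ⊆ openTime T) (hsv : volume s ≠ ⊤) :
    IntegrableOn (fun t => drift hη hα (u t)) s :=
  hu.integrableOn_comp (continuous_drift hη hα) (exists_norm_drift_le hη hα) hs hsv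

theorem integrableOn_smul_openTime {E : Type*} [NormedAddCommGroup E] [NormedSpace ℝ E] {k : ℝ → ℝ}
    (hk : Continuous k) (hkc : HasCompactSupport k) {f : ℝ → E}
    (hf : ∀ s ⊆ openTime T, volume s ≠ ⊤ → IntegrableOn f s) :
    IntegrableOn (fun t => k t • f t) (openTime T) := by
  obtain ⟨C, hC⟩ := hk.bounded_above_of_compact_support hkc
  have h1 : IntegrableOn (fun t => k t • f t) (openTime T ∩ tsupport k) :=
    (hf _ inter_subset_left ((measure_mono inter_subset_right).trans_lt
      hkc.isCompact.measure_lt_top).ne).bdd_smul C hk.aestronglyMeasurable (ae_of_all _ hC)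
  refine h1.of_forall_sdiff_eq_zero (isOpen_openTime T).measurableSet fun t ht => ?_
  rw [image_eq_zero_of_notMem_tsupport fun h => ht.2 ⟨ht.1, h⟩, zero_smul]

theorem IsLerayHopf.integrableOn_test {η : R3 → ℝ} (hη : IsMollifier η) (hα : 0 ≤ 2 * α)
    (hu : IsLerayHopf α T u₀ u) {χ : ℝ → ℝ} (hχ : ContDiff ℝ ∞ χ) (hχc : HasCompactSupport χ) :
    IntegrableOn (fun t => deriv χ t • molL hη (u t) + χ t • drift hη hα (u t)) (openTime T) :=
  (integrableOn_smul_openTime (hχ.continuous_deriv (by norm_num)) hχc.deriv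
    fun _ h1 h2 => hu.integrableOn_molL hη h1 h2).add
  (integrableOn_smul_openTime hχ.continuous hχc fun _ h1 h2 => hu.integrableOn_drift hη hα h1 h2)

/-- The weak formulation says that this vector is orthogonal to every curl; it is therefore
annihilated by the projection. -/
theorem IsLerayHopf.leray_test {η : R3 → ℝ} (hη : IsMollifier η) (hα : 0 ≤ 2 * α)
    (hu : IsLerayHopf α T u₀ u) {χ : ℝ → ℝ} (hχ : ContDiff ℝ ∞ χ) (hχc : HasCompactSupport χ)
    (hχT : tsupport χ ⊆ {t | ENNReal.ofReal t < T}) :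
    leray ((∫ t in openTime T, (deriv χ t • molL hη (u t) + χ t • drift hη hα (u t))) +
      χ 0 • molL hη u₀) = 0 := by
  refine leray_eq_zero ?_
  rintro c ⟨Φ, i, j, hΦ, hΦc, hcK⟩
  have h1 := hu.weak_form _ (isTestField_mol_curlField hη hχ hχc hχT hΦ hΦc i j)
  have h2 := fun t => weakIntegrand_mol_curlField hη hα u (hχ.differentiable (by norm_num))
    (contDiff_curlField hΦ i j) (hasCompactSupport_curlField hΦc i j) hcK t
  simp only [h2] at h1
  have h3 : ∫ x, inner ℝ (u₀ x) (χ 0 • mol η (curlField Φ i j) x) =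
      inner ℝ (χ 0 • molL hη u₀) c := by
    rw [real_inner_smul_left, inner_molL_left, L2.inner_def, ← integral_const_mul]
    refine integral_congr_ae ?_
    filter_upwards [coeFn_molL hη c] with x hx
    rw [hx, ← mol_congr_ae η hcK, real_inner_smul_right]
  have h4 := integral_inner (𝕜 := ℝ) (hu.integrableOn_test hη hα hχ hχc) c
  have h5 : ∫ t in openTime T, inner ℝ (deriv χ t • molL hη (u t) + χ t • drift hη hα (u t)) c =
      ∫ t in openTime T, inner ℝ c (deriv χ t • molL hη (u t) + χ t • drift hη hα (u t)) :=
    integral_congr_ae (ae_of_all _ fun t => real_inner_comm _ _)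
  rw [inner_add_left, ← h3, real_inner_comm, ← h4, ← h5, h1, neg_add_cancel]

/-- The projection fixes η ⋆ u and η ⋆ u₀ by incompressibility. Applied to the weak identity it
leaves a distributional differential equation in L² with right side `leray (drift ..)`, which
`ae_eq_add_setIntegral` integrates. -/
theorem IsLerayHopf.molL_ae_eq {η : R3 → ℝ} (hη : IsMollifier η) (hα : 0 ≤ 2 * α)
    (hu : IsLerayHopf α T u₀ u) :
    ∀ᵐ t ∂(volume.restrict (openTime T)), molL hη (u t) = mollified hη hα u₀ u t := by
  have hsub : ∀ b ∈ openTime T, Ioc 0 b ⊆ openTime T := fun b hb =>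
    Ioc_subset_openTime (openTime_subset_halfTime T hb)
  refine ae_eq_add_setIntegral (fun b hb => hu.integrableOn_molL hη (hsub b hb) (by simp))
    (fun b hb => leray.integrable_comp (hu.integrableOn_drift hη hα (hsub b hb) (by simp)))
    fun χ hχ hχc hχT => ?_
  have hX := hu.leray_test hη hα hχ hχc hχT
  rw [map_add, map_smul, hu.div_free_initial.leray_molL hη,
    ← ContinuousLinearMap.integral_comp_comm _ (hu.integrableOn_test hη hα hχ hχc)] at hX
  rw [← hX]
  congr 1
  refine integral_congr_ae ?_
  filter_upwards [hu.div_free] with t ht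
  rw [map_add, map_smul, map_smul, ht.leray_molL hη]

/-- Expand the square of initial value plus primitive and recombine the cross terms into η ⋆ u. The
projection is then moved onto η ⋆ u, which it fixes. -/
theorem IsLerayHopf.norm_mollified_sq {η : R3 → ℝ} (hη : IsMollifier η) (hα : 0 ≤ 2 * α)
    (hu : IsLerayHopf α T u₀ u) {t : ℝ} (ht : t ∈ halfTime T) :
    ‖mollified hη hα u₀ u t‖ ^ 2 = ‖molL hη u₀‖ ^ 2 +
      2 * ∫ τ in Ioc 0 t, inner ℝ (drift hη hα (u τ)) (molL hη (u τ)) := by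
  have hsub := Ioc_subset_openTime ht
  have hg : IntegrableOn (fun τ => leray (drift hη hα (u τ))) (Ioc 0 t) :=
    leray.integrable_comp (hu.integrableOn_drift hη hα hsub (by simp))
  have h1 := norm_setIntegral_sq hg
  have hc : ContinuousOn (fun t => ∫ τ in Ioc 0 t, leray (drift hη hα (u τ))) (Icc 0 t) :=
    intervalIntegral.continuousOn_primitive ((integrableOn_Icc_iff_integrableOn_Ioc (by simp)).2 hg)
  obtain ⟨C, hC⟩ := isCompact_Icc.exists_bound_of_continuousOn hc
  have i1 : IntegrableOn (fun t => inner ℝ (leray (drift hη hα (u t)))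
      (∫ τ in Ioc 0 t, leray (drift hη hα (u τ)))) (Ioc 0 t) := by
    refine Integrable.mono' (hg.norm.mul_const C)
      (hg.1.inner ((hc.mono Ioc_subset_Icc_self).aestronglyMeasurable measurableSet_Ioc))
      ((ae_restrict_iff' measurableSet_Ioc).2 (ae_of_all _ fun t ht => ?_))
    exact (norm_inner_le_norm _ _).trans (by gcongr; exact hC t (Ioc_subset_Icc_self ht))
  have i2 : IntegrableOn (fun t => inner ℝ (molL hη u₀) (leray (drift hη hα (u t)))) (Ioc 0 t) :=
    hg.const_inner _
  have h2 : ∫ τ in Ioc 0 t, inner ℝ (drift hη hα (u τ)) (molL hη (u τ)) =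
      ∫ τ in Ioc 0 t, (inner ℝ (molL hη u₀) (leray (drift hη hα (u τ))) +
        inner ℝ (leray (drift hη hα (u τ))) (∫ τ' in Ioc 0 τ, leray (drift hη hα (u τ')))) := by
    refine integral_congr_ae ?_
    filter_upwards [ae_restrict_of_ae_restrict_of_subset hsub hu.div_free,
      ae_restrict_of_ae_restrict_of_subset hsub (hu.molL_ae_eq hη hα)] with τ a1 a2
    rw [← a1.leray_molL hη, ← inner_leray_left, a2, mollified, inner_add_right,
      real_inner_comm (molL hη u₀)]
  rw [h2, integral_add i2 i1, mollified, norm_add_sq_real, h1, integral_inner hg]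
  ring

end


/-! ### The dissipation -/

theorem symb_two_mul (s : ℝ) (ξ : R3) : symb (2 * s) ξ = symb s ξ ^ 2 := by
  rw [symb, symb, mul_comm 2 s, Real.rpow_mul (by positivity), Real.rpow_ofNat]

theorem inner_dissip_molL {η : R3 → ℝ} (hη : IsMollifier η) {s : ℝ} (hs : 0 ≤ s) (u : L2V) :
    inner ℝ (dissip hη hs u) (molL hη u) =
      ∑ j, ∫ ξ, symb s ξ * hat η ξ ^ 2 * ‖fhat u j ξ‖ ^ 2 := by
  rw [inner_dissip]
  refine Finset.sum_congr rfl fun j _ => ?_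
  rw [fhat_molL, L2.inner_def]
  refine integral_congr_ae ?_
  filter_upwards [coeFn_mulL (hη.memLp_symb_mul_hat hs) (fhat u j), coeFn_mulL hη.memLp_hat (fhat u j)]
    with ξ h1 h2
  rw [h1, h2, ← Complex.real_smul, ← Complex.real_smul, real_inner_smul_left, real_inner_smul_right,
    real_inner_self_eq_norm_sq]
  ring

theorem integrable_symb_sq {α : ℝ} {u : L2V} (h : fracNormSq α u ≠ ⊤) (j : Fin 3) :
    Integrable fun ξ => symb α ξ ^ 2 * ‖fhat u j ξ‖ ^ 2 := by
  have h1 := ENNReal.sum_ne_top.1 h j (Finset.mem_univ j)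
  refine ⟨((measurable_symb α).pow_const 2).aestronglyMeasurable.mul ((Lp.memLp (fhat u j)).1.norm.pow 2),
    ?_⟩
  refine lt_of_le_of_lt (le_of_eq ?_) h1.lt_top
  refine lintegral_congr fun ξ => ?_
  rw [enorm_mul, Real.enorm_of_nonneg (by positivity), enorm_pow, enorm_norm]

theorem toReal_fracNormSq {α : ℝ} {u : L2V} (h : fracNormSq α u ≠ ⊤) :
    (fracNormSq α u).toReal = ∑ j, ∫ ξ, symb α ξ ^ 2 * ‖fhat u j ξ‖ ^ 2 := by
  rw [fracNormSq, ENNReal.toReal_sum (ENNReal.sum_ne_top.1 h)]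
  refine Finset.sum_congr rfl fun j _ => ?_
  rw [integral_eq_lintegral_of_nonneg_ae (ae_of_all _ fun ξ => by positivity)
    (integrable_symb_sq h j).1]
  congr 1
  refine lintegral_congr fun ξ => ?_
  rw [ENNReal.ofReal_mul (by positivity), ENNReal.ofReal_pow (norm_nonneg _), ofReal_norm]

theorem IsMollifier.symb_mul_hat_le {η : R3 → ℝ} (hη : IsMollifier η) (α : ℝ) (u : L2V) (j : Fin 3)
    (ξ : R3) : ‖symb (2 * α) ξ * hat η ξ ^ 2 * ‖fhat u j ξ‖ ^ 2‖ ≤ symb α ξ ^ 2 * ‖fhat u j ξ‖ ^ 2 := by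
  have h1 : hat η ξ ^ 2 ≤ 1 := (sq_le_one_iff_abs_le_one _).2 (hη.abs_hat_le_one ξ)
  rw [symb_two_mul, Real.norm_of_nonneg (by positivity)]
  gcongr
  exact mul_le_of_le_one_right (by positivity) h1

theorem abs_inner_dissip_molL_le {η : R3 → ℝ} (hη : IsMollifier η) {α : ℝ} (hα : 0 ≤ 2 * α) {u : L2V}
    (h : fracNormSq α u ≠ ⊤) :
    |inner ℝ (dissip hη hα u) (molL hη u)| ≤ (fracNormSq α u).toReal := by
  rw [inner_dissip_molL, toReal_fracNormSq h]
  refine (Finset.abs_sum_le_sum_abs _ _).trans (Finset.sum_le_sum fun j _ => ?_)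
  exact norm_integral_le_of_norm_le (integrable_symb_sq h j) (ae_of_all _ (hη.symb_mul_hat_le α u j))

/-- The integrand is |ξ|^{2α} times the squared transforms of the mollifier and of u. Transforms of
mollifiers are at most 1 and converge to 1. -/
theorem tendsto_inner_dissip_molL {α : ℝ} (hα : 0 ≤ 2 * α) {u : L2V} (h : fracNormSq α u ≠ ⊤) :
    Tendsto (fun n => inner ℝ (dissip (isMollifier_ker n) hα u) (molL (isMollifier_ker n) u)) atTop
      (𝓝 (fracNormSq α u).toReal) := by
  simp only [inner_dissip_molL]
  rw [toReal_fracNormSq h]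
  refine tendsto_finsetSum _ fun j _ => ?_
  refine tendsto_integral_of_dominated_convergence _ (fun n => ?_) (integrable_symb_sq h j)
    (fun n => ae_of_all _ ((isMollifier_ker n).symb_mul_hat_le α u j)) (ae_of_all _ fun ξ => ?_)
  · exact (((measurable_symb _).mul
      ((isMollifier_ker n).continuous_hat.measurable.pow_const 2)).aestronglyMeasurable).mul
        ((Lp.memLp (fhat u j)).1.norm.pow 2)
  · have := (((tendsto_hat_ker ξ).pow 2).const_mul (symb (2 * α) ξ)).mul_const (‖fhat u j ξ‖ ^ 2)
    simpa only [one_pow, mul_one, symb_two_mul] using this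

theorem fracNormSq_le {α : ℝ} (hα : 0 ≤ α) (u : L2V) : fracNormSq α u ≤ sobolevNorm α u ^ 2 := by
  rw [sobolevNorm, ← ENNReal.rpow_natCast, ← ENNReal.rpow_mul]
  norm_num
  refine Finset.sum_le_sum fun j _ => lintegral_mono fun ξ => ?_
  gcongr
  rw [← symb_two_mul, symb, Real.rpow_mul (by positivity), Real.rpow_ofNat]
  gcongr
  exact le_add_of_nonneg_left zero_le_one

/-! ### Extended-valued functions in `Lᵖ` -/

theorem memLp_toReal {X : Type*} [MeasurableSpace X] {μ : Measure X} {p : ℝ≥0∞} {f : X → ℝ≥0∞}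
    (hf : MemLp f p μ) : MemLp (fun x => (f x).toReal) p μ := by
  refine ⟨hf.1.aemeasurable.ennreal_toReal.aestronglyMeasurable, lt_of_le_of_lt ?_ hf.2⟩
  refine eLpNorm_mono_enorm fun x => ?_
  rw [Real.enorm_of_nonneg ENNReal.toReal_nonneg]
  exact ENNReal.ofReal_toReal_le

theorem ae_ne_top_of_memLp {X : Type*} [MeasurableSpace X] {μ : Measure X} {p : ℝ≥0∞} (hp : p ≠ 0)
    {f : X → ℝ≥0∞} (hf : MemLp f p μ) : ∀ᵐ x ∂μ, f x ≠ ⊤ := by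
  by_cases hpt : p = ⊤
  · subst hpt
    have h := hf.2
    rw [eLpNorm_exponent_top] at h
    filter_upwards [ae_le_eLpNormEssSup (f := f) (μ := μ)] with x hx
    exact (lt_of_le_of_lt hx h).ne
  · have h := (eLpNorm_lt_top_iff_lintegral_rpow_enorm_lt_top hp hpt).1 hf.2
    have hm : AEMeasurable (fun x => ‖f x‖ₑ ^ p.toReal) μ := by
      exact hf.1.aemeasurable.pow_const _
    filter_upwards [ae_lt_top' hm h.ne] with x hx hx'
    rw [hx', enorm_eq_self, ENNReal.top_rpow_of_pos (ENNReal.toReal_pos hp hpt)] at hx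
    exact absurd hx (lt_irrefl _)


/-! ### Passage to the limit in the mollified energy identity -/

theorem inner_nonlin_molL {η : R3 → ℝ} (hη : IsMollifier η) (u : L2V) :
    inner ℝ (nonlin hη u) (molL hη u) =
      ∫ x, inner ℝ (fderiv ℝ (mol η (mol η u)) x (u x)) (u x) := by
  rw [inner_nonlin, mol_congr_ae η (coeFn_molL hη u)]

/-- The multiplier estimate that controls the trilinear term. -/
def SobolevBound (s m a : ℝ) (C : ℝ≥0) : Prop :=
  ∀ (f : R3 → ℝ) (g : Fin 3 → R3 → ℝ), MemLp f (ENNReal.ofReal 2) volume →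
    (∀ i, MemLp (g i) (ENNReal.ofReal 2) volume) → (∀ i, HasWeakDeriv i f (g i)) →
    MemLp f (ENNReal.ofReal a) volume →
    homSobolevNorm s m f ≤ C * (eLpNorm f (ENNReal.ofReal a) volume +
      (eLpNorm f (ENNReal.ofReal 2) volume + ∑ i, eLpNorm (g i) (ENNReal.ofReal 2) volume))

section
variable {s m a r α : ℝ} {C : ℝ≥0} {u : L2V} {G : Fin 3 → Fin 3 → R3 → ℝ}

theorem tendsto_inner_nonlin_molL (har : a.HolderConjugate r) (hC : SobolevBound s m a C) (hα : 1 ≤ α)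
    (hu : IsDivFree u) (hG : IsWeakGrad u G) (hua : eLpNorm u (ENNReal.ofReal a) volume ≠ ⊤)
    (hA : sobMultNorm s m r G ≠ ⊤) (hN : sobolevNorm α u ≠ ⊤) :
    Tendsto (fun n => inner ℝ (nonlin (isMollifier_ker n) u) (molL (isMollifier_ker n) u)) atTop (𝓝 0) := by
  have e2 : ENNReal.ofReal 2 = 2 := by norm_num
  have hG2 : ∀ i j, MemLp (G i j) (ENNReal.ofReal 2) volume := fun i j => by
    rw [e2]; exact (hG.eLpNorm_le hα hN i j).1
  have hu2 : MemLp u (ENNReal.ofReal 2) volume := by rw [e2]; exact Lp.memLp u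
  have hua' : MemLp u (ENNReal.ofReal a) volume := ⟨(Lp.memLp u).1, hua.lt_top⟩
  have h1 := ENNReal.Tendsto.const_mul (a := 9 * C * (sobMultNorm s m r G * eLpNorm u (ENNReal.ofReal a) volume))
    (tendsto_defect har.lt.le hua' hu2 hG2)
    (Or.inr (ENNReal.mul_ne_top (ENNReal.mul_ne_top (by norm_num) (by simp)) (ENNReal.mul_ne_top hA hua)))
  rw [mul_zero] at h1
  rw [tendsto_iff_edist_tendsto_0]
  refine tendsto_of_tendsto_of_tendsto_of_le_of_le tendsto_const_nhds h1 (fun _ => zero_le) fun n => ?_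
  simp only [edist_zero_right]
  rw [inner_nonlin_molL]
  exact (isMollifier_ker n).enorm_trilinear_le har hC hu hG hG2 hua' hA

/-- A bound independent of η, for dominated convergence in time. The constant is 54 = 9 · 6, from
the trilinear estimate and the bound on the defect; the inner 9 counts the entries of ∇u. -/
theorem IsMollifier.norm_inner_nonlin_molL_le {η : R3 → ℝ} (hη : IsMollifier η)
    (har : a.HolderConjugate r) (hC : SobolevBound s m a C) (hα : 1 ≤ α)
    (hu : IsDivFree u) (hG : IsWeakGrad u G) (hua : eLpNorm u (ENNReal.ofReal a) volume ≠ ⊤)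
    (hA : sobMultNorm s m r G ≠ ⊤) (hN : sobolevNorm α u ≠ ⊤) :
    ‖inner ℝ (nonlin hη u) (molL hη u)‖ ≤ 54 * C * ((sobMultNorm s m r G).toReal *
      (eLpNorm u (ENNReal.ofReal a) volume).toReal * ((eLpNorm u (ENNReal.ofReal a) volume).toReal +
        (‖u‖ + 9 * (sobolevNorm α u).toReal))) := by
  have e2 : ENNReal.ofReal 2 = 2 := by norm_num
  have hG2 : ∀ i j, MemLp (G i j) (ENNReal.ofReal 2) volume := fun i j => by
    rw [e2]; exact (hG.eLpNorm_le hα hN i j).1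
  have hu2 : MemLp u (ENNReal.ofReal 2) volume := by rw [e2]; exact Lp.memLp u
  have hua' : MemLp u (ENNReal.ofReal a) volume := ⟨(Lp.memLp u).1, hua.lt_top⟩
  have h1 := hη.enorm_trilinear_le har hC hu hG hG2 hua' hA
  have h2 := hη.defect_le har.lt.le hua' hu2 hG2
  have h3 : eLpNorm u (ENNReal.ofReal 2) volume = ‖u‖ₑ := by rw [e2, Lp.enorm_def]
  have h4 : ∑ i, ∑ j, eLpNorm (G i j) (ENNReal.ofReal 2) volume ≤ 9 * sobolevNorm α u := by
    refine (Finset.sum_le_sum fun i _ => Finset.sum_le_sum fun j _ => ?_).trans_eq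
      (b := ∑ _i : Fin 3, ∑ _j : Fin 3, sobolevNorm α u) ?_
    · rw [e2]; exact (hG.eLpNorm_le hα hN i j).2
    · simp only [Finset.sum_const, Finset.card_univ, Fintype.card_fin, nsmul_eq_mul, ← mul_assoc]
      norm_num
  rw [← inner_nonlin_molL] at h1
  have h5 : ‖inner ℝ (nonlin hη u) (molL hη u)‖ₑ ≤ 9 * C * (sobMultNorm s m r G *
      eLpNorm u (ENNReal.ofReal a) volume) * (6 * (eLpNorm u (ENNReal.ofReal a) volume +
        (‖u‖ₑ + 9 * sobolevNorm α u))) := by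
    refine h1.trans (mul_le_mul_right (h2.trans ?_) _)
    rw [h3]
    gcongr
  have hr : eLpNorm u (ENNReal.ofReal a) volume + (‖u‖ₑ + 9 * sobolevNorm α u) ≠ ⊤ :=
    ENNReal.add_ne_top.2 ⟨hua, ENNReal.add_ne_top.2 ⟨enorm_ne_top, ENNReal.mul_ne_top (by norm_num) hN⟩⟩
  have h6 := ENNReal.toReal_mono (ENNReal.mul_ne_top (ENNReal.mul_ne_top
    (ENNReal.mul_ne_top (by norm_num) (by simp)) (ENNReal.mul_ne_top hA hua))
    (ENNReal.mul_ne_top (by norm_num) hr)) h5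
  rw [toReal_enorm] at h6
  refine h6.trans_eq ?_
  simp only [ENNReal.toReal_mul]
  rw [ENNReal.toReal_add hua (ENNReal.add_ne_top.1 hr).2,
    ENNReal.toReal_add enorm_ne_top (ENNReal.add_ne_top.1 (ENNReal.add_ne_top.1 hr).2).2,
    ENNReal.toReal_mul, toReal_enorm]
  simp only [ENNReal.toReal_ofNat, ENNReal.coe_toReal]
  ring

end

section
variable {α : ℝ} {T : ℝ≥0∞} {u₀ : L2V} {u : ℝ → L2V}

theorem IsLerayHopf.ae_sobolevNorm_ne_top (hu : IsLerayHopf α T u₀ u) :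
    ∀ᵐ t ∂(volume.restrict (openTime T)), sobolevNorm α (u t) ≠ ⊤ :=
  ae_ne_top_of_memLp (by norm_num) hu.mem_L2_H

theorem IsLerayHopf.ae_fracNormSq_ne_top (hα : 0 ≤ α) (hu : IsLerayHopf α T u₀ u) :
    ∀ᵐ t ∂(volume.restrict (openTime T)), fracNormSq α (u t) ≠ ⊤ := by
  filter_upwards [hu.ae_sobolevNorm_ne_top] with t ht
  exact ((fracNormSq_le hα _).trans_lt (ENNReal.pow_lt_top ht.lt_top)).ne

theorem IsLerayHopf.aestronglyMeasurable_comp {E : Type*} [TopologicalSpace E]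
    [TopologicalSpace.PseudoMetrizableSpace E] (hu : IsLerayHopf α T u₀ u)
    {F : L2V → E} (hF : Continuous F) :
    AEStronglyMeasurable (fun t => F (u t)) (volume.restrict (openTime T)) :=
  hF.comp_aestronglyMeasurable hu.mem_Linfty_L2.1

theorem IsLerayHopf.aestronglyMeasurable_dissip {η : R3 → ℝ} (hη : IsMollifier η) (hα : 0 ≤ 2 * α)
    (hu : IsLerayHopf α T u₀ u) : AEStronglyMeasurable
      (fun t => inner ℝ (dissip hη hα (u t)) (molL hη (u t))) (volume.restrict (openTime T)) :=
  hu.aestronglyMeasurable_comp (F := fun v => inner ℝ (dissip hη hα v) (molL hη v))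
    ((dissip hη hα).continuous.inner (molL hη).continuous)

theorem IsLerayHopf.integrable_fracNormSq (hα : 0 ≤ α) (hu : IsLerayHopf α T u₀ u) :
    IntegrableOn (fun t => (fracNormSq α (u t)).toReal) (openTime T) := by
  have h2α : 0 ≤ 2 * α := by positivity
  refine Integrable.mono' (memLp_toReal hu.mem_L2_H).integrable_sq ?_ ?_
  -- Measurability in time comes from the mollified dissipations, which are continuous functions of
  -- u(t).
  · refine aestronglyMeasurable_of_tendsto_ae atTop
      (fun n => hu.aestronglyMeasurable_dissip (isMollifier_ker n) h2α) ?_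
    filter_upwards [hu.ae_fracNormSq_ne_top hα] with t ht
    exact tendsto_inner_dissip_molL h2α ht
  · filter_upwards [hu.ae_sobolevNorm_ne_top] with t ht
    rw [Real.norm_of_nonneg ENNReal.toReal_nonneg, ← ENNReal.toReal_pow]
    exact ENNReal.toReal_mono (ENNReal.pow_ne_top ht) (fracNormSq_le hα _)

theorem IsLerayHopf.tendsto_integral_dissip (hα : 0 ≤ α) (h2α : 0 ≤ 2 * α) (hu : IsLerayHopf α T u₀ u)
    {t : ℝ} (ht : t ∈ halfTime T) :
    Tendsto (fun n => ∫ τ in Ioc 0 t, inner ℝ (dissip (isMollifier_ker n) h2α (u τ))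
      (molL (isMollifier_ker n) (u τ))) atTop (𝓝 (∫ τ in Ioc 0 t, (fracNormSq α (u τ)).toReal)) := by
  have hsub := Ioc_subset_openTime ht
  have hae := ae_restrict_of_ae_restrict_of_subset hsub (hu.ae_fracNormSq_ne_top hα)
  refine tendsto_integral_of_dominated_convergence _
    (fun n => (hu.aestronglyMeasurable_dissip (isMollifier_ker n) h2α).mono_measure
      (Measure.restrict_mono_set _ hsub)) ((hu.integrable_fracNormSq hα).mono_set hsub) (fun n => ?_) ?_
  · filter_upwards [hae] with τ hτ using abs_inner_dissip_molL_le (isMollifier_ker n) h2α hτ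
  · filter_upwards [hae] with τ hτ using tendsto_inner_dissip_molL h2α hτ

variable {s m a r : ℝ} {C : ℝ≥0} {p q : ℝ≥0∞} {G : ℝ → Fin 3 → Fin 3 → R3 → ℝ}

/-- Hölder's inequality in time with 1/p + 1/q = 1/2 puts the product of the multiplier norm and the
L^a norm in L². The last factor of the dominating function is also in L² on (0, t], because q ≥ 2
and the interval is bounded. -/
theorem IsLerayHopf.tendsto_integral_nonlin (hu : IsLerayHopf α T u₀ u) (har : a.HolderConjugate r)
    (hC : SobolevBound s m a C) (hα : 1 ≤ α) (hp : 2 ≤ p) (hpq : 1 / p + 1 / q = 1 / 2)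
    (hG : ∀ᵐ t ∂(volume.restrict (openTime T)), IsWeakGrad (u t) (G t))
    (hGp : MemLp (fun t => sobMultNorm s m r (G t)) p (volume.restrict (openTime T)))
    (huq : MemLp (fun t => eLpNorm (u t) (ENNReal.ofReal a) volume) q (volume.restrict (openTime T)))
    {t : ℝ} (ht : t ∈ halfTime T) :
    Tendsto (fun n => ∫ τ in Ioc 0 t, inner ℝ (nonlin (isMollifier_ker n) (u τ))
      (molL (isMollifier_ker n) (u τ))) atTop (𝓝 0) := by
  have hsub := Ioc_subset_openTime ht
  have hle := Measure.restrict_mono_set (volume : Measure ℝ) hsub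
  have : ENNReal.HolderTriple p q 2 := ⟨by simpa only [one_div] using hpq⟩
  have hq : 2 ≤ q := by
    rw [← ENNReal.inv_le_inv, ← one_div, ← one_div, ← hpq]
    exact le_add_self
  have hp0 : p ≠ 0 := (lt_of_lt_of_le (by norm_num) hp).ne'
  have hq0 : q ≠ 0 := (lt_of_lt_of_le (by norm_num) hq).ne'
  have mA := (memLp_toReal hGp).mono_measure hle
  have mB := (memLp_toReal huq).mono_measure hle
  have mN := (memLp_toReal hu.mem_L2_H).mono_measure hle
  have mu : MemLp (fun τ => ‖u τ‖) 2 (volume.restrict (Ioc 0 t)) :=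
    ((hu.mem_Linfty_L2.mono_measure hle).mono_exponent le_top).norm
  have mAB : MemLp (fun τ => (sobMultNorm s m r (G τ)).toReal *
      (eLpNorm (u τ) (ENNReal.ofReal a) volume).toReal) 2 (volume.restrict (Ioc 0 t)) := mB.mul' mA
  have mS := (mB.mono_exponent hq).add (mu.add (mN.const_mul 9))
  have hint := (mAB.integrable_mul mS).const_mul (54 * (C : ℝ))
  have hae : ∀ᵐ τ ∂(volume.restrict (Ioc 0 t)), IsDivFree (u τ) ∧ IsWeakGrad (u τ) (G τ) ∧
      eLpNorm (u τ) (ENNReal.ofReal a) volume ≠ ⊤ ∧ sobMultNorm s m r (G τ) ≠ ⊤ ∧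
      sobolevNorm α (u τ) ≠ ⊤ := by
    refine ae_restrict_of_ae_restrict_of_subset hsub ?_
    filter_upwards [hu.div_free, hG, ae_ne_top_of_memLp hq0 huq, ae_ne_top_of_memLp hp0 hGp,
      hu.ae_sobolevNorm_ne_top] with τ h1 h2 h3 h4 h5 using ⟨h1, h2, h3, h4, h5⟩
  have key : Tendsto (fun n => ∫ τ in Ioc 0 t, inner ℝ (nonlin (isMollifier_ker n) (u τ))
      (molL (isMollifier_ker n) (u τ))) atTop (𝓝 (∫ _τ in Ioc 0 t, (0 : ℝ))) := ?_
  · rwa [integral_zero] at key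
  refine tendsto_integral_of_dominated_convergence _ (fun n => ?_) hint (fun n => ?_) ?_
  · exact (hu.aestronglyMeasurable_comp (F := fun v => inner ℝ (nonlin (isMollifier_ker n) v)
      (molL (isMollifier_ker n) v)) ((continuous_nonlin _).inner (molL _).continuous)).mono_measure hle
  · filter_upwards [hae] with τ hτ
    exact (isMollifier_ker n).norm_inner_nonlin_molL_le har hC hα hτ.1 hτ.2.1 hτ.2.2.1 hτ.2.2.2.1 hτ.2.2.2.2
  · filter_upwards [hae] with τ hτ
    exact tendsto_inner_nonlin_molL har hC hα hτ.1 hτ.2.1 hτ.2.2.1 hτ.2.2.2.1 hτ.2.2.2.2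

theorem IsLerayHopf.integral_inner_drift {η : R3 → ℝ} (hη : IsMollifier η) (hα : 0 ≤ 2 * α)
    (hu : IsLerayHopf α T u₀ u) {t : ℝ} (ht : t ∈ halfTime T) :
    ∫ τ in Ioc 0 t, inner ℝ (drift hη hα (u τ)) (molL hη (u τ)) =
      (∫ τ in Ioc 0 t, inner ℝ (nonlin hη (u τ)) (molL hη (u τ))) -
        ∫ τ in Ioc 0 t, inner ℝ (dissip hη hα (u τ)) (molL hη (u τ)) := by
  have hsub := Ioc_subset_openTime ht
  have i1 : IntegrableOn (fun τ => inner ℝ (drift hη hα (u τ)) (molL hη (u τ))) (Ioc 0 t) := by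
    refine hu.integrableOn_comp (F := fun v => inner ℝ (drift hη hα v) (molL hη v))
      ((continuous_drift hη hα).inner (molL hη).continuous) (fun M => ?_) hsub (by simp)
    obtain ⟨K, hK⟩ := exists_norm_drift_le hη hα M
    refine ⟨K * M, fun v hv => (norm_inner_le_norm _ _).trans ?_⟩
    exact mul_le_mul (hK v hv) ((norm_molL_le hη v).trans hv) (norm_nonneg _)
      ((norm_nonneg _).trans (hK v hv))
  have i2 : IntegrableOn (fun τ => inner ℝ (dissip hη hα (u τ)) (molL hη (u τ))) (Ioc 0 t) := by
    refine hu.integrableOn_comp (F := fun v => inner ℝ (dissip hη hα v) (molL hη v))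
      ((dissip hη hα).continuous.inner (molL hη).continuous) (fun M => ?_) hsub (by simp)
    refine ⟨‖dissip hη hα‖ * M * M, fun v hv => (norm_inner_le_norm _ _).trans ?_⟩
    have hM : 0 ≤ M := (norm_nonneg _).trans hv
    exact mul_le_mul ((ContinuousLinearMap.le_opNorm _ _).trans (by gcongr))
      ((norm_molL_le hη v).trans hv) (norm_nonneg _) (by positivity)
  rw [eq_sub_iff_add_eq, ← integral_add i1 i2]
  refine integral_congr_ae (ae_of_all _ fun τ => ?_)
  simp only
  rw [← inner_add_left, drift, sub_add_cancel]

theorem IsLerayHopf.tendsto_norm_mollified_sq (hu : IsLerayHopf α T u₀ u) (har : a.HolderConjugate r)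
    (hC : SobolevBound s m a C) (hα : 1 ≤ α) (h2α : 0 ≤ 2 * α) (hp : 2 ≤ p)
    (hpq : 1 / p + 1 / q = 1 / 2)
    (hG : ∀ᵐ t ∂(volume.restrict (openTime T)), IsWeakGrad (u t) (G t))
    (hGp : MemLp (fun t => sobMultNorm s m r (G t)) p (volume.restrict (openTime T)))
    (huq : MemLp (fun t => eLpNorm (u t) (ENNReal.ofReal a) volume) q (volume.restrict (openTime T)))
    {t : ℝ} (ht : t ∈ halfTime T) :
    Tendsto (fun n => ‖mollified (isMollifier_ker n) h2α u₀ u t‖ ^ 2) atTop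
      (𝓝 (‖u₀‖ ^ 2 - 2 * ∫ τ in Ioc 0 t, (fracNormSq α (u τ)).toReal)) := by
  simp only [hu.norm_mollified_sq _ h2α ht, hu.integral_inner_drift _ h2α ht]
  have h := ((tendsto_molL u₀).norm.pow 2).add (((hu.tendsto_integral_nonlin har hC hα hp hpq hG hGp
    huq ht).sub (hu.tendsto_integral_dissip (zero_le_one.trans hα) h2α ht)).const_mul 2)
  rwa [zero_sub, mul_neg, ← sub_eq_add_neg] at h

end


/-! ### The weakly continuous version -/

/-- The Banach-Alaoglu theorem. The limit along an ultrafilter makes the choice of a subsequence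
unnecessary. -/
theorem exists_tendsto_inner_hyperfilter {H : Type*} [NormedAddCommGroup H] [InnerProductSpace ℝ H]
    [CompleteSpace H] {x : ℕ → H} {M : ℝ} (hx : ∀ n, ‖x n‖ ≤ M) :
    ∃ y : H, ∀ w, Tendsto (fun n => inner ℝ (x n) w) (hyperfilter ℕ) (𝓝 (inner ℝ y w)) := by
  set F : ℕ → WeakDual ℝ H := fun n => StrongDual.toWeakDual (InnerProductSpace.toDual ℝ H (x n)) with hF
  have hK := WeakDual.isCompact_closedBall (𝕜 := ℝ) (E := H) 0 M
  obtain ⟨a, -, ha⟩ := hK.ultrafilter_le_nhds ((hyperfilter ℕ).map F) (by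
    rw [Filter.le_principal_iff]
    refine Filter.mem_map.2 (univ_mem' fun n => ?_)
    show InnerProductSpace.toDual ℝ H (x n) ∈ Metric.closedBall 0 M
    rw [mem_closedBall_zero_iff, LinearIsometryEquiv.norm_map]
    exact hx n)
  refine ⟨(InnerProductSpace.toDual ℝ H).symm (WeakDual.toStrongDual a), fun w => ?_⟩
  rw [InnerProductSpace.toDual_symm_apply]
  exact ((WeakDual.eval_continuous w).tendsto a).comp ha

theorem eq_zero_of_fhat_eq_zero {f : L2V} (h : ∀ j, fhat f j = 0) : f = 0 := by
  rw [← inner_self_eq_zero (𝕜 := ℝ), inner_eq_sum_fhat]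
  simp [h]

theorem molL_comm {η η' : R3 → ℝ} (hη : IsMollifier η) (hη' : IsMollifier η') (f : L2V) :
    molL hη (molL hη' f) = molL hη' (molL hη f) := by
  refine sub_eq_zero.1 (eq_zero_of_fhat_eq_zero fun j => ?_)
  have h : fhat (molL hη (molL hη' f) - molL hη' (molL hη f)) j =
      fhat (molL hη (molL hη' f)) j - fhat (molL hη' (molL hη f)) j := (fhatL j).map_sub _ _
  rw [h, sub_eq_zero]
  simp only [fhat_molL]
  refine Lp.ext ?_
  filter_upwards [coeFn_mulL hη.memLp_hat (mulL hη'.memLp_hat (fhat f j)),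
    coeFn_mulL hη'.memLp_hat (mulL hη.memLp_hat (fhat f j)),
    coeFn_mulL hη'.memLp_hat (fhat f j), coeFn_mulL hη.memLp_hat (fhat f j)] with ξ h1 h2 h3 h4
  rw [h1, h2, h3, h4]
  ring

theorem eq_of_molL_eq {f g : L2V} (h : ∀ n, molL (isMollifier_ker n) f = molL (isMollifier_ker n) g) :
    f = g :=
  tendsto_nhds_unique (tendsto_molL f) (by simpa only [h] using tendsto_molL g)

theorem eqOn_halfTime_of_ae_eq {E : Type*} [TopologicalSpace E] [T2Space E] {T : ℝ≥0∞} {f g : ℝ → E}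
    (h : ∀ᵐ t ∂(volume.restrict (openTime T)), f t = g t) (hf : ContinuousOn f (halfTime T))
    (hg : ContinuousOn g (halfTime T)) : EqOn f g (halfTime T) := by
  have hO := Measure.eqOn_open_of_ae_eq h (isOpen_openTime T) (hf.mono (openTime_subset_halfTime T))
    (hg.mono (openTime_subset_halfTime T))
  refine hO.of_subset_closure hf hg (openTime_subset_halfTime T) fun t ht => ?_
  obtain ⟨b, hb, htb⟩ := exists_lt_mem_openTime ht
  have h1 : Ioc t b ⊆ openTime T := fun τ hτ =>
    ⟨ht.1.trans_lt hτ.1, (ENNReal.ofReal_le_ofReal hτ.2).trans_lt hb.2⟩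
  refine closure_mono h1 ?_
  rw [closure_Ioc htb.ne]
  exact left_mem_Icc.2 htb.le

section
variable {α : ℝ} {T : ℝ≥0∞} {u₀ : L2V} {u : ℝ → L2V}

theorem IsLerayHopf.continuousOn_mollified {η : R3 → ℝ} (hη : IsMollifier η) (hα : 0 ≤ 2 * α)
    (hu : IsLerayHopf α T u₀ u) : ContinuousOn (mollified hη hα u₀ u) (halfTime T) := by
  intro t ht
  obtain ⟨b, hb, htb⟩ := exists_lt_mem_openTime ht
  have hg : IntegrableOn (fun τ => leray (drift hη hα (u τ))) (Ioc 0 b) := leray.integrable_comp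
    (hu.integrableOn_drift hη hα (Ioc_subset_openTime (openTime_subset_halfTime T hb)) (by simp))
  have h1 := intervalIntegral.continuousOn_primitive
    ((integrableOn_Icc_iff_integrableOn_Ioc (by simp)).2 hg)
  have h2 : ContinuousWithinAt (mollified hη hα u₀ u) (Icc 0 b) t :=
    continuousWithinAt_const.add (h1 t ⟨ht.1, htb.le⟩)
  refine h2.mono_of_mem_nhdsWithin ?_
  filter_upwards [self_mem_nhdsWithin, mem_nhdsWithin_of_mem_nhds (Iio_mem_nhds htb)] with τ h3 h4
  exact ⟨h3.1, h4.le⟩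

/-- Mollifications commute, so the identity holds for almost every time; both sides are continuous
in time. -/
theorem IsLerayHopf.molL_mollified (hu : IsLerayHopf α T u₀ u) (hα : 0 ≤ 2 * α) {η η' : R3 → ℝ}
    (hη : IsMollifier η) (hη' : IsMollifier η') {t : ℝ} (ht : t ∈ halfTime T) :
    molL hη (mollified hη' hα u₀ u t) = molL hη' (mollified hη hα u₀ u t) := by
  refine eqOn_halfTime_of_ae_eq (f := fun t => molL hη (mollified hη' hα u₀ u t))
    (g := fun t => molL hη' (mollified hη hα u₀ u t)) ?_
    ((molL hη).continuous.comp_continuousOn (hu.continuousOn_mollified hη' hα))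
    ((molL hη').continuous.comp_continuousOn (hu.continuousOn_mollified hη hα)) ht
  filter_upwards [hu.molL_ae_eq hη hα, hu.molL_ae_eq hη' hα] with τ h1 h2
  rw [← h1, ← h2, molL_comm]

/-- Tested against w, both sides are continuous on [0, T) and agree almost everywhere, so they agree
at every time, including t = 0. -/
theorem IsLerayHopf.molL_version {η : R3 → ℝ} (hη : IsMollifier η) (hα : 0 ≤ 2 * α)
    (hu : IsLerayHopf α T u₀ u) {v : ℝ → L2V} (hv : IsWeaklyContVersion T u v) {t : ℝ}
    (ht : t ∈ halfTime T) : molL hη (v t) = mollified hη hα u₀ u t := by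
  refine ext_inner_right ℝ fun w => ?_
  refine eqOn_halfTime_of_ae_eq (f := fun t => inner ℝ (molL hη (v t)) w)
    (g := fun t => inner ℝ (mollified hη hα u₀ u t) w) ?_ ?_
    ((hu.continuousOn_mollified hη hα).inner continuousOn_const) ht
  · filter_upwards [hu.molL_ae_eq hη hα, hv.1] with τ h1 h2
    rw [h2, h1]
  · simp only [inner_molL_left]
    exact hv.2 _

/-- Fix t and let x be a weak limit of the mollified solutions at t. Since mollifications commute,
η_n ⋆ x is the limit of η_k ⋆ (the n-th mollified solution) as k grows, which is the n-th mollified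
solution. Hence ‖x‖ ≤ |M|, and x = u(t) for almost every t. Weak continuity passes to the limit,
because pairings with w converge uniformly in t at the rate |M| ‖w - η_n ⋆ w‖. -/
theorem IsLerayHopf.exists_version (hα : 0 ≤ 2 * α) (hu : IsLerayHopf α T u₀ u) {M : ℝ}
    (hM : ∀ t ∈ halfTime T, ∃ l ≤ M ^ 2,
      Tendsto (fun n => ‖mollified (isMollifier_ker n) hα u₀ u t‖ ^ 2) atTop (𝓝 l)) :
    ∃ v, IsWeaklyContVersion T u v := by
  have h1 : ∀ t, ∃ x : L2V, t ∈ halfTime T →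
      ∀ n, molL (isMollifier_ker n) x = mollified (isMollifier_ker n) hα u₀ u t := by
    intro t
    by_cases ht : t ∈ halfTime T
    swap
    · exact ⟨0, fun h => absurd h ht⟩
    obtain ⟨l, -, hl⟩ := hM t ht
    obtain ⟨K, hK⟩ := hl.bddAbove_range
    have hK' : ∀ n, ‖mollified (isMollifier_ker n) hα u₀ u t‖ ≤ √K := fun n =>
      Real.le_sqrt_of_sq_le (hK (mem_range_self n))
    obtain ⟨x, hx⟩ := exists_tendsto_inner_hyperfilter hK'
    refine ⟨x, fun _ n => ext_inner_right ℝ fun w => ?_⟩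
    have h2 := hx (molL (isMollifier_ker n) w)
    simp only [← inner_molL_left, hu.molL_mollified hα (isMollifier_ker n) (isMollifier_ker _) ht] at h2
    refine tendsto_nhds_unique h2 (Tendsto.mono_left ?_ Nat.hyperfilter_le_atTop)
    exact (tendsto_molL _).inner tendsto_const_nhds
  choose v hv using h1
  have hvM : ∀ t ∈ halfTime T, ‖v t‖ ≤ |M| := by
    intro t ht
    obtain ⟨l, hlM, hl⟩ := hM t ht
    simp only [← hv t ht] at hl
    have := tendsto_nhds_unique hl ((tendsto_molL (v t)).norm.pow 2)
    rw [← abs_norm (v t)]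
    exact sq_le_sq.1 (this ▸ hlM)
  refine ⟨v, ?_, fun w => ?_⟩
  · have h2 : ∀ᵐ t ∂(volume.restrict (openTime T)), ∀ n,
        molL (isMollifier_ker n) (u t) = mollified (isMollifier_ker n) hα u₀ u t :=
      ae_all_iff.2 fun n => hu.molL_ae_eq (isMollifier_ker n) hα
    filter_upwards [h2, ae_restrict_mem (isOpen_openTime T).measurableSet] with t ht hmem
    exact eq_of_molL_eq fun n => by rw [ht n, hv t (openTime_subset_halfTime T hmem) n]
  · have h3 : TendstoUniformlyOn (fun n t => inner ℝ (mollified (isMollifier_ker n) hα u₀ u t) w)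
        (fun t => inner ℝ (v t) w) atTop (halfTime T) := by
      rw [Metric.tendstoUniformlyOn_iff]
      intro ε hε
      have h4 : Tendsto (fun n => |M| * ‖w - molL (isMollifier_ker n) w‖) atTop (𝓝 0) := by
        simpa using ((tendsto_molL w).const_sub w).norm.const_mul |M|
      filter_upwards [h4.eventually_lt_const hε] with n hn t ht
      refine lt_of_le_of_lt ?_ hn
      rw [← hv t ht n, inner_molL_left, Real.dist_eq, ← inner_sub_right]
      exact (abs_real_inner_le_norm _ _).trans (by gcongr; exact hvM t ht)
    exact h3.continuousOn (Eventually.of_forall fun n =>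
      (hu.continuousOn_mollified (isMollifier_ker n) hα).inner continuousOn_const).frequently

theorem IsLerayHopf.totalEnergy_version (hα : 0 ≤ α) (h2α : 0 ≤ 2 * α) (hu : IsLerayHopf α T u₀ u)
    {v : ℝ → L2V} (hv : IsWeaklyContVersion T u v) {t : ℝ} (ht : t ∈ halfTime T)
    (h : Tendsto (fun n => ‖mollified (isMollifier_ker n) h2α u₀ u t‖ ^ 2) atTop
      (𝓝 (‖u₀‖ ^ 2 - 2 * ∫ τ in Ioc 0 t, (fracNormSq α (u τ)).toReal))) :
    totalEnergy α v t = ‖u₀‖ₑ ^ 2 / 2 := by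
  have hsub := Ioc_subset_openTime ht
  simp only [← hu.molL_version _ h2α hv ht] at h
  have h1 := tendsto_nhds_unique h ((tendsto_molL (v t)).norm.pow 2)
  have h2 : ∫⁻ τ in Ioc 0 t, fracNormSq α (v τ) =
      ENNReal.ofReal (∫ τ in Ioc 0 t, (fracNormSq α (u τ)).toReal) := by
    rw [ofReal_integral_eq_lintegral_ofReal ((hu.integrable_fracNormSq hα).mono_set hsub)
      (ae_of_all _ fun τ => ENNReal.toReal_nonneg)]
    refine lintegral_congr_ae (ae_restrict_of_ae_restrict_of_subset hsub ?_)
    filter_upwards [hv.1, hu.ae_fracNormSq_ne_top hα] with τ h3 h4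
    rw [h3, ENNReal.ofReal_toReal h4]
  have h3 : ∀ x : L2V, ‖x‖ₑ ^ 2 / 2 = ENNReal.ofReal (‖x‖ ^ 2 / 2) := by
    intro x
    rw [ENNReal.ofReal_div_of_pos two_pos, ENNReal.ofReal_pow (norm_nonneg _), ofReal_norm,
      ENNReal.ofReal_ofNat]
  rw [totalEnergy, h2, h3, h3, ← ENNReal.ofReal_add (by positivity)
    (integral_nonneg fun τ => ENNReal.toReal_nonneg)]
  congr 1
  linarith

end

/-! ### The exponents of the theorem -/

/-- The embedding is used with ϑ = 1 + θ, for which 1/m = ϑ/2 + (1-ϑ)/a is an identity in θ.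
Dividing by 1 + β only lowers the order, so s ≤ ϑ, and θ < 0 gives ϑ < 1. -/
theorem exists_sobolevBound {β θ : ℝ} (hβ : 0 ≤ β) (hθ : -1 ≤ θ) (hθ' : θ < 0) :
    ∃ C : ℝ≥0, SobolevBound ((1 + θ) / (1 + β)) ((6 - 3 * θ) / (3 - θ ^ 2))
      ((12 - 6 * θ) / (3 - θ)) C := by
  have p1 : 0 < 3 - θ ^ 2 := by nlinarith
  have p2 : 0 < 6 - 3 * θ := by linarith
  have p3 : 0 < 3 - θ := by linarith
  have p4 : 0 < 12 - 6 * θ := by linarith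
  have p5 : 0 < 1 + β := by linarith
  have hs0 : 0 ≤ (1 + θ) / (1 + β) := div_nonneg (by linarith) p5.le
  have hsϑ : (1 + θ) / (1 + β) ≤ 1 + θ := div_le_self (by linarith) (by linarith)
  set s := (1 + θ) / (1 + β) with hs
  set m := (6 - 3 * θ) / (3 - θ ^ 2) with hm
  have hm0 : 0 < m := div_pos p2 p1
  have hsm : s * m ≤ (1 + θ) * m := mul_le_mul_of_nonneg_right hsϑ hm0.le
  have hsm0 : 0 ≤ s * m := mul_nonneg hs0 hm0.le
  -- This is the condition m* ≤ 6 at order 1 + θ; lowering the order to s only helps. The bound m* ≥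
  -- 2 follows from m ≥ 2.
  have hden : m / 2 ≤ 3 - (1 + θ) * m := by
    have : m * (3 / 2 + θ) ≤ 3 := by
      rw [hm, div_mul_eq_mul_div, div_le_iff₀ p1]
      linarith
    linarith
  have hden0 : 0 < 3 - s * m := by linarith
  refine exists_homSobolevNorm_le hs0 hsϑ (fun h => ?_) (by linarith) ?_ hm0 ?_ ?_ ?_
  · rw [hs, div_eq_zero_iff] at h
    exact h.resolve_right p5.ne'
  · rw [lt_div_iff₀ p3]; linarith
  · rw [hm]
    field_simp
    ring
  · rw [le_div_iff₀ hden0]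
    have : 2 ≤ m := by
      rw [hm, le_div_iff₀ p1]; nlinarith
    linarith
  · rw [div_le_iff₀ hden0]
    linarith

end FracNS

/-! ### Conclusion -/

theorem corollary1p6 (α β θ : ℝ) (hα : 1 ≤ α) (hβ : 0 ≤ β) (hθ : -1 ≤ θ) (hθ' : θ < 0)
    (T : ℝ≥0∞) (hT : 0 < T) (p q : ℝ≥0∞) (hp : 2 ≤ p) (hpq : 1 / p + 1 / q = 1 / 2)
    (u₀ : FracNS.L2V) (u : ℝ → FracNS.L2V) (hu : FracNS.IsLerayHopf α T u₀ u)
    (G : ℝ → Fin 3 → Fin 3 → FracNS.R3 → ℝ)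
    (hG : ∀ᵐ t ∂(volume.restrict (FracNS.openTime T)), FracNS.IsWeakGrad (u t) (G t))
    (hGp : MemLp (fun t => FracNS.sobMultNorm ((1 + θ) / (1 + β)) ((6 - 3 * θ) / (3 - θ ^ 2))
      ((12 - 6 * θ) / (9 - 5 * θ)) (G t)) p (volume.restrict (FracNS.openTime T)))
    (huq : MemLp (fun t => eLpNorm (u t) (ENNReal.ofReal ((12 - 6 * θ) / (3 - θ))) volume) q
      (volume.restrict (FracNS.openTime T))) :
    (∃ v, FracNS.IsWeaklyContVersion T u v) ∧
    ∀ v, FracNS.IsWeaklyContVersion T u v → ∀ t ∈ FracNS.halfTime T,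
      FracNS.totalEnergy α v t = ‖u₀‖ₑ ^ 2 / 2 := by
  obtain ⟨C, hC⟩ := FracNS.exists_sobolevBound hβ hθ hθ'
  have hα0 : 0 ≤ α := zero_le_one.trans hα
  have h2α : 0 ≤ 2 * α := by positivity
  have har : ((12 - 6 * θ) / (3 - θ)).HolderConjugate ((12 - 6 * θ) / (9 - 5 * θ)) := by
    have p3 : 0 < 3 - θ := by linarith
    have p4 : 0 < 12 - 6 * θ := by linarith
    refine Real.holderConjugate_iff.2 ⟨by rw [lt_div_iff₀ p3]; linarith, ?_⟩
    rw [inv_div, inv_div, ← add_div, div_eq_one_iff_eq p4.ne']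
    ring
  -- The limit exists at every time and not merely almost every time. It both bounds the mollified
  -- solutions, for the existence of a version, and identifies the norm of any version at each t.
  have key := fun (t : ℝ) (ht : t ∈ FracNS.halfTime T) =>
    hu.tendsto_norm_mollified_sq har hC hα h2α hp hpq hG hGp huq ht
  refine ⟨hu.exists_version h2α (M := ‖u₀‖) fun t ht => ⟨_, ?_, key t ht⟩, fun v hv t ht =>
    hu.totalEnergy_version hα0 h2α hv ht (key t ht)⟩
  have : 0 ≤ ∫ τ in Ioc 0 t, (FracNS.fracNormSq α (u τ)).toReal :=
    integral_nonneg fun τ => ENNReal.toReal_nonneg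
  linarith
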